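/- Let $k\ge 2$ be an integer and let $\mu_k^2(n)\in\{0,1\}$ be the indicator that the positive integer $n$ is $k$-free, i.e. not divisible by $p^k$ for any prime $p$. Let $g:\mathbb{N}\to\{-1,1\}$ be completely multiplicative ($\mathbb N$ being the positive integers), let $\chi$ be a real (i.e. real-valued) non-principal Dirichlet character, and suppose that $g$ is $\chi$-pretentious, that is, $$\sum_{p}\frac{1-g(p)\chi(p)}{p}<\infty ,$$ where $p$ runs over the primes. Suppose further that for some constant $c>0$ $$\sum_{p\le x}|1-g(p)\chi(p)|\ll \frac{x^{1/k}}{\exp(c\sqrt{\log x})}.$$ Let $f=\mu_k^2 g$, i.e. $f(n)=g(n)$ if $n$ is $k$-free and $f(n)=0$ otherwise. Then there exists a constant $\lambda>0$ such that $$\sum_{n\le x} f(n)\ll \frac{x^{1/k}}{\exp(\lambda(\log x)^{1/4})}.$$ Here $F(x)\ll G(x)$ means that there is a constant $C>0$ with $|F(x)|\le C|G(x)|$ for all sufficiently large real $x$; the implied constants and $\lambda$ may depend on $k$, $g$, $\chi$ and $c$. -/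

import Mathlib

open Filter Asymptotics

/-- An arithmetic function, regarded as a function of the positive integers (its value at `0` plays
no role), is completely multiplicative. -/
def IsCompletelyMultiplicative (g : ℕ → ℤ) : Prop :=
  g 1 = 1 ∧ ∀ m n : ℕ, 1 ≤ m → 1 ≤ n → g (m * n) = g m * g n

/-- `n` is `k`-free: no `k`-th power of a prime divides `n`. -/
def IsKFree (k n : ℕ) : Prop := ∀ p : ℕ, p.Prime → ¬ p ^ k ∣ n

open Classical in
/-- The indicator function `μ_k²` of the `k`-free integers. -/
noncomputable def kFreeIndicator (k n : ℕ) : ℤ := if IsKFree k n then 1 else 0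

/-- The finite set of primes `p ≤ x`. -/
noncomputable def primesUpTo (x : ℝ) : Finset ℕ := (Finset.Icc 1 ⌊x⌋₊).filter Nat.Prime

/-- The distance `𝔻(f, g; x)` of Granville and Soundararajan, for functions bounded by `1`. -/
noncomputable def pretentiousDist (f g : ℕ → ℂ) (x : ℝ) : ℝ :=
  √(∑ p ∈ primesUpTo x, (1 - (f p * starRingEnd ℂ (g p)).re) / (p : ℝ))

/-- `f` is `g`-pretentious: `𝔻(f, g; ∞) < ∞`. For functions bounded by `1` the distance
`𝔻(f, g; x)` is nondecreasing in `x`, so this says that it stays bounded as `x` grows. -/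
def IsPretentious (f g : ℕ → ℂ) : Prop := ∃ B : ℝ, ∀ x : ℝ, pretentiousDist f g x ≤ B

/-! Write `u` for `g`, `v` for `χ` and β = 1/k. At a prime where the two differ, |1 - g(p) χ(p)| is
1 or 2, so the hypothesis on primes counts the exceptional primes: there are O(x^β exp(-c √log x))
of them up to x. Since μ v is the Dirichlet inverse of v, one has u = h * v with h = u * (μ v). This
h is multiplicative with h(p^(j+1)) = u(p)^j (u(p) - v(p)), so it lives on integers composed of
exceptional primes, and ∑ |h(n)| n^(-β) exp(c' √log n) converges for 0 ≤ c' < c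
(`IsRealCharacterLike.summable_quotient`). Convolution with such an h preserves bounds x^β exp(-c'
√log x) for partial sums (`abs_sum_mul_le`).

Detecting k-free integers by μ_k²(n) = ∑ μ(d) over d^k ∣ n gives μ_k² u = A * u = h * (A * v), where
A takes the value a(d) = μ(d) u(d)^k at d^k. So everything reduces to A * v. The partial sums of v
are bounded by periodicity, and those of a are O(z exp(-c₃ √log z)). The hyperbola method, cut at d
= y^β exp(-ε √log y), then yields O(y^β exp(-ε √log y)) (`exists_abs_sum_powSupported_mul_le`). The
resulting saving has √log x in the exponent, more than the required (log x)^(1/4).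

For the sums of a: as u = ±1, a is μ for even k and μ u for odd k, and μ u = (v * μ u) * (μ v) with
v * μ u again summable against the weight. Both cases thus rest on the prime number theorem with
classical error term for μ and μ χ (`IsRealLFunction.exists_norm_sum_moebius_le`). It is proved for
both at once in terms of the entire function H(s) = (s - 1)^e L(s, ψ): Landau's lemma and the 3-4-1
inequality give a zero-free region, Borel–Carathéodory bounds 1/H inside it, and Perron's formula
with Cesàro weights keeps the shifted contour integral absolutely convergent. Since χ is fixed,
zeros near s = 1 are excluded by compactness, with constants depending on χ. -/

/-! ### Local growth of holomorphic functions: Borel–Carathéodory and Landau's lemma -/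

/-- A zero-free holomorphic function on a disc is an exponential. -/
lemma exists_eq_mul_exp_of_ne_zero {G : ℂ → ℂ} {c : ℂ} {R : ℝ} (hR : 0 < R)
    (hG : Differentiable ℂ G) (h0 : ∀ s ∈ Metric.ball c R, G s ≠ 0) :
    ∃ h : ℂ → ℂ, h c = 0 ∧ (∀ s ∈ Metric.ball c R, HasDerivAt h (deriv G s / G s) s) ∧
      ∀ s ∈ Metric.ball c R, G s = G c * Complex.exp (h s) := by
  have hd : DifferentiableOn ℂ (fun s => deriv G s / G s) (Metric.ball c R) := by
    refine DifferentiableOn.div ?_ hG.differentiableOn h0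
    exact (hG.differentiableOn (s := Set.univ)).deriv isOpen_univ |>.mono (Set.subset_univ _)
  obtain ⟨h, hc, hh⟩ := (hd.isExactOn_ball).with_val_at c 0
  refine ⟨h, hc, hh, fun s hs => ?_⟩
  have key : ∀ s ∈ Metric.ball c R,
      HasDerivAt (fun s => G s * Complex.exp (-h s)) 0 s := by
    intro s hs
    have := (hG s).hasDerivAt.mul ((hh s hs).neg.cexp)
    have e : deriv G s * Complex.exp ((-h) s) +
        G s * (Complex.exp ((-h) s) * -(deriv G s / G s)) = 0 := by
      have := h0 s hs
      field_simp
      ring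
    rw [e] at this
    exact this
  have hconst := (convex_ball c R).is_const_of_fderivWithin_eq_zero (𝕜 := ℂ)
    (f := fun s => G s * Complex.exp (-h s))
    (fun s hs => (key s hs).differentiableAt.differentiableWithinAt) (fun s hs => by
      rw [fderivWithin_of_isOpen Metric.isOpen_ball hs]
      ext; simpa using (key s hs).deriv) hs (Metric.mem_ball_self hR)
  simp only [hc, neg_zero, Complex.exp_zero, mul_one] at hconst
  rw [← hconst, mul_assoc, ← Complex.exp_add]
  simp

/-- A logarithm of G / G(c) exists on the disc, vanishes at c and has real part at most log B, so
Borel–Carathéodory bounds its modulus. Near c this bounds the logarithmic derivative; on the whole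
disc it keeps |G| from being small. -/
lemma norm_le_of_ne_zero_of_norm_le {G : ℂ → ℂ} {c : ℂ} {R B : ℝ} (hR : 0 < R)
    (hG : Differentiable ℂ G) (h0 : ∀ s ∈ Metric.ball c R, G s ≠ 0) (hB : 1 < B)
    (hGB : ∀ s ∈ Metric.ball c R, ‖G s‖ ≤ B * ‖G c‖) :
    ‖deriv G c / G c‖ ≤ 4 * Real.log B / R ∧
    ∀ s ∈ Metric.ball c R,
      ‖G c‖ * Real.exp (-(2 * Real.log B * ‖s - c‖ / (R - ‖s - c‖))) ≤ ‖G s‖ := by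
  obtain ⟨h, hc, hd, hh⟩ := exists_eq_mul_exp_of_ne_zero hR hG h0
  have hM : 0 < Real.log B := Real.log_pos hB
  have hGc : 0 < ‖G c‖ := norm_pos_iff.2 (h0 c (Metric.mem_ball_self hR))
  have hre : ∀ s ∈ Metric.ball c R, (h s).re ≤ Real.log B := by
    intro s hs
    have := hGB s hs
    rw [hh s hs, norm_mul, Complex.norm_exp, mul_comm] at this
    have := le_of_mul_le_mul_right this hGc
    rwa [Real.le_log_iff_exp_le (by linarith)]
  have hb : ∀ s ∈ Metric.ball c R, ‖h s‖ ≤ 2 * Real.log B * ‖s - c‖ / (R - ‖s - c‖) := by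
    intro s hs
    have hm : ∀ z ∈ Metric.ball (0:ℂ) R, z + c ∈ Metric.ball c R := by
      intro z hz; simpa [dist_eq_norm] using hz
    have := Complex.borelCaratheodory_zero (f := fun z => h (z + c)) (R := R) (z := s - c) hM
      (fun z hz => by
        have := (hd (z + c) (hm z hz)).comp_add_const z c
        exact this.differentiableAt.differentiableWithinAt)
      (fun z hz => hre _ (hm z hz)) hR (by simpa [dist_eq_norm] using hs) (by simpa using hc)
    simpa using this
  constructor
  · refine HasDerivAt.le_of_lip' (hd c (Metric.mem_ball_self hR)) (by positivity) ?_
    filter_upwards [Metric.ball_mem_nhds c (half_pos hR)] with s hs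
    have hs' : ‖s - c‖ < R / 2 := by simpa [dist_eq_norm] using hs
    have := hb s (Metric.ball_subset_ball (by linarith) hs)
    rw [hc, sub_zero]
    refine this.trans ?_
    rw [div_le_iff₀ (by linarith), div_mul_eq_mul_div, div_mul_eq_mul_div, le_div_iff₀ hR]
    have := mul_nonneg hM.le (norm_nonneg (s - c))
    nlinarith
  · intro s hs
    rw [hh s hs, norm_mul, Complex.norm_exp]
    gcongr
    have := (abs_le.1 ((Complex.abs_re_le_norm (h s)).trans (hb s hs))).1
    linarith

lemma dslope_of_zero {G : ℂ → ℂ} (hG : Differentiable ℂ G) {ρ : ℂ} (hρ : G ρ = 0) :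
    Differentiable ℂ (dslope G ρ) ∧ ∀ s, G s = (s - ρ) * dslope G ρ s := by
  constructor
  · have := (Complex.differentiableOn_dslope (f := G) (c := ρ) (s := Set.univ)
      Filter.univ_mem).2 hG.differentiableOn
    exact differentiableOn_univ.1 this
  · intro s
    have := sub_smul_dslope G ρ s
    rw [smul_eq_mul, hρ, sub_zero] at this
    exact this.symm

lemma norm_le_on_closedBall_of_sphere {G : ℂ → ℂ} (hG : Differentiable ℂ G) {c : ℂ} {R C : ℝ}
    (hR : 0 < R) (h : ∀ s ∈ Metric.sphere c R, ‖G s‖ ≤ C) :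
    ∀ s ∈ Metric.closedBall c R, ‖G s‖ ≤ C := by
  intro s hs
  refine Complex.norm_le_of_forall_mem_frontier_norm_le (U := Metric.ball c R)
    Metric.isBounded_ball hG.diffContOnCl ?_ ?_
  · rwa [frontier_ball c hR.ne']
  · rwa [closure_ball c hR.ne']

/-- Dividing out a zero close to the centre at least halves the growth. -/
lemma norm_dslope_le {G : ℂ → ℂ} (hG : Differentiable ℂ G) {c ρ : ℂ} {R B : ℝ} (hR : 0 < R)
    (hGB : ∀ s ∈ Metric.closedBall c R, ‖G s‖ ≤ B * ‖G c‖) (hB : 0 ≤ B) (hρ : G ρ = 0)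
    (hρc : ‖ρ - c‖ < R / 3) :
    ∀ s ∈ Metric.closedBall c R, ‖dslope G ρ s‖ ≤ B / 2 * ‖dslope G ρ c‖ := by
  obtain ⟨hd, hfac⟩ := dslope_of_zero hG hρ
  refine norm_le_on_closedBall_of_sphere hd hR fun s hs => ?_
  have h1 := hGB s (Metric.sphere_subset_closedBall hs)
  rw [hfac s, hfac c, norm_mul, norm_mul] at h1
  have hsR : ‖s - c‖ = R := by simpa [dist_eq_norm] using hs
  -- On the sphere ρ is at distance at least 2R/3 from s but at most R/3 from c; the ratio of the
  -- two is the factor 2 gained.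
  have h2 : 2 * R / 3 ≤ ‖s - ρ‖ := by
    have : ‖s - c‖ ≤ ‖s - ρ‖ + ‖ρ - c‖ := by
      simpa using norm_add_le (s - ρ) (ρ - c)
    linarith
  have h3 : ‖c - ρ‖ ≤ R / 3 := by rw [norm_sub_rev]; exact hρc.le
  have h4 := norm_nonneg (dslope G ρ s)
  have h5 := mul_nonneg hB (norm_nonneg (dslope G ρ c))
  have h6 : 2 * R / 3 * ‖dslope G ρ s‖ ≤ R / 3 * (B * ‖dslope G ρ c‖) := by
    calc _ ≤ ‖s - ρ‖ * ‖dslope G ρ s‖ := by gcongr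
      _ ≤ _ := h1
      _ = ‖c - ρ‖ * (B * ‖dslope G ρ c‖) := by ring
      _ ≤ _ := by gcongr
  have : R * (2 * ‖dslope G ρ s‖) ≤ R * (B * ‖dslope G ρ c‖) := by linarith
  have := le_of_mul_le_mul_left this hR
  linarith

lemma logDeriv_eq_of_zero {G : ℂ → ℂ} (hG : Differentiable ℂ G) {c ρ : ℂ} (hρ : G ρ = 0)
    (hc : G c ≠ 0) :
    dslope G ρ c ≠ 0 ∧
      deriv G c / G c = 1 / (c - ρ) + deriv (dslope G ρ) c / dslope G ρ c := by
  obtain ⟨hd, hfac⟩ := dslope_of_zero hG hρ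
  have hne := hc
  rw [hfac c, mul_ne_zero_iff] at hne
  refine ⟨hne.2, ?_⟩
  have h1 : HasDerivAt G (1 * dslope G ρ c + (c - ρ) * deriv (dslope G ρ) c) c := by
    have := ((hasDerivAt_id c).sub_const ρ).mul (hd c).hasDerivAt
    refine this.congr_of_eventuallyEq (Eventually.of_forall fun s => ?_)
    simpa using hfac s
  rw [h1.deriv, hfac c]
  have := hne.1
  have := hne.2
  field_simp

/-- **Landau's lemma**: if all zeros of `G` lie to the left of `c`, then `- Re (G'/G)(c)` is at
most a constant times the logarithmic growth of `G` around `c`. -/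
lemma neg_re_logDeriv_le {G : ℂ → ℂ} (hG : Differentiable ℂ G) {c : ℂ} {R B : ℝ} (hR : 0 < R)
    (hB : 1 < B) (hGc : G c ≠ 0) (hGB : ∀ s ∈ Metric.closedBall c R, ‖G s‖ ≤ B * ‖G c‖)
    (hz : ∀ s, G s = 0 → s.re ≤ c.re) :
    -(deriv G c / G c).re ≤ 12 * Real.log B / R := by
  -- Induction on m with B' < 2^m: dividing out a zero within R/3 of c halves B', so the process
  -- stops. For m = 0 the bound at s = c itself would force G c = 0. Keeping B' ≤ B lets the
  -- zero-free case end with log B.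
  obtain ⟨m, hm⟩ := pow_unbounded_of_one_lt B (one_lt_two)
  have main : ∀ (m : ℕ) (G : ℂ → ℂ), Differentiable ℂ G → G c ≠ 0 → ∀ B' : ℝ, B' ≤ B →
      B' < 2 ^ m → 0 ≤ B' → (∀ s ∈ Metric.closedBall c R, ‖G s‖ ≤ B' * ‖G c‖) →
      (∀ s, G s = 0 → s.re ≤ c.re) → -(deriv G c / G c).re ≤ 12 * Real.log B / R := by
    intro m
    induction m with
    | zero =>
      intro G _ hGc B' _ hB' _ hGB _
      have := hGB c (Metric.mem_closedBall_self hR.le)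
      have h2 := norm_pos_iff.2 hGc
      nlinarith
    | succ m ih =>
      intro G hG hGc B' hB'B hB' hB0 hGB hz
      by_cases hex : ∃ ρ ∈ Metric.ball c (R / 3), G ρ = 0
      · obtain ⟨ρ, hρc, hρ⟩ := hex
        obtain ⟨hd, hfac⟩ := dslope_of_zero hG hρ
        obtain ⟨hne, hlog⟩ := logDeriv_eq_of_zero hG hρ hGc
        have hstep := ih (dslope G ρ) hd hne (B' / 2) (by linarith)
          (by rw [pow_succ] at hB'; linarith) (by linarith)
          (norm_dslope_le hG hR hGB hB0 hρ (by simpa [dist_eq_norm] using hρc))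
          (fun s hs => hz s (by rw [hfac s, hs, mul_zero]))
        rw [hlog, Complex.add_re]
        -- A zero to the left of c contributes with a favourable sign, so its term can be dropped.
        have : 0 ≤ (1 / (c - ρ)).re := by
          rw [one_div, Complex.inv_re]
          exact div_nonneg (by simpa using hz ρ hρ) (Complex.normSq_nonneg _)
        linarith
      · push Not at hex
        have := (norm_le_of_ne_zero_of_norm_le (R := R / 3) (by linarith) hG hex hB
          (fun s hs => (hGB s ((Metric.ball_subset_ball (by linarith)).trans
            Metric.ball_subset_closedBall hs)).trans (by gcongr))).1
        have h2 := (abs_le.1 ((Complex.abs_re_le_norm _).trans this)).1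
        calc _ ≤ 4 * Real.log B / (R / 3) := by linarith
          _ = _ := by field_simp; ring
  exact main m G hG hGc B le_rfl hm (by linarith) hGB hz

/-- Landau's lemma applied to G / (s - ρ), so that the term of one chosen zero is retained. This
term is what contradicts a zero too close to Re s = 1. -/
lemma neg_re_logDeriv_le_of_zero {G : ℂ → ℂ} (hG : Differentiable ℂ G) {c ρ : ℂ} {R B : ℝ}
    (hR : 0 < R) (hB : 1 < B) (hGc : G c ≠ 0)
    (hGB : ∀ s ∈ Metric.closedBall c R, ‖G s‖ ≤ B * ‖G c‖)
    (hz : ∀ s, G s = 0 → s.re ≤ c.re) (hρ : G ρ = 0) (hρc : ‖ρ - c‖ < R / 3) :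
    -(deriv G c / G c).re ≤ 12 * Real.log B / R - (1 / (c - ρ)).re := by
  obtain ⟨hd, hfac⟩ := dslope_of_zero hG hρ
  obtain ⟨hne, hlog⟩ := logDeriv_eq_of_zero hG hρ hGc
  have := neg_re_logDeriv_le hd hR hB hne (fun s hs =>
    (norm_dslope_le hG hR hGB (by linarith) hρ hρc s hs).trans (by gcongr; linarith))
    (fun s hs => hz s (by rw [hfac s, hs, mul_zero]))
  rw [hlog, Complex.add_re]
  linarith

/-! ### Continuation and growth of Dirichlet series from bounded summatory errors -/

lemma sum_Ioc_dirichletCharacter {q : ℕ} [NeZero q] {χ : DirichletCharacter ℂ q} (hχ : χ ≠ 1)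
    (n : ℕ) : ∑ k ∈ Finset.Ioc n (n + q), χ (k : ZMod q) = 0 := by
  rw [← MulChar.sum_eq_zero_of_ne_one hχ]
  refine Finset.sum_nbij' (fun k => (k : ZMod q)) (fun a => n + 1 + (a - (n + 1 : ℕ) : ZMod q).val) ?_ ?_ ?_ ?_ ?_
  · simp
  · intro a _
    have := ZMod.val_lt (a - (n + 1 : ℕ) : ZMod q)
    simp only [Finset.mem_Ioc]; omega
  · intro k hk
    simp only [Finset.mem_Ioc] at hk
    have : ((k : ZMod q) - ((n + 1 : ℕ) : ZMod q)) = ((k - (n + 1) : ℕ) : ZMod q) := by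
      rw [Nat.cast_sub (by omega)]
    rw [this, ZMod.val_natCast, Nat.mod_eq_of_lt (by omega)]
    omega
  · intro a _
    simp
  · simp

/-- The partial sums of a non-principal character are bounded. -/
lemma norm_sum_dirichletCharacter_le {q : ℕ} [NeZero q] {χ : DirichletCharacter ℂ q} (hχ : χ ≠ 1)
    (n : ℕ) : ‖∑ k ∈ Finset.Icc 1 n, χ (k : ZMod q)‖ ≤ q := by
  have hper : Function.Periodic (fun n : ℕ => ∑ k ∈ Finset.Icc 1 n, χ (k : ZMod q)) q := by
    intro n
    have h : ∀ m : ℕ, Finset.Icc 1 m = Finset.Ioc 0 m := fun m => by ext; simp; omega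
    simp only [h]
    rw [← Finset.sum_Ioc_consecutive _ (Nat.zero_le n) (Nat.le_add_right n q),
      sum_Ioc_dirichletCharacter hχ, add_zero]
  have := hper.map_mod_nat n
  rw [← this]
  refine (norm_sum_le _ _).trans ((Finset.sum_le_card_nsmul _ _ 1 fun k _ => χ.norm_le_one _).trans ?_)
  have : n % q < q := Nat.mod_lt _ (NeZero.pos q)
  simp only [Nat.card_Icc, nsmul_eq_mul, mul_one]
  exact_mod_cast by omega

open Classical in
/-- The error term of the summatory function of `ψ`, set to `0` on `(0, 1]`. -/
noncomputable def sumError (ψ : ℕ → ℂ) (κ : ℂ) (u : ℝ) : ℂ :=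
  (Set.Ioi (1 : ℝ)).indicator (fun u => ∑ k ∈ Finset.Icc 1 ⌊u⌋₊, ψ k - κ * u) u

lemma norm_sumError_le {ψ : ℕ → ℂ} {κ : ℂ} {C : ℝ}
    (hC : ∀ n : ℕ, ‖∑ k ∈ Finset.Icc 1 n, ψ k - κ * n‖ ≤ C) (u : ℝ) :
    ‖sumError ψ κ u‖ ≤ C + ‖κ‖ := by
  have hC0 : 0 ≤ C := (norm_nonneg _).trans (hC 0)
  unfold sumError Set.indicator
  split_ifs with hu
  · have h1 := Nat.floor_le (zero_le_one.trans (Set.mem_Ioi.1 hu).le)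
    have h2 := Nat.lt_floor_add_one u
    have : ∑ k ∈ Finset.Icc 1 ⌊u⌋₊, ψ k - κ * u =
        (∑ k ∈ Finset.Icc 1 ⌊u⌋₊, ψ k - κ * (⌊u⌋₊ : ℕ)) - κ * ((u - ⌊u⌋₊ : ℝ) : ℂ) := by
      push_cast; ring
    simp only [this]
    refine (norm_sub_le _ _).trans (add_le_add (hC _) ?_)
    rw [norm_mul, Complex.norm_real, Real.norm_eq_abs, abs_of_nonneg (by linarith)]
    exact mul_le_of_le_one_right (norm_nonneg _) (by linarith)
  · simpa using by positivity

lemma measurable_sumError (ψ : ℕ → ℂ) (κ : ℂ) : Measurable (sumError ψ κ) := by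
  refine Measurable.indicator ?_ measurableSet_Ioi
  refine Measurable.sub ?_ (by fun_prop)
  exact (measurable_from_nat (f := fun n => ∑ k ∈ Finset.Icc 1 n, ψ k)).comp Nat.measurable_floor


lemma locallyIntegrableOn_sumError {ψ : ℕ → ℂ} {κ : ℂ} {C : ℝ}
    (hC : ∀ n : ℕ, ‖∑ k ∈ Finset.Icc 1 n, ψ k - κ * n‖ ≤ C) (s : Set ℝ) :
    MeasureTheory.LocallyIntegrableOn (sumError ψ κ) s := by
  refine MeasureTheory.LocallyIntegrable.locallyIntegrableOn ?_ _
  refine (MeasureTheory.locallyIntegrable_const (C + ‖κ‖)).mono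
    (measurable_sumError ψ κ).aestronglyMeasurable (Eventually.of_forall fun u => ?_)
  exact (norm_sumError_le hC u).trans (le_abs_self _)

/-- Vanishing on (0, 1] makes every exponent b admissible at 0, and boundedness gives exponent 0 at
infinity. Hence the Mellin transform is holomorphic on all of Re s < 0. -/
lemma sumError_isBigO {ψ : ℕ → ℂ} {κ : ℂ} {C : ℝ}
    (hC : ∀ n : ℕ, ‖∑ k ∈ Finset.Icc 1 n, ψ k - κ * n‖ ≤ C) (b : ℝ) :
    sumError ψ κ =O[atTop] (fun x : ℝ => x ^ (-(0:ℝ))) ∧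
    sumError ψ κ =O[nhdsWithin 0 (Set.Ioi 0)] (fun x : ℝ => x ^ (-b)) := by
  constructor
  · refine IsBigO.of_bound (C + ‖κ‖) (Eventually.of_forall fun u => ?_)
    simpa using norm_sumError_le hC u
  · refine IsBigO.of_bound 0 ?_
    have : Set.Iio (1:ℝ) ∈ nhdsWithin (0:ℝ) (Set.Ioi 0) :=
      mem_nhdsWithin_of_mem_nhds (Iio_mem_nhds one_pos)
    filter_upwards [this] with u hu
    simp only [sumError, zero_mul, norm_le_zero_iff]
    exact Set.indicator_of_notMem (by simpa using hu.le) _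

lemma differentiableAt_mellin_sumError {ψ : ℕ → ℂ} {κ : ℂ} {C : ℝ}
    (hC : ∀ n : ℕ, ‖∑ k ∈ Finset.Icc 1 n, ψ k - κ * n‖ ≤ C) {s : ℂ} (hs : s.re < 0) :
    DifferentiableAt ℂ (mellin (sumError ψ κ)) s :=
  mellin_differentiableAt_of_isBigO_rpow (a := 0) (b := s.re - 1)
    (locallyIntegrableOn_sumError hC _) (sumError_isBigO hC 0).1 (by linarith)
    (sumError_isBigO hC _).2 (by linarith)

lemma mellinConvergent_sumError {ψ : ℕ → ℂ} {κ : ℂ} {C : ℝ}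
    (hC : ∀ n : ℕ, ‖∑ k ∈ Finset.Icc 1 n, ψ k - κ * n‖ ≤ C) {s : ℂ} (hs : s.re < 0) :
    MellinConvergent (sumError ψ κ) s :=
  mellinConvergent_of_isBigO_rpow (a := 0) (b := s.re - 1)
    (locallyIntegrableOn_sumError hC _) (sumError_isBigO hC 0).1 (by linarith)
    (sumError_isBigO hC _).2 (by linarith)

lemma mellin_sumError_eq (ψ : ℕ → ℂ) (κ : ℂ) (s : ℂ) :
    mellin (sumError ψ κ) (-s) = ∫ u in Set.Ioi (1:ℝ),
      (∑ k ∈ Finset.Icc 1 ⌊u⌋₊, ψ k - κ * u) * (u : ℂ) ^ (-(s + 1)) := by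
  rw [mellin, MeasureTheory.setIntegral_eq_of_subset_of_forall_sdiff_eq_zero (s := Set.Ioi (1:ℝ))
    measurableSet_Ioi (Set.Ioi_subset_Ioi zero_le_one)]
  · refine MeasureTheory.setIntegral_congr_fun measurableSet_Ioi fun u hu => ?_
    simp only [sumError, Set.indicator_of_mem hu, smul_eq_mul]
    rw [mul_comm]
    congr 2
    ring
  · intro u hu
    simp [sumError, Set.indicator_of_notMem hu.2]

lemma norm_mellin_sumError_le {ψ : ℕ → ℂ} {κ : ℂ} {C : ℝ}
    (hC : ∀ n : ℕ, ‖∑ k ∈ Finset.Icc 1 n, ψ k - κ * n‖ ≤ C) {s : ℂ} (hs : 0 < s.re) :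
    ‖mellin (sumError ψ κ) (-s)‖ ≤ (C + ‖κ‖) / s.re := by
  rw [mellin_sumError_eq]
  have hb : ∀ u ∈ Set.Ioi (1:ℝ), ‖(∑ k ∈ Finset.Icc 1 ⌊u⌋₊, ψ k - κ * u) * (u : ℂ) ^ (-(s + 1))‖
      ≤ (C + ‖κ‖) * u ^ (-s.re - 1) := by
    intro u hu
    have h0 : (0:ℝ) < u := zero_lt_one.trans hu
    rw [norm_mul, Complex.norm_cpow_eq_rpow_re_of_pos h0]
    have h1 := norm_sumError_le hC u
    simp only [sumError, Set.indicator_of_mem hu] at h1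
    have : (-(s + 1)).re = -s.re - 1 := by simp; ring
    rw [this]
    gcongr
  refine (MeasureTheory.norm_integral_le_of_norm_le ?_
    ((MeasureTheory.ae_restrict_iff' measurableSet_Ioi).2 (Eventually.of_forall hb))).trans ?_
  · exact (integrableOn_Ioi_rpow_of_lt (by linarith) one_pos).const_mul _
  · rw [MeasureTheory.integral_const_mul, integral_Ioi_rpow_of_lt (by linarith) one_pos]
    simp
    rw [div_eq_mul_inv]

/-- The representation of a Dirichlet series by the error term of its summatory function. -/
lemma LSeries_eq_mellin_sumError {ψ : ℕ → ℂ} {κ : ℂ} {C : ℝ}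
    (hC : ∀ n : ℕ, ‖∑ k ∈ Finset.Icc 1 n, ψ k - κ * n‖ ≤ C) {s : ℂ} (hs : 1 < s.re)
    (hsum : LSeriesSummable ψ s) :
    LSeries ψ s = s * mellin (sumError ψ κ) (-s) + κ * s / (s - 1) := by
  have hC0 : 0 ≤ C := (norm_nonneg _).trans (hC 0)
  rw [LSeries_eq_mul_integral ψ zero_le_one hs hsum, mellin_sumError_eq]
  · have hi : MeasureTheory.IntegrableOn (fun u : ℝ => κ * (u : ℂ) ^ (-s)) (Set.Ioi 1) :=
      (integrableOn_Ioi_cpow_of_lt (by simpa using hs) one_pos).const_mul _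
    have hv : ∫ u in Set.Ioi (1:ℝ), κ * (u : ℂ) ^ (-s) = κ / (s - 1) := by
      rw [MeasureTheory.integral_const_mul, integral_Ioi_cpow_of_lt (by simpa using hs) one_pos]
      have h1 : s - 1 ≠ 0 := fun h => by
        rw [sub_eq_zero] at h; rw [h] at hs; simp at hs
      have h2 : -s + 1 ≠ 0 := fun h => h1 (by linear_combination -h)
      simp
      field_simp
      ring
    have hm : MeasureTheory.IntegrableOn (fun u : ℝ =>
        (∑ k ∈ Finset.Icc 1 ⌊u⌋₊, ψ k - κ * u) * (u : ℂ) ^ (-(s + 1))) (Set.Ioi 1) := by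
      have := (mellinConvergent_sumError hC (s := -s) (by simpa using by linarith)).mono_set
        (Set.Ioi_subset_Ioi zero_le_one)
      refine this.congr_fun (fun u hu => ?_) measurableSet_Ioi
      simp only [sumError, Set.indicator_of_mem hu, smul_eq_mul]
      rw [mul_comm]
      congr 2
      ring_nf
    have : ∫ u in Set.Ioi (1:ℝ), (∑ k ∈ Finset.Icc 1 ⌊u⌋₊, ψ k) * (u : ℂ) ^ (-(s + 1)) =
        (∫ u in Set.Ioi (1:ℝ), (∑ k ∈ Finset.Icc 1 ⌊u⌋₊, ψ k - κ * u) * (u : ℂ) ^ (-(s + 1))) +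
        ∫ u in Set.Ioi (1:ℝ), κ * (u : ℂ) ^ (-s) := by
      rw [← MeasureTheory.integral_add hm hi]
      refine MeasureTheory.setIntegral_congr_fun measurableSet_Ioi fun u hu => ?_
      have h0 : (u : ℂ) ≠ 0 := by
        have : (0:ℝ) < u := zero_lt_one.trans hu
        exact_mod_cast this.ne'
      have : (u : ℂ) ^ (-s) = u * (u : ℂ) ^ (-(s + 1)) := by
        rw [show -s = 1 + (-(s + 1)) by ring, Complex.cpow_add _ _ h0, Complex.cpow_one]
      simp only [this]
      ring
    rw [this, hv]
    ring
  · refine IsBigO.of_bound (C + ‖κ‖) ?_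
    filter_upwards [eventually_ge_atTop 1] with n hn
    have h1 : (1:ℝ) ≤ n := by exact_mod_cast hn
    rw [Real.rpow_one, Real.norm_natCast]
    calc _ = ‖(∑ k ∈ Finset.Icc 1 n, ψ k - κ * n) + κ * n‖ := by simp
      _ ≤ C + ‖κ‖ * n := (norm_add_le _ _).trans (add_le_add (hC n) (by simp))
      _ ≤ (C + ‖κ‖) * n := by nlinarith [norm_nonneg κ]

/-- An entire function that continues `(s - 1) ^ e L(s, ψ)` grows at most quadratically to the
right of `Re s = 1 / 2`, if the partial sums of `ψ` are known up to a bounded error. -/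
lemma exists_norm_le_of_sum_bounded {ψ : ℕ → ℂ} {κ : ℂ} {C : ℝ}
    (hC : ∀ n : ℕ, ‖∑ k ∈ Finset.Icc 1 n, ψ k - κ * n‖ ≤ C) {e : ℕ} (he : e ≤ 1)
    (hκ : κ = 0 ∨ e = 1) (hsum : ∀ s : ℂ, 1 < s.re → LSeriesSummable ψ s)
    {H : ℂ → ℂ} (hH : Differentiable ℂ H)
    (hHL : ∀ s : ℂ, 1 < s.re → H s = (s - 1) ^ e * LSeries ψ s) :
    ∃ K : ℝ, 0 < K ∧ ∀ s : ℂ, 1 / 2 ≤ s.re → ‖H s‖ ≤ K * (‖s‖ + 1) ^ 2 := by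
  have hC0 : 0 ≤ C := (norm_nonneg _).trans (hC 0)
  -- Both sides agree for Re s > 1 and are holomorphic for Re s > 0, so the identity theorem carries
  -- the Mellin representation past Re s = 1. The polar term becomes κ s: either e = 1 cancels the
  -- denominator, or κ = 0.
  have heq : Set.EqOn H (fun s => (s - 1) ^ e * (s * mellin (sumError ψ κ) (-s)) + κ * s)
      {s : ℂ | 0 < s.re} := by
    have hopen : IsOpen {s : ℂ | 0 < s.re} := isOpen_lt continuous_const Complex.continuous_re
    have hconv : Convex ℝ {s : ℂ | 0 < s.re} := convex_halfSpace_re_gt 0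
    refine AnalyticOnNhd.eqOn_of_preconnected_of_eventuallyEq (z₀ := 2)
      (hH.differentiableOn.analyticOnNhd hopen) (DifferentiableOn.analyticOnNhd ?_ hopen)
      hconv.isPreconnected (by simp) ?_
    · intro s hs
      have h := (differentiableAt_mellin_sumError hC (s := -s) (by simpa using hs))
      have h2 : DifferentiableAt ℂ (fun s => mellin (sumError ψ κ) (-s)) s :=
        h.comp s (differentiableAt_id.neg)
      exact DifferentiableAt.differentiableWithinAt (by fun_prop)
    · have h1 : {s : ℂ | 1 < s.re} ∈ nhds (2 : ℂ) :=
        (isOpen_lt continuous_const Complex.continuous_re).mem_nhds (by simp)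
      filter_upwards [h1] with s hs
      rw [hHL s hs, LSeries_eq_mellin_sumError hC hs (hsum s hs), mul_add]
      congr 1
      rcases hκ with h | h
      · simp [h]
      · have h1 : s - 1 ≠ 0 := fun h => by
          rw [sub_eq_zero] at h
          have hs' : 1 < s.re := hs
          rw [h] at hs'; simp at hs'
        rw [h]
        field_simp
  refine ⟨2 * (C + ‖κ‖) + ‖κ‖ + 1, by positivity, fun s hs => ?_⟩
  have hs0 : 0 < s.re := by linarith
  have hn := norm_nonneg s
  have hk := norm_nonneg κ
  rw [heq hs0]
  have h1 : ‖mellin (sumError ψ κ) (-s)‖ ≤ 2 * (C + ‖κ‖) := by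
    refine (norm_mellin_sumError_le hC hs0).trans ?_
    rw [div_le_iff₀ hs0]
    nlinarith
  have h2 : ‖(s - 1) ^ e‖ ≤ ‖s‖ + 1 := by
    rw [norm_pow]
    interval_cases e
    · simp
    · simpa using norm_sub_le s 1
  calc _ ≤ ‖(s - 1) ^ e‖ * (‖s‖ * ‖mellin (sumError ψ κ) (-s)‖) + ‖κ‖ * ‖s‖ := by
        refine (norm_add_le _ _).trans (by simp)
    _ ≤ (‖s‖ + 1) * (‖s‖ * (2 * (C + ‖κ‖))) + ‖κ‖ * ‖s‖ := by gcongr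
    _ ≤ _ := by nlinarith [mul_nonneg hk hn, mul_nonneg hC0 hn, mul_nonneg hk (mul_nonneg hn hn)]

/-! ### A common interface for ζ and real Dirichlet L-functions -/

section

open scoped ArithmeticFunction.Moebius ArithmeticFunction.vonMangoldt

/-- The analytic data of the Dirichlet series of a real-valued completely multiplicative `ψ`: the
function `H` is entire, continues `(s - 1) ^ e L(s, ψ)`, and has no zeros with `1 ≤ Re s`. -/
structure IsRealLFunction (ψ : ℕ → ℂ) (e : ℕ) (H : ℂ → ℂ) : Prop where
  values : ∀ n, ψ n = -1 ∨ ψ n = 0 ∨ ψ n = 1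
  exponent_le : e ≤ 1
  differentiable : Differentiable ℂ H
  eq_LSeries : ∀ s : ℂ, 1 < s.re → H s = (s - 1) ^ e * LSeries ψ s
  ne_zero : ∀ s : ℂ, 1 ≤ s.re → H s ≠ 0
  growth : ∃ K : ℝ, 0 < K ∧ ∀ s : ℂ, 1 / 2 ≤ s.re → ‖H s‖ ≤ K * (‖s‖ + 1) ^ 2
  mul_moebius : ∀ s : ℂ, 1 < s.re → LSeries ψ s * LSeries (ψ * fun n => (μ n : ℂ)) s = 1
  logDeriv : ∀ s : ℂ, 1 < s.re →
    LSeries (ψ * fun n => (Λ n : ℂ)) s = -deriv (LSeries ψ) s / LSeries ψ s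

/-- Real characters take only the values `-1`, `0`, `1`. -/
lemma dirichletCharacter_values {q : ℕ} {χ : DirichletCharacter ℂ q}
    (hχ : ∀ a : ZMod q, (χ a).im = 0) (a : ZMod q) : χ a = -1 ∨ χ a = 0 ∨ χ a = 1 := by
  by_cases ha : IsUnit a
  · have h1 := DirichletCharacter.unit_norm_eq_one χ ha.unit
    have h2 : χ a = ((χ a).re : ℂ) := by
      apply Complex.ext <;> simp [hχ a]
    rw [IsUnit.unit_spec, h2, Complex.norm_real, Real.norm_eq_abs] at h1
    rcases eq_or_eq_neg_of_abs_eq h1 with h | h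
    · right; right; rw [h2, h]; simp
    · left; rw [h2, h]; simp
  · right; left; exact χ.map_nonunit ha

lemma isRealLFunction_dirichletCharacter {q : ℕ} [NeZero q] {χ : DirichletCharacter ℂ q}
    (hχ : ∀ a : ZMod q, (χ a).im = 0) (hχ1 : χ ≠ 1) :
    IsRealLFunction (fun n => χ (n : ZMod q)) 0 χ.LFunction where
  values n := dirichletCharacter_values hχ _
  exponent_le := zero_le_one
  differentiable := DirichletCharacter.differentiable_LFunction hχ1
  eq_LSeries s hs := by
    rw [pow_zero, one_mul, DirichletCharacter.LFunction_eq_LSeries χ hs]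
  ne_zero s hs := DirichletCharacter.LFunction_ne_zero_of_one_le_re χ (.inl hχ1) hs
  growth := by
    refine exists_norm_le_of_sum_bounded (ψ := fun n => χ (n : ZMod q)) (κ := 0) (C := q) (e := 0)
      (fun n => by simpa using norm_sum_dirichletCharacter_le hχ1 n) zero_le_one (.inl rfl)
      (fun s hs => DirichletCharacter.LSeriesSummable_of_one_lt_re χ hs)
      (DirichletCharacter.differentiable_LFunction hχ1) fun s hs => by
        rw [pow_zero, one_mul, DirichletCharacter.LFunction_eq_LSeries χ hs]
  mul_moebius s hs := DirichletCharacter.LSeries.mul_mu_eq_one χ hs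
  logDeriv s hs := DirichletCharacter.LSeries_twist_vonMangoldt_eq χ hs

lemma LFunctionTrivChar₁_eq_LSeries {s : ℂ} (hs : 1 < s.re) :
    DirichletCharacter.LFunctionTrivChar₁ 1 s = (s - 1) ^ 1 * LSeries (1 : ℕ → ℂ) s := by
  have h1 : s ≠ 1 := fun h => by rw [h] at hs; simp at hs
  rw [DirichletCharacter.LFunctionTrivChar₁, Function.update_of_ne h1, pow_one,
    DirichletCharacter.LFunctionTrivChar, DirichletCharacter.LFunction_eq_LSeries _ hs]
  congr 2
  ext n
  exact MulChar.one_apply (isUnit_of_subsingleton _)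

lemma isRealLFunction_zeta :
    IsRealLFunction 1 1 (DirichletCharacter.LFunctionTrivChar₁ 1) where
  values n := by simp
  exponent_le := le_rfl
  differentiable := DirichletCharacter.differentiable_LFunctionTrivChar₁ 1
  eq_LSeries s hs := LFunctionTrivChar₁_eq_LSeries hs
  ne_zero s hs := by
    by_cases h1 : s = 1
    · rw [h1]; exact DirichletCharacter.LFunctionTrivChar₁_apply_one_ne_zero 1
    · rw [DirichletCharacter.LFunctionTrivChar₁, Function.update_of_ne h1]
      exact mul_ne_zero (sub_ne_zero.2 h1)
        (DirichletCharacter.LFunction_ne_zero_of_one_le_re _ (.inr h1) hs)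
  growth := by
    refine exists_norm_le_of_sum_bounded (ψ := 1) (κ := 1) (C := 0) (e := 1)
      (fun n => by simp) le_rfl (.inr rfl)
      (fun s hs => LSeriesSummable_one_iff.2 hs)
      (DirichletCharacter.differentiable_LFunctionTrivChar₁ 1)
      fun s hs => LFunctionTrivChar₁_eq_LSeries hs
  mul_moebius s hs := by
    rw [one_mul]; exact LSeries_one_mul_Lseries_moebius hs
  logDeriv s hs := by
    rw [one_mul]; exact ArithmeticFunction.LSeries_vonMangoldt_eq hs

lemma norm_le_one_of_values {z : ℂ} (h : z = -1 ∨ z = 0 ∨ z = 1) : ‖z‖ ≤ 1 := by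
  rcases h with h | h | h <;> simp [h]

lemma norm_LSeries_le_of_norm_le_one {a : ℕ → ℂ} (ha : ∀ n, ‖a n‖ ≤ 1) {s : ℂ} (hs : 1 < s.re) :
    ‖LSeries a s‖ ≤ ‖LSeries 1 (s.re : ℂ)‖ := by
  have hsum : LSeriesSummable 1 (s.re : ℂ) := LSeriesSummable_one_iff.2 (by simpa using hs)
  have hterm : ∀ n, LSeries.term 1 (s.re : ℂ) n = ((‖LSeries.term 1 (s.re : ℂ) n‖ : ℝ) : ℂ) := by
    intro n
    rcases eq_or_ne n 0 with rfl | hn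
    · simp
    · have h0 : (0:ℝ) < n := by exact_mod_cast Nat.pos_of_ne_zero hn
      have : ((n : ℂ) ^ (s.re : ℂ)) = (((n : ℝ) ^ s.re : ℝ) : ℂ) := by
        rw [Complex.ofReal_cpow h0.le]; simp
      rw [LSeries.term_of_ne_zero hn, this, Pi.one_apply, norm_div, Complex.norm_real, norm_one,
        Real.norm_of_nonneg (by positivity)]
      push_cast; rfl
  have h1 : ‖LSeries 1 (s.re : ℂ)‖ = ∑' n, ‖LSeries.term 1 (s.re : ℂ) n‖ := by
    rw [LSeries, tsum_congr hterm, ← Complex.ofReal_tsum, Complex.norm_real,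
      Real.norm_of_nonneg (tsum_nonneg fun _ => norm_nonneg _)]
  rw [h1]
  refine tsum_of_norm_bounded hsum.norm.hasSum fun n => ?_
  refine (LSeries.norm_term_le s (g := 1) (by simpa using ha n)).trans_eq ?_
  rcases eq_or_ne n 0 with rfl | hn
  · simp
  · have h0 : (0:ℝ) < n := by exact_mod_cast Nat.pos_of_ne_zero hn
    have := Complex.norm_cpow_eq_rpow_re_of_pos h0 s
    have h2 := Complex.norm_cpow_eq_rpow_re_of_pos h0 (s.re : ℂ)
    simp only [Complex.ofReal_natCast, Complex.ofReal_re] at this h2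
    simp [hn, this, h2]

/-- `ζ(σ) ≪ 1 / (σ - 1)`. -/
lemma exists_norm_LSeries_one_le : ∃ K : ℝ, 1 ≤ K ∧ ∀ σ : ℝ, 1 < σ → σ ≤ 2 →
    ‖LSeries 1 (σ : ℂ)‖ ≤ K / (σ - 1) := by
  obtain ⟨K, hK, h⟩ := isRealLFunction_zeta.growth
  refine ⟨K * 9 + 1, by linarith, fun σ h1 h2 => ?_⟩
  have := h (σ : ℂ) (by simp; linarith)
  rw [isRealLFunction_zeta.eq_LSeries _ (by simpa using h1), pow_one, norm_mul,
    Complex.norm_real, Real.norm_of_nonneg (by linarith)] at this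
  have h3 : ‖((σ:ℂ) - 1)‖ = σ - 1 := by
    rw [← Complex.ofReal_one, ← Complex.ofReal_sub, Complex.norm_real,
      Real.norm_of_nonneg (by linarith)]
  rw [h3] at this
  rw [le_div_iff₀ (by linarith), mul_comm]
  have h4 : (σ + 1) ^ 2 ≤ 9 := by nlinarith
  nlinarith

namespace IsRealLFunction

variable {ψ : ℕ → ℂ} {e : ℕ} {H : ℂ → ℂ}

lemma norm_le_one (hL : IsRealLFunction ψ e H) (n : ℕ) : ‖ψ n‖ ≤ 1 :=
  norm_le_one_of_values (hL.values n)

lemma norm_mul_moebius_le_one (hL : IsRealLFunction ψ e H) (n : ℕ) :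
    ‖(ψ * fun n => (μ n : ℂ)) n‖ ≤ 1 := by
  have h1 := hL.norm_le_one n
  have h2 : ‖(μ n : ℂ)‖ ≤ 1 := by
    rw [Complex.norm_intCast]; exact_mod_cast ArithmeticFunction.abs_moebius_le_one
  rw [Pi.mul_apply, norm_mul]
  exact mul_le_one₀ h1 (norm_nonneg _) h2

/-- The reciprocal of L(s, ψ) is the Dirichlet series of ψ μ, whose coefficients are bounded by 1,
so it is dominated by ζ(Re s). -/
lemma one_le_norm_mul (hL : IsRealLFunction ψ e H) {s : ℂ} (hs : 1 < s.re) :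
    1 ≤ ‖LSeries ψ s‖ * ‖LSeries 1 (s.re : ℂ)‖ := by
  have := congrArg norm (hL.mul_moebius s hs)
  rw [norm_mul, norm_one] at this
  rw [← this]
  gcongr
  exact norm_LSeries_le_of_norm_le_one hL.norm_mul_moebius_le_one hs

/-- A lower bound for `H` on the right of the line `Re s = 1`. -/
lemma exists_le_norm (hL : IsRealLFunction ψ e H) : ∃ K : ℝ, 1 ≤ K ∧ ∀ s : ℂ, 1 < s.re →
    s.re ≤ 2 → ‖s - 1‖ ^ e * (s.re - 1) ≤ K * ‖H s‖ := by
  obtain ⟨K, hK, h⟩ := exists_norm_LSeries_one_le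
  refine ⟨K, hK, fun s h1 h2 => ?_⟩
  have h3 := hL.one_le_norm_mul h1
  have h4 := h s.re h1 h2
  rw [hL.eq_LSeries s h1, norm_mul, norm_pow]
  have h5 : s.re - 1 ≤ K * ‖LSeries ψ s‖ := by
    rw [le_div_iff₀ (by linarith)] at h4
    have : 0 ≤ s.re - 1 := by linarith
    calc s.re - 1 = 1 * (s.re - 1) := by ring
      _ ≤ ‖LSeries ψ s‖ * ‖LSeries 1 (s.re : ℂ)‖ * (s.re - 1) := by gcongr
      _ = ‖LSeries ψ s‖ * (‖LSeries 1 (s.re : ℂ)‖ * (s.re - 1)) := by ring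
      _ ≤ ‖LSeries ψ s‖ * K := by gcongr
      _ = _ := by ring
  calc ‖s - 1‖ ^ e * (s.re - 1) ≤ ‖s - 1‖ ^ e * (K * ‖LSeries ψ s‖) := by gcongr
    _ = _ := by ring

/-- The relative growth of `H` around a point just to the right of `Re s = 1`. -/
lemma exists_norm_le_mul_norm (hL : IsRealLFunction ψ e H) : ∃ K : ℝ, 2 ≤ K ∧ ∀ η t : ℝ, 0 < η →
    η ≤ 1 / 2 → ∀ s ∈ Metric.closedBall (⟨1 + η, t⟩ : ℂ) (1 / 2),
    ‖H s‖ ≤ K * (|t| + 2) ^ 2 / η ^ 2 * ‖H ⟨1 + η, t⟩‖ := by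
  obtain ⟨K, hK, h⟩ := hL.growth
  obtain ⟨K', hK', h'⟩ := hL.exists_le_norm
  refine ⟨K * K' * 4 + 2, by nlinarith, fun η t h0 h1 s hs => ?_⟩
  have hs' : ‖s - ⟨1 + η, t⟩‖ ≤ 1 / 2 := by simpa [dist_eq_norm] using hs
  have hre := (abs_le.1 ((Complex.abs_re_le_norm _).trans hs')).1
  simp only [Complex.sub_re] at hre
  have hg := h s (by linarith)
  have hn : ‖s‖ ≤ |t| + 2 := by
    have h2 : ‖(⟨1 + η, t⟩ : ℂ)‖ ≤ |1 + η| + |t| := Complex.norm_le_abs_re_add_abs_im _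
    rw [abs_of_pos (by linarith)] at h2
    have := norm_add_le (s - ⟨1 + η, t⟩) ⟨1 + η, t⟩
    rw [sub_add_cancel] at this
    linarith
  have hl := h' ⟨1 + η, t⟩ (by simpa using h0) (by simp; linarith)
  simp only [add_sub_cancel_left] at hl
  have hd : η ≤ ‖(⟨1 + η, t⟩ : ℂ) - 1‖ := by
    have := Complex.abs_re_le_norm ((⟨1 + η, t⟩ : ℂ) - 1)
    simp only [Complex.sub_re, Complex.one_re, add_sub_cancel_left] at this
    exact (le_abs_self _).trans this
  have hd2 : η ≤ ‖(⟨1 + η, t⟩ : ℂ) - 1‖ ^ e := by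
    have he := hL.exponent_le
    interval_cases e
    · simp; linarith
    · simpa using hd
  have hl2 : η ^ 2 ≤ K' * ‖H ⟨1 + η, t⟩‖ := by nlinarith
  have ht := abs_nonneg t
  rw [div_mul_eq_mul_div, le_div_iff₀ (by positivity)]
  calc ‖H s‖ * η ^ 2 ≤ K * (|t| + 2 + 1) ^ 2 * (K' * ‖H ⟨1 + η, t⟩‖) := by
        gcongr
        exact hg.trans (by gcongr)
    _ ≤ K * (2 * (|t| + 2)) ^ 2 * (K' * ‖H ⟨1 + η, t⟩‖) := by
        gcongr; linarith
    _ = (K * K' * 4) * (|t| + 2) ^ 2 * ‖H ⟨1 + η, t⟩‖ := by ring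
    _ ≤ _ := by gcongr; linarith

/-- Separates the possible pole at s = 1 from the logarithmic derivative of the entire function H,
to which Landau's lemma applies. -/
lemma LSeries_vonMangoldt_eq (hL : IsRealLFunction ψ e H) {s : ℂ} (hs : 1 < s.re) :
    LSeries (ψ * fun n => (Λ n : ℂ)) s = e / (s - 1) - deriv H s / H s := by
  have hs1 : s - 1 ≠ 0 := fun h => by
    rw [sub_eq_zero] at h; rw [h] at hs; simp at hs
  have hopen : IsOpen {s : ℂ | 1 < s.re} := isOpen_lt continuous_const Complex.continuous_re
  have hHs := hL.ne_zero s hs.le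
  have hLs : LSeries ψ s ≠ 0 := fun h => hHs (by rw [hL.eq_LSeries s hs, h, mul_zero])
  have hev : LSeries ψ =ᶠ[nhds s] fun s => H s / (s - 1) ^ e := by
    filter_upwards [hopen.mem_nhds hs] with z hz
    have hz1 : z - 1 ≠ 0 := fun h => by
      rw [sub_eq_zero] at h
      have hz' : 1 < z.re := hz
      rw [h] at hz'; simp at hz'
    rw [hL.eq_LSeries z hz]
    field_simp
  have hd : HasDerivAt (fun s => H s / (s - 1) ^ e)
      ((deriv H s * (s - 1) ^ e - H s * (e * (s - 1) ^ (e - 1) * 1)) / ((s - 1) ^ e) ^ 2) s :=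
    (hL.differentiable s).hasDerivAt.div (((hasDerivAt_id s).sub_const 1).pow e)
      (pow_ne_zero _ hs1)
  rw [hL.logDeriv s hs, hev.deriv_eq, hd.deriv, hev.self_of_nhds]
  have he := hL.exponent_le
  interval_cases e
  · simp; ring
  · simp
    field_simp
    ring

/-! ### The classical zero-free region -/

/-- The classical inequality `3 + 4 cos θ + cos 2θ ≥ 0`, summed over the prime powers. -/
lemma re_comb_nonneg (hL : IsRealLFunction ψ e H) {σ : ℝ} (hσ : 1 < σ) (t : ℝ) :
    0 ≤ 3 * (LSeries (fun n => (Λ n : ℂ)) ⟨σ, 0⟩).re +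
      4 * (LSeries (ψ * fun n => (Λ n : ℂ)) ⟨σ, t⟩).re +
      (LSeries (fun n => (Λ n : ℂ)) ⟨σ, 2 * t⟩).re := by
  have hΛ : ∀ t : ℝ, LSeriesSummable (fun n => (Λ n : ℂ)) ⟨σ, t⟩ := fun t =>
    ArithmeticFunction.LSeriesSummable_vonMangoldt hσ
  have hψ : LSeriesSummable (ψ * fun n => (Λ n : ℂ)) ⟨σ, t⟩ := by
    refine Summable.of_norm_bounded (hΛ t).norm fun n => LSeries.norm_term_le _ ?_
    rw [Pi.mul_apply, norm_mul]
    exact mul_le_of_le_one_left (norm_nonneg _) (hL.norm_le_one n)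
  have key : ∀ t, ∀ f : ℕ → ℂ, LSeriesSummable f ⟨σ, t⟩ →
      HasSum (fun n => (LSeries.term f ⟨σ, t⟩ n).re) (LSeries f ⟨σ, t⟩).re := fun t f hf =>
    Complex.hasSum_re hf.hasSum
  refine HasSum.nonneg ?_ ((((key 0 _ (hΛ 0)).mul_left 3).add ((key t _ hψ).mul_left 4)).add
    (key (2 * t) _ (hΛ (2 * t))))
  intro n
  rcases eq_or_ne n 0 with rfl | hn
  · simp
  have h0 : (0:ℝ) < n := by exact_mod_cast Nat.pos_of_ne_zero hn
  have hpow : ∀ t : ℝ, ((n : ℂ) ^ (⟨σ, t⟩ : ℂ))⁻¹ =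
      ((n : ℝ) ^ (-σ) : ℝ) * Complex.exp ((-(t * Real.log n) : ℝ) * Complex.I) := by
    intro t
    have hn0 : (n : ℂ) ≠ 0 := by exact_mod_cast hn
    rw [← Complex.cpow_neg, show -(⟨σ, t⟩ : ℂ) = ((-σ : ℝ) : ℂ) + (-t : ℝ) * Complex.I by
      apply Complex.ext <;> simp, Complex.cpow_add _ _ hn0, Complex.ofReal_cpow h0.le]
    congr 1
    rw [Complex.cpow_def_of_ne_zero hn0, Complex.natCast_log.symm]
    push_cast; ring_nf
  simp only [LSeries.term_of_ne_zero hn, div_eq_mul_inv, hpow, Pi.mul_apply]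
  have hΛ0 : 0 ≤ Λ n := ArithmeticFunction.vonMangoldt_nonneg
  have hp : 0 ≤ (n : ℝ) ^ (-σ) := by positivity
  have hre : ∀ (x θ : ℝ), ((x : ℂ) * (((n : ℝ) ^ (-σ) : ℝ) * Complex.exp ((θ : ℝ) * Complex.I))).re
      = x * (n : ℝ) ^ (-σ) * Real.cos θ := by
    intro x θ
    rw [← mul_assoc, ← Complex.ofReal_mul, Complex.re_ofReal_mul, Complex.exp_ofReal_mul_I_re]
  obtain ⟨x, hx, hx'⟩ : ∃ x : ℝ, ψ n = x ∧ (x = -1 ∨ x = 0 ∨ x = 1) := by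
    rcases hL.values n with h | h | h
    · exact ⟨-1, by simp [h], by simp⟩
    · exact ⟨0, by simp [h], by simp⟩
    · exact ⟨1, by simp [h], by simp⟩
  rw [hx, ← Complex.ofReal_mul, hre, hre, hre]
  set θ := t * Real.log n with hθ
  rw [show -(2 * t * Real.log n) = -(2 * θ) by rw [hθ]; ring]
  simp only [zero_mul, neg_zero, Real.cos_zero, Real.cos_neg, Real.cos_two_mul]
  have h2 : 0 ≤ Λ n * (n : ℝ) ^ (-σ) := mul_nonneg hΛ0 hp
  -- For x = ±1 this is 2 (1 ± cos θ)², and for x = 0 it is 2 + 2 cos² θ. Taking ζ rather than the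
  -- series of ψ² in the outer terms therefore costs nothing where ψ vanishes.
  have h3 : 0 ≤ 3 + 4 * x * Real.cos θ + (2 * Real.cos θ ^ 2 - 1) := by
    rcases hx' with h | h | h <;> rw [h]
    · nlinarith [sq_nonneg (Real.cos θ - 1)]
    · nlinarith [sq_nonneg (Real.cos θ)]
    · nlinarith [sq_nonneg (Real.cos θ + 1)]
  calc 0 ≤ (Λ n * (n : ℝ) ^ (-σ)) * (3 + 4 * x * Real.cos θ + (2 * Real.cos θ ^ 2 - 1)) :=
        mul_nonneg h2 h3
    _ = _ := by ring

end IsRealLFunction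

lemma half_le_log_abs_add_two (t : ℝ) : 1 / 2 ≤ Real.log (|t| + 2) := by
  have h1 : Real.log 2 ≤ Real.log (|t| + 2) :=
    Real.log_le_log (by norm_num) (by linarith [abs_nonneg t])
  linarith [Real.log_two_gt_d9]

/-- At distance θ / log(|t| + 2) from Re s = 1 the logarithmic growth of H is of order (1 + log θ⁻¹)
log(|t| + 2), while the competing main terms are of order log(|t| + 2) / θ. Since θ log θ → 0, a
small θ makes the main terms win. -/
lemma exists_mul_one_add_log_inv_le {ε m : ℝ} (hε : 0 < ε) (hm : 0 < m) :
    ∃ θ : ℝ, 0 < θ ∧ θ ≤ m ∧ θ ≤ 1 ∧ θ * (1 + Real.log θ⁻¹) ≤ ε := by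
  have h : Tendsto (fun θ : ℝ => θ * (1 + Real.log θ⁻¹)) (nhdsWithin 0 (Set.Ioi 0)) (nhds 0) := by
    have h1 := Real.continuous_mul_log.tendsto 0
    have h2 : Tendsto (fun θ : ℝ => θ - θ * Real.log θ) (nhds 0) (nhds (0 - 0 * Real.log 0)) :=
      tendsto_id.sub h1
    simp only [zero_mul, sub_zero] at h2
    refine (h2.mono_left nhdsWithin_le_nhds).congr fun θ => ?_
    rw [Real.log_inv]; ring
  have h3 := h.eventually (ge_mem_nhds hε)
  have h4 : ∀ᶠ θ : ℝ in nhdsWithin 0 (Set.Ioi 0), θ ∈ Set.Ioo 0 (min m 1) :=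
    Ioo_mem_nhdsGT (lt_min hm one_pos)
  obtain ⟨θ, h5, h6⟩ := (h3.and h4).exists
  exact ⟨θ, h6.1, (h6.2.trans_le (min_le_left _ _)).le, (h6.2.trans_le (min_le_right _ _)).le, h5⟩

namespace IsRealLFunction

variable {ψ : ℕ → ℂ} {e : ℕ} {H : ℂ → ℂ}

/-- The logarithmic form of `exists_norm_le_mul_norm` at a distance `θ / log (|t| + 2)` from the
line `Re s = 1` and at heights `t` and `2 t`. -/
lemma exists_log_growth (hL : IsRealLFunction ψ e H) : ∃ K : ℝ, 0 < K ∧ ∀ θ t u : ℝ, 0 < θ →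
    θ ≤ 1 / 4 → |u| ≤ 2 * |t| → ∃ B : ℝ, 1 < B ∧
      Real.log B ≤ K * (1 + Real.log θ⁻¹) * Real.log (|t| + 2) ∧
      ∀ s ∈ Metric.closedBall (⟨1 + θ / Real.log (|t| + 2), u⟩ : ℂ) (1 / 2),
        ‖H s‖ ≤ B * ‖H ⟨1 + θ / Real.log (|t| + 2), u⟩‖ := by
  obtain ⟨K, hK, h⟩ := hL.exists_norm_le_mul_norm
  have hlK : 0 ≤ Real.log K := Real.log_nonneg (by linarith)
  refine ⟨2 * Real.log K + 6, by positivity, fun θ t u hθ hθ1 hu => ?_⟩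
  have hl := half_le_log_abs_add_two t
  have hl0 : 0 < Real.log (|t| + 2) := by linarith
  have ht := abs_nonneg t
  set l := Real.log (|t| + 2) with hldef
  have hη : 0 < θ / l := by positivity
  have hη1 : θ / l ≤ 1 / 2 := by rw [div_le_iff₀ hl0]; linarith
  have hu0 := abs_nonneg u
  refine ⟨K * (|u| + 2) ^ 2 / (θ / l) ^ 2, ?_, ?_, h (θ / l) u hη hη1⟩
  · rw [lt_div_iff₀ (by positivity)]
    nlinarith
  · have e1 : Real.log (K * (|u| + 2) ^ 2 / (θ / l) ^ 2) =
        Real.log K + 2 * Real.log (|u| + 2) + 2 * (Real.log θ⁻¹ + Real.log l) := by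
      rw [Real.log_div (by positivity) (by positivity), Real.log_mul (by positivity) (by positivity),
        Real.log_pow, Real.log_pow, Real.log_div hθ.ne' hl0.ne', Real.log_inv]
      push_cast; ring
    have e2 : Real.log (|u| + 2) ≤ 2 * l := by
      have : Real.log (|u| + 2) ≤ Real.log ((|t| + 2) ^ 2) :=
        Real.log_le_log (by positivity) (by nlinarith)
      rw [Real.log_pow] at this
      exact_mod_cast this
    have e3 : Real.log l ≤ l := (Real.log_le_sub_one_of_pos hl0).trans (by linarith)
    have e4 : 0 ≤ Real.log θ⁻¹ := Real.log_nonneg (by rw [one_le_inv₀ hθ]; linarith)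
    rw [e1]
    have e5 : Real.log K ≤ 2 * Real.log K * l := by nlinarith
    have e6 : Real.log θ⁻¹ ≤ 2 * Real.log θ⁻¹ * l := by nlinarith
    have e7 : 0 ≤ Real.log K * Real.log θ⁻¹ * l := by positivity
    have e8 : 0 ≤ Real.log θ⁻¹ * l := by positivity
    nlinarith

lemma re_le_of_zero (hL : IsRealLFunction ψ e H) {c : ℂ} (hc : 1 < c.re) (s : ℂ) (hs : H s = 0) :
    s.re ≤ c.re := by
  by_contra! h
  exact hL.ne_zero s (by linarith) hs

/-- The zero-free region away from the real axis. -/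
lemma exists_zero_free_of_one_le_abs (hL : IsRealLFunction ψ e H) : ∃ c : ℝ, 0 < c ∧
    ∀ s : ℂ, 1 ≤ |s.im| → H s = 0 → s.re < 1 - c / Real.log (|s.im| + 2) := by
  set Z := DirichletCharacter.LFunctionTrivChar₁ 1
  have hZ : IsRealLFunction 1 1 Z := isRealLFunction_zeta
  obtain ⟨K, hK, h⟩ := hL.exists_log_growth
  obtain ⟨K', hK', h'⟩ := hZ.exists_log_growth
  -- Each Landau bound is 24 K Y or 24 K' Y; the weights 3, 4, 1 give 96 K Y + 96 K' Y, and the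
  -- polar terms at heights t and 2t add at most 5 ≤ 10 Y. The choice of ε turns the final
  -- inequality into 3/7 ≤ 1/4.
  obtain ⟨θ, hθ, hθ1, -, hθ2⟩ := exists_mul_one_add_log_inv_le
    (ε := 1 / (4 * (96 * K + 96 * K' + 10))) (m := 1 / 16) (by positivity) (by norm_num)
  refine ⟨θ / 6, by positivity, fun ρ hρ1 hρ => ?_⟩
  by_contra! hcon
  set t := ρ.im with ht
  have hl := half_le_log_abs_add_two t
  set l := Real.log (|t| + 2) with hldef
  have hl0 : 0 < l := by linarith
  set η := θ / l with hη
  have hη0 : 0 < η := by positivity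
  have hη1 : η ≤ 1 / 8 := by rw [hη, div_le_iff₀ hl0]; linarith
  have hcon' : 1 - ρ.re ≤ η / 6 := by
    have : θ / 6 / l = η / 6 := by rw [hη]; ring
    linarith
  have hρ2 : ρ.re < 1 := by
    by_contra! hh
    exact hL.ne_zero ρ hh hρ
  have hlog : 0 ≤ Real.log θ⁻¹ := Real.log_nonneg (by rw [one_le_inv₀ hθ]; linarith)
  set Y := (1 + Real.log θ⁻¹) * l with hY
  have hY1 : 1 / 2 ≤ Y := by nlinarith
  -- the three logarithmic derivatives
  obtain ⟨B0, hB0, hB0', hb0⟩ := h' θ t 0 hθ (by linarith) (by simp)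
  obtain ⟨B1, hB1, hB1', hb1⟩ := h θ t t hθ (by linarith) (by linarith [abs_nonneg t])
  obtain ⟨B2, hB2, hB2', hb2⟩ := h' θ t (2 * t) hθ (by linarith) (by rw [abs_mul]; simp)
  have hre : ∀ u : ℝ, 1 < (⟨1 + η, u⟩ : ℂ).re := fun u => by simpa using hη0
  have d0 := neg_re_logDeriv_le hZ.differentiable (by norm_num) hB0 (hZ.ne_zero _ (hre 0).le) hb0
    (hZ.re_le_of_zero (hre 0))
  have d2 := neg_re_logDeriv_le hZ.differentiable (by norm_num) hB2 (hZ.ne_zero _ (hre (2 * t)).le)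
    hb2 (hZ.re_le_of_zero (hre (2 * t)))
  have hdiff : (⟨1 + η, t⟩ : ℂ) - ρ = ((1 + η - ρ.re : ℝ) : ℂ) := by
    apply Complex.ext <;> simp [ht]
  -- The centre 1 + η + it has the height of ρ, so c - ρ is real and 1 / (c - ρ) counts in full.
  have d1 := neg_re_logDeriv_le_of_zero hL.differentiable (by norm_num) hB1
    (hL.ne_zero _ (hre t).le) hb1 (hL.re_le_of_zero (hre t)) hρ (by
      rw [norm_sub_rev, hdiff, Complex.norm_real, Real.norm_of_nonneg (by linarith)]
      linarith)
  have hcomb := hL.re_comb_nonneg (σ := 1 + η) (by linarith) t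
  have hZΛ : ∀ u : ℝ, LSeries (fun n => (Λ n : ℂ)) ⟨1 + η, u⟩ =
      1 / ((⟨1 + η, u⟩ : ℂ) - 1) - deriv Z ⟨1 + η, u⟩ / Z ⟨1 + η, u⟩ := fun u => by
    have := hZ.LSeries_vonMangoldt_eq (hre u)
    rw [one_mul] at this
    simpa using this
  rw [hZΛ, hZΛ, hL.LSeries_vonMangoldt_eq (hre t)] at hcomb
  simp only [Complex.sub_re] at hcomb
  -- the polar terms
  have p0 : (1 / ((⟨1 + η, 0⟩ : ℂ) - 1)).re = 1 / η := by
    have : ((⟨1 + η, 0⟩ : ℂ) - 1) = (η : ℂ) := by apply Complex.ext <;> simp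
    rw [this, ← Complex.ofReal_one, ← Complex.ofReal_div, Complex.ofReal_re]
  have pt : ∀ u : ℝ, 1 ≤ |u| → (1 / ((⟨1 + η, u⟩ : ℂ) - 1)).re ≤ 1 := by
    intro u hu
    have h1 : |u| ≤ ‖(⟨1 + η, u⟩ : ℂ) - 1‖ := by
      have := Complex.abs_im_le_norm ((⟨1 + η, u⟩ : ℂ) - 1)
      simpa using this
    refine (Complex.re_le_norm _).trans ?_
    rw [norm_div, norm_one]
    exact (div_le_one (by linarith)).2 (by linarith)
  have p1 : ((e : ℂ) / ((⟨1 + η, t⟩ : ℂ) - 1)).re ≤ 1 := by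
    have he := hL.exponent_le
    interval_cases e
    · simp
    · simpa using pt t hρ1
  have p2 := pt (2 * t) (by rw [abs_mul]; simp; linarith)
  -- With 1 - Re ρ ≤ η/6 the distance to ρ is at most 7η/6. Four times 6/7 exceeds the 3 coming from
  -- the pole of ζ, leaving 3/(7η).
  have pz : 6 / (7 * η) ≤ (1 / ((⟨1 + η, t⟩ : ℂ) - ρ)).re := by
    rw [hdiff, ← Complex.ofReal_one, ← Complex.ofReal_div, Complex.ofReal_re,
      div_le_div_iff₀ (by positivity) (by linarith)]
    linarith
  rw [p0] at hcomb
  have q0 : 12 * Real.log B0 / (1 / 2) ≤ 24 * (K' * Y) := by rw [hY]; linarith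
  have q1 : 12 * Real.log B1 / (1 / 2) ≤ 24 * (K * Y) := by rw [hY]; linarith
  have q2 : 12 * Real.log B2 / (1 / 2) ≤ 24 * (K' * Y) := by rw [hY]; linarith
  have hfin : 3 / (7 * η) ≤ (96 * K + 96 * K' + 10) * Y := by
    have e1 : 6 / (7 * η) * 4 - 3 * (1 / η) = 3 / (7 * η) := by field_simp; norm_num
    nlinarith
  have hηY : η * Y = θ * (1 + Real.log θ⁻¹) := by rw [hη, hY]; field_simp
  have : 3 / 7 ≤ (96 * K + 96 * K' + 10) * (θ * (1 + Real.log θ⁻¹)) := by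
    rw [← hηY]
    rw [div_le_iff₀ (by positivity)] at hfin
    linarith
  have h5 : (96 * K + 96 * K' + 10) * (θ * (1 + Real.log θ⁻¹)) ≤ 1 / 4 := by
    calc _ ≤ (96 * K + 96 * K' + 10) * (1 / (4 * (96 * K + 96 * K' + 10))) := by gcongr
      _ = 1 / 4 := by field_simp
  linarith

/-- The zero-free region close to the real axis. -/
lemma exists_zero_free_of_abs_le_one (hL : IsRealLFunction ψ e H) : ∃ δ : ℝ, 0 < δ ∧
    ∀ s : ℂ, |s.im| ≤ 1 → H s = 0 → s.re < 1 - δ := by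
  set S : Set ℂ := (fun t : ℝ => (⟨1, t⟩ : ℂ)) '' Set.Icc (-1) 1
  have hcont : Continuous fun t : ℝ => (⟨1, t⟩ : ℂ) := by
    have : (fun t : ℝ => (⟨1, t⟩ : ℂ)) = fun t : ℝ => (1 : ℂ) + t * Complex.I := by
      ext t; apply Complex.ext <;> simp
    rw [this]; fun_prop
  have hS : IsCompact S := isCompact_Icc.image hcont
  have hopen : IsOpen {s : ℂ | H s ≠ 0} :=
    isOpen_ne_fun hL.differentiable.continuous continuous_const
  -- H does not vanish on the compact segment Re s = 1, |Im s| ≤ 1, hence not on a δ-neighbourhood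
  -- of it.
  obtain ⟨δ, hδ, hsub⟩ := hS.exists_thickening_subset_open hopen (by
    rintro _ ⟨t, _, rfl⟩
    exact hL.ne_zero _ (by simp))
  refine ⟨δ / 2, by positivity, fun s hs h0 => ?_⟩
  by_contra! hcon
  have hlt : s.re < 1 := by
    by_contra! hh
    exact hL.ne_zero s hh h0
  refine hsub (Metric.mem_thickening_iff.2 ⟨⟨1, s.im⟩, ⟨s.im, abs_le.1 hs, rfl⟩, ?_⟩) h0
  have : s - ⟨1, s.im⟩ = ((s.re - 1 : ℝ) : ℂ) := by apply Complex.ext <;> simp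
  rw [dist_eq_norm, this, Complex.norm_real, Real.norm_eq_abs, abs_of_neg (by linarith)]
  linarith

/-- The **classical zero-free region**. -/
theorem exists_zero_free (hL : IsRealLFunction ψ e H) : ∃ c : ℝ, 0 < c ∧ c ≤ 1 ∧
    ∀ s : ℂ, H s = 0 → s.re < 1 - c / Real.log (|s.im| + 2) := by
  obtain ⟨c, hc, h⟩ := hL.exists_zero_free_of_one_le_abs
  obtain ⟨δ, hδ, h'⟩ := hL.exists_zero_free_of_abs_le_one
  -- As log(|t| + 2) ≥ 1/2, a constant at most δ/2 gives a width at most δ.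
  refine ⟨min (min c 1) (δ / 2), by positivity, (min_le_left _ _).trans (min_le_right _ _),
    fun s hs => ?_⟩
  have hl := half_le_log_abs_add_two s.im
  rcases le_total 1 |s.im| with h1 | h1
  · refine (h s h1 hs).trans_le (sub_le_sub_left ?_ _)
    gcongr
    exact (min_le_left _ _).trans (min_le_left _ _)
  · refine (h' s h1 hs).trans_le (sub_le_sub_left ?_ _)
    rw [div_le_iff₀ (by linarith)]
    have := min_le_right (min c 1) (δ / 2)
    nlinarith

end IsRealLFunction

/-! ### Bounding the reciprocal inside the zero-free region -/

namespace IsRealLFunction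

variable {ψ : ℕ → ℂ} {e : ℕ} {H : ℂ → ℂ}

/-- Inside the ball the height changes by at most 1, so log(|Im s| + 2) at most doubles; the radius
is small enough to stay inside the zero-free region after this loss. -/
lemma ne_zero_of_mem_ball {c : ℝ} (hc : 0 < c) (hc1 : c ≤ 1)
    (hzf : ∀ s : ℂ, H s = 0 → s.re < 1 - c / Real.log (|s.im| + 2)) {η t : ℝ} (hη : 0 < η) :
    ∀ s ∈ Metric.ball (⟨1 + η, t⟩ : ℂ) (c / (4 * Real.log (|t| + 2))), H s ≠ 0 := by
  intro s hs h0
  have hl := half_le_log_abs_add_two t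
  set l := Real.log (|t| + 2) with hldef
  have hl0 : 0 < l := by linarith
  have hs' : ‖s - ⟨1 + η, t⟩‖ < c / (4 * l) := by simpa [dist_eq_norm] using hs
  have hr : c / (4 * l) ≤ 1 / 2 := by rw [div_le_iff₀ (by positivity)]; linarith
  have h1 := (abs_le.1 ((Complex.abs_re_le_norm _).trans hs'.le)).1
  have h2 := (Complex.abs_im_le_norm _).trans hs'.le
  simp only [Complex.sub_re, Complex.sub_im] at h1 h2
  have h3 : |s.im| ≤ |t| + 1 := by
    have := abs_add_le (s.im - t) t
    rw [sub_add_cancel] at this; linarith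
  have h4 : Real.log (|s.im| + 2) ≤ 2 * l := by
    have : Real.log (|s.im| + 2) ≤ Real.log ((|t| + 2) ^ 2) := by
      refine Real.log_le_log (by positivity) ?_
      nlinarith [abs_nonneg t]
    rw [Real.log_pow] at this
    exact_mod_cast this
  have h5 := hzf s h0
  have h6 : c / (4 * l) ≤ c / Real.log (|s.im| + 2) := by
    have := half_le_log_abs_add_two s.im
    gcongr
    · linarith
  linarith

lemma log_le_rpow_quarter (t : ℝ) : Real.log (|t| + 2) ≤ 4 * (|t| + 2) ^ (1 / 4 : ℝ) := by
  have := Real.log_le_rpow_div (x := |t| + 2) (by positivity) (show (0:ℝ) < 1 / 4 by norm_num)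
  linarith

/-- The reciprocal of the `L`-function is of moderate growth in a zero-free region. -/
theorem exists_norm_inv_le (hL : IsRealLFunction ψ e H) : ∃ θ K : ℝ, 0 < θ ∧ θ ≤ 1 / 16 ∧ 0 < K ∧
    ∀ s : ℂ, 1 - θ / Real.log (|s.im| + 2) ≤ s.re → s.re ≤ 2 →
      H s ≠ 0 ∧ ‖(s - 1) ^ e / H s‖ ≤ K * (|s.im| + 2) ^ (1 / 2 : ℝ) := by
  obtain ⟨c, hc, hc1, hzf⟩ := hL.exists_zero_free
  obtain ⟨K, hK, hgr⟩ := hL.exists_log_growth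
  obtain ⟨K', hK', hlow⟩ := hL.exists_le_norm
  -- ε is chosen so that moving from 1 + η + it to s costs at most exp(l/4) = (|t| + 2)^(1/4) in
  -- Borel–Carathéodory. Another (|t| + 2)^(1/4) pays for 1/η; their product must stay below the
  -- first power for Perron's integral to converge absolutely.
  obtain ⟨θ, hθ, hθ1, -, hθ2⟩ := exists_mul_one_add_log_inv_le
    (ε := c / (128 * K)) (m := c / 16) (by positivity) (by positivity)
  refine ⟨θ, 12 * K' / θ, hθ, by linarith, by positivity, fun s hs1 hs2 => ?_⟩
  set t := s.im with ht
  have hl := half_le_log_abs_add_two t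
  have hlq := log_le_rpow_quarter t
  set l := Real.log (|t| + 2) with hldef
  have hl0 : 0 < l := by linarith
  set η := θ / l with hη
  have hη0 : 0 < η := by positivity
  have hη1 : η ≤ 1 / 8 := by rw [hη, div_le_iff₀ hl0]; linarith
  have ht0 := abs_nonneg t
  have hne : H s ≠ 0 := fun h0 => by
    have h1 := hzf s h0
    have h2 : η ≤ c / l := by rw [hη]; gcongr; linarith
    linarith
  refine ⟨hne, ?_⟩
  have hHs := norm_pos_iff.2 hne
  rw [norm_div, norm_pow, div_le_iff₀ hHs]
  have hq1 : 1 ≤ (|t| + 2) ^ (1 / 4 : ℝ) := Real.one_le_rpow (by linarith) (by norm_num)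
  have hq2 : (|t| + 2) ^ (1 / 2 : ℝ) = (|t| + 2) ^ (1 / 4 : ℝ) * (|t| + 2) ^ (1 / 4 : ℝ) := by
    rw [← Real.rpow_add (by positivity)]; norm_num
  set Q := (|t| + 2) ^ (1 / 4 : ℝ) with hQ
  have hηinv : K' / η ≤ 4 * K' / θ * Q := by
    rw [hη]
    calc K' / (θ / l) = K' / θ * l := by field_simp
      _ ≤ K' / θ * (4 * Q) := by gcongr
      _ = _ := by ring
  -- to the right of the centre the Euler product suffices
  rcases le_or_gt (1 + η) s.re with hright | hleft
  · have h1 := hlow s (by linarith) hs2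
    have h2 : ‖s - 1‖ ^ e * η ≤ K' * ‖H s‖ :=
      le_trans (by gcongr; linarith) h1
    rw [← le_div_iff₀ hη0] at h2
    calc ‖s - 1‖ ^ e ≤ K' * ‖H s‖ / η := h2
      _ = K' / η * ‖H s‖ := by ring
      _ ≤ 4 * K' / θ * Q * ‖H s‖ := by gcongr
      _ ≤ 12 * K' / θ * (Q * Q) * ‖H s‖ := by
          gcongr ?_ * ‖H s‖
          calc 4 * K' / θ * Q ≤ 12 * K' / θ * Q := by gcongr; norm_num
            _ ≤ _ := by gcongr; nlinarith
      _ = _ := by rw [hq2]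
  · set s1 : ℂ := ⟨1 + η, t⟩ with hs1def
    obtain ⟨B, hB, hBl, hBs⟩ := hgr θ t t hθ (by linarith) (by linarith)
    set r := c / (4 * l) with hr
    have hr0 : 0 < r := by positivity
    have hr1 : r ≤ 1 / 2 := by rw [hr, div_le_iff₀ (by positivity)]; linarith
    have hηr : 4 * η ≤ r := by
      have : 4 * η = 4 * (θ / l) := by rw [hη]
      rw [this, hr, show c / (4 * l) = (c / 4) / l by field_simp, ← mul_div_assoc]
      gcongr
      linarith
    have hdiff : s - s1 = ((s.re - (1 + η) : ℝ) : ℂ) := by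
      apply Complex.ext <;> simp [hs1def, ht]
    have hdist : ‖s - s1‖ ≤ 2 * η := by
      rw [hdiff, Complex.norm_real, Real.norm_eq_abs, abs_of_neg (by linarith)]
      linarith
    have hbc := (norm_le_of_ne_zero_of_norm_le hr0 hL.differentiable
      (ne_zero_of_mem_ball hc hc1 hzf hη0) hB (fun z hz => hBs z
        (Metric.closedBall_subset_closedBall hr1 (Metric.ball_subset_closedBall hz)))).2 s
      (by rw [Metric.mem_ball, dist_eq_norm]; linarith)
    have hlogB : 0 < Real.log B := Real.log_pos hB
    have hexp : 2 * Real.log B * ‖s - s1‖ / (r - ‖s - s1‖) ≤ l / 4 := by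
      calc 2 * Real.log B * ‖s - s1‖ / (r - ‖s - s1‖)
          ≤ 2 * Real.log B * (2 * η) / (r / 2) := by gcongr; linarith
        _ = 8 * Real.log B * η / r := by field_simp; ring
        _ = 32 * Real.log B * θ / c := by rw [hη, hr]; field_simp; ring
        _ ≤ 32 * (K * (1 + Real.log θ⁻¹) * l) * θ / c := by gcongr
        _ = 32 * K * l / c * (θ * (1 + Real.log θ⁻¹)) := by ring
        _ ≤ 32 * K * l / c * (c / (128 * K)) := by gcongr
        _ = l / 4 := by field_simp; norm_num
    have hQexp : Real.exp (l / 4) = Q := by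
      rw [hQ, Real.rpow_def_of_pos (by positivity), ← hldef]; ring_nf
    have h1 : ‖H s1‖ ≤ Q * ‖H s‖ := by
      have : ‖H s1‖ * Real.exp (-(l / 4)) ≤ ‖H s‖ :=
        le_trans (by gcongr) hbc
      rw [Real.exp_neg, hQexp, ← div_eq_mul_inv, div_le_iff₀ (by linarith)] at this
      linarith
    have h2 := hlow s1 (by simpa [hs1def] using hη0) (by simp [hs1def]; linarith)
    simp only [hs1def, add_sub_cancel_left] at h2
    rw [← hs1def] at h2
    have h3 : η ≤ ‖s1 - 1‖ := by
      have := Complex.abs_re_le_norm (s1 - 1)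
      simp only [hs1def, Complex.sub_re, Complex.one_re, add_sub_cancel_left] at this
      exact (le_abs_self _).trans this
    have h4 : ‖s - 1‖ ^ e ≤ 3 * ‖s1 - 1‖ ^ e := by
      have h5 : ‖s - 1‖ ≤ 3 * ‖s1 - 1‖ := by
        have := norm_add_le (s - s1) (s1 - 1)
        rw [sub_add_sub_cancel] at this
        linarith
      have he := hL.exponent_le
      interval_cases e
      · simp
      · simpa using h5
    have h6 : ‖s1 - 1‖ ^ e ≤ K' / η * ‖H s1‖ := by
      rw [div_mul_eq_mul_div, le_div_iff₀ hη0]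
      exact h2
    calc ‖s - 1‖ ^ e ≤ 3 * (K' / η * ‖H s1‖) := h4.trans (by gcongr)
      _ ≤ 3 * (4 * K' / θ * Q * (Q * ‖H s‖)) := by gcongr
      _ = _ := by rw [hq2]; ring

end IsRealLFunction

/-! ### Perron's formula with Cesàro weights -/

/-- The Cesàro kernel `(1 - u)₊`. -/
noncomputable def cesaroKernel (u : ℝ) : ℂ := ((max (1 - u) 0 : ℝ) : ℂ)

/-- The transform is 1/s - 1/(s + 1). Its quadratic decay, unlike the 1/s of a sharp cutoff, makes
the inversion integral absolutely convergent. -/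
lemma hasMellin_cesaroKernel {s : ℂ} (hs : 0 < s.re) :
    HasMellin cesaroKernel s (1 / (s * (s + 1))) := by
  have h1 := hasMellin_one_Ioc hs
  have h2 := hasMellin_cpow_Ioc 1 (s := s) (by simp; linarith)
  have h3 := hasMellin_sub h1.1 h2.1
  rw [h1.2, h2.2] at h3
  have hs0 : s ≠ 0 := fun h => by simp [h] at hs
  have hs1 : s + 1 ≠ 0 := fun h => by
    have := congrArg Complex.re h
    simp at this; linarith
  have hval : 1 / s - 1 / (s + 1) = 1 / (s * (s + 1)) := by field_simp; ring
  rw [hval] at h3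
  have hcongr : Set.EqOn (fun t : ℝ => (t : ℂ) ^ (s - 1) • (Set.indicator (Set.Ioc 0 1)
      (fun _ => (1 : ℂ)) t - Set.indicator (Set.Ioc 0 1) (fun t : ℝ => (t : ℂ) ^ (1 : ℂ)) t))
      (fun t : ℝ => (t : ℂ) ^ (s - 1) • cesaroKernel t) (Set.Ioi 0) := by
    intro t ht
    have ht' : 0 < t := ht
    simp only [cesaroKernel]
    congr 1
    by_cases h : t ≤ 1
    · have hmem : t ∈ Set.Ioc (0:ℝ) 1 := ⟨ht', h⟩
      rw [Set.indicator_of_mem hmem, Set.indicator_of_mem hmem,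
        max_eq_left (by linarith)]
      simp
    · rw [Set.indicator_of_notMem (fun h' => h h'.2), Set.indicator_of_notMem (fun h' => h h'.2),
        max_eq_right (by linarith)]
      simp
  refine ⟨MeasureTheory.IntegrableOn.congr_fun h3.1 hcongr measurableSet_Ioi, ?_⟩
  rw [← h3.2, mellin, mellin]
  exact (MeasureTheory.setIntegral_congr_fun measurableSet_Ioi hcongr).symm

lemma continuous_cesaroKernel : Continuous cesaroKernel := by
  unfold cesaroKernel; fun_prop

lemma le_norm_mul_add_one {s : ℂ} (hs : 1 / 2 ≤ s.re) :
    (|s.im| + 2) ^ 2 / 36 ≤ ‖s * (s + 1)‖ := by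
  have h : ∀ z : ℂ, 1 / 2 ≤ z.re → (|z.im| + 2) / 6 ≤ ‖z‖ := by
    intro z hz
    refine le_of_sq_le_sq ?_ (norm_nonneg z)
    rw [← Complex.normSq_eq_norm_sq, Complex.normSq_apply]
    nlinarith [sq_abs z.im, sq_nonneg (|z.im| - 1), abs_nonneg z.im]
  rw [norm_mul]
  calc _ = (|s.im| + 2) / 6 * ((|s.im| + 2) / 6) := by ring
    _ ≤ _ := mul_le_mul (h s hs) (by simpa using h (s + 1) (by simp; linarith)) (by positivity)
      (norm_nonneg _)

lemma integrable_inv_mul_add_one {σ : ℝ} (hσ : 1 / 2 ≤ σ) :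
    MeasureTheory.Integrable fun y : ℝ =>
      (1 : ℂ) / (((σ : ℂ) + y * Complex.I) * ((σ : ℂ) + y * Complex.I + 1)) := by
  refine (integrable_inv_one_add_sq.const_mul 36).mono' ?_ (Eventually.of_forall fun y => ?_)
  · refine Continuous.aestronglyMeasurable ?_
    refine Continuous.div continuous_const (by fun_prop) fun y h => ?_
    have := le_norm_mul_add_one (s := (σ : ℂ) + y * Complex.I) (by simpa using hσ)
    rw [h, norm_zero] at this
    have h2 : 0 < (|((σ : ℂ) + y * Complex.I).im| + 2) ^ 2 / 36 := by positivity
    linarith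
  · have := le_norm_mul_add_one (s := (σ : ℂ) + y * Complex.I) (by simpa using hσ)
    simp only [Complex.add_im, Complex.ofReal_im, Complex.mul_im, Complex.ofReal_re, Complex.I_im,
      Complex.I_re, mul_zero, mul_one, zero_add, add_zero] at this
    rw [norm_div, norm_one, ← div_eq_mul_inv, div_le_div_iff₀ ?_ (by positivity)]
    · nlinarith [sq_abs y, abs_nonneg y]
    · have h2 : 0 < (|y| + 2) ^ 2 / 36 := by positivity
      linarith

/-- The Mellin inversion formula for the Cesàro kernel. -/
lemma cesaroKernel_eq_integral {σ x : ℝ} (hσ : 1 < σ) (hx : 0 < x) :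
    cesaroKernel x = (1 / (2 * Real.pi) : ℝ) • ∫ y : ℝ, (x : ℂ) ^ (-((σ : ℂ) + y * Complex.I)) •
      ((1 : ℂ) / (((σ : ℂ) + y * Complex.I) * ((σ : ℂ) + y * Complex.I + 1))) := by
  have hm : ∀ y : ℝ, mellin cesaroKernel ((σ : ℂ) + y * Complex.I) =
      (1 : ℂ) / (((σ : ℂ) + y * Complex.I) * ((σ : ℂ) + y * Complex.I + 1)) := fun y =>
    (hasMellin_cesaroKernel (by simp; linarith)).2
  have := mellinInv_mellin_eq σ cesaroKernel hx
    (hasMellin_cesaroKernel (by simp; linarith)).1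
    (by
      unfold Complex.VerticalIntegrable
      simp only [hm]
      exact integrable_inv_mul_add_one (by linarith))
    continuous_cesaroKernel.continuousAt
  rw [← this, mellinInv]
  simp only [hm]

/-- **Perron's formula** with Cesàro weights. -/
lemma sum_cesaro_eq_integral {a : ℕ → ℂ} (ha : ∀ n, ‖a n‖ ≤ 1) {σ x : ℝ} (hσ : 1 < σ)
    (hx : 0 < x) :
    ∑ n ∈ Finset.Icc 1 ⌊x⌋₊, a n * (1 - n / x) = (1 / (2 * Real.pi) : ℝ) • ∫ y : ℝ,
      LSeries a ((σ : ℂ) + y * Complex.I) * ((x : ℂ) ^ ((σ : ℂ) + y * Complex.I) *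
        ((1 : ℂ) / (((σ : ℂ) + y * Complex.I) * ((σ : ℂ) + y * Complex.I + 1)))) := by
  set k : ℝ → ℂ := fun y =>
    (1 : ℂ) / (((σ : ℂ) + y * Complex.I) * ((σ : ℂ) + y * Complex.I + 1)) with hk
  set s : ℝ → ℂ := fun y => (σ : ℂ) + y * Complex.I with hs
  have hsre : ∀ y, (s y).re = σ := fun y => by simp [hs]
  have hkint : MeasureTheory.Integrable k := integrable_inv_mul_add_one (by linarith)
  have hx0 : (x : ℂ) ≠ 0 := by exact_mod_cast hx.ne'
  set F : ℕ → ℝ → ℂ := fun n y => LSeries.term a (s y) n * ((x : ℂ) ^ s y * k y) with hF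
  have hFnorm : ∀ n y, ‖F n y‖ ≤ ‖LSeries.term 1 (σ : ℂ) n‖ * (x ^ σ * ‖k y‖) := by
    intro n y
    rw [hF]
    simp only [norm_mul]
    rw [Complex.norm_cpow_eq_rpow_re_of_pos hx, hsre]
    gcongr
    rcases eq_or_ne n 0 with rfl | hn
    · simp
    · have h0 : (0:ℝ) < n := by exact_mod_cast Nat.pos_of_ne_zero hn
      have h1 := Complex.norm_cpow_eq_rpow_re_of_pos h0 (s y)
      have h2 := Complex.norm_cpow_eq_rpow_re_of_pos h0 (σ : ℂ)
      simp only [Complex.ofReal_natCast, Complex.ofReal_re, hsre] at h1 h2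
      rw [LSeries.term_of_ne_zero hn, LSeries.term_of_ne_zero hn, norm_div, norm_div, h1, h2]
      gcongr
      simpa using ha n
  have hscont : Continuous s := by rw [hs]; fun_prop
  have hFint : ∀ n, MeasureTheory.Integrable (F n) := by
    intro n
    refine ((hkint.norm.const_mul (x ^ σ)).const_mul ‖LSeries.term 1 (σ : ℂ) n‖).mono' ?_
      (Eventually.of_forall (hFnorm n))
    refine Continuous.aestronglyMeasurable ?_ |>.mul
      ((Continuous.aestronglyMeasurable ?_).mul hkint.aestronglyMeasurable)
    · rcases eq_or_ne n 0 with rfl | hn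
      · simp [continuous_const]
      · simp only [LSeries.term_of_ne_zero hn]
        have hn0 : (n : ℂ) ≠ 0 := by exact_mod_cast hn
        refine continuous_const.div (hscont.const_cpow (.inl hn0)) fun y => ?_
        simp [Complex.cpow_eq_zero_iff, hn0]
    · exact hscont.const_cpow (.inl hx0)
  have hsum1 : Summable fun n => ‖LSeries.term 1 (σ : ℂ) n‖ :=
    (LSeriesSummable_one_iff.2 (by simpa using hσ)).norm
  -- Domination by the terms of ζ(σ) times an integrable kernel permits exchanging sum and integral.
  have hFsum : Summable fun n => ∫ y, ‖F n y‖ := by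
    refine Summable.of_nonneg_of_le (fun n => MeasureTheory.integral_nonneg fun y => norm_nonneg _)
      (fun n => ?_) (hsum1.mul_right (∫ y, x ^ σ * ‖k y‖))
    rw [← MeasureTheory.integral_const_mul]
    exact MeasureTheory.integral_mono (hFint n).norm
      ((hkint.norm.const_mul _).const_mul _) (hFnorm n)
  have hmain := MeasureTheory.hasSum_integral_of_summable_integral_norm hFint hFsum
  have htsum : ∀ y, ∑' n, F n y = LSeries a (s y) * ((x : ℂ) ^ s y * k y) := fun y => by
    rw [hF]; simp only; rw [tsum_mul_right]; rfl
  simp only [htsum] at hmain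
  have hterm : ∀ n, (1 / (2 * Real.pi) : ℝ) • ∫ y, F n y =
      if n = 0 then 0 else a n * cesaroKernel (n / x) := by
    intro n
    rcases eq_or_ne n 0 with rfl | hn
    · simp [hF]
    · have h0 : (0:ℝ) < n := by exact_mod_cast Nat.pos_of_ne_zero hn
      rw [if_neg hn, cesaroKernel_eq_integral hσ (div_pos h0 hx), mul_smul_comm,
        ← MeasureTheory.integral_const_mul]
      congr 2
      ext y
      have hn0 : (n : ℂ) ≠ 0 := by exact_mod_cast hn
      have : ((n / x : ℝ) : ℂ) ^ (-s y) = (x : ℂ) ^ s y / (n : ℂ) ^ s y := by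
        rw [Complex.ofReal_div, Complex.ofReal_natCast]
        have h1 : ((n : ℂ) / x) ^ (-s y) = ((n : ℂ) ^ (-s y)) / ((x : ℂ) ^ (-s y)) := by
          have := Complex.div_cpow_ofReal_nonneg h0.le hx.le (-s y)
          simpa using this
        rw [h1, Complex.cpow_neg, Complex.cpow_neg]
        field_simp
      rw [hF]
      simp only [LSeries.term_of_ne_zero hn]
      change _ = a n * ((((n / x : ℝ) : ℂ) ^ (-s y)) • k y)
      rw [this, smul_eq_mul]
      ring
  have h2 := hmain.const_smul (1 / (2 * Real.pi) : ℝ)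
  simp only [hterm] at h2
  -- The kernel at n / x vanishes for n ≥ x, so only n ≤ ⌊x⌋ survive.
  rw [← h2.tsum_eq, tsum_eq_sum (s := Finset.Icc 1 ⌊x⌋₊)]
  · refine Finset.sum_congr rfl fun n hn => ?_
    rw [Finset.mem_Icc] at hn
    rw [if_neg (by omega), cesaroKernel, max_eq_left]
    · push_cast; ring
    · have := (Nat.le_floor_iff hx.le).1 hn.2
      rw [sub_nonneg, div_le_one hx]
      exact this
  · intro n hn
    split_ifs with h0
    · rfl
    · rw [Finset.mem_Icc, not_and_or] at hn
      have hn' : ⌊x⌋₊ < n := by omega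
      have := (Nat.floor_lt hx.le).1 hn'
      rw [cesaroKernel, max_eq_right]
      · simp
      · rw [sub_nonpos, one_le_div hx]; exact this.le

namespace IsRealLFunction

variable {ψ : ℕ → ℂ} {e : ℕ} {H : ℂ → ℂ}

lemma LSeries_mul_moebius_eq (hL : IsRealLFunction ψ e H) {s : ℂ} (hs : 1 < s.re) :
    LSeries (ψ * fun n => (ArithmeticFunction.moebius n : ℂ)) s = (s - 1) ^ e / H s := by
  have hs1 : s - 1 ≠ 0 := fun h => by
    rw [sub_eq_zero] at h; rw [h] at hs; simp at hs
  have h1 := hL.mul_moebius s hs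
  have h2 : LSeries ψ s ≠ 0 := fun h => by simp [h] at h1
  rw [hL.eq_LSeries s hs, eq_div_iff (mul_ne_zero (pow_ne_zero _ hs1) h2)]
  linear_combination (s - 1) ^ e * h1

/-- A bound for Perron's integrand in the zero-free region. -/
lemma exists_integrand_le (hL : IsRealLFunction ψ e H) : ∃ θ K : ℝ, 0 < θ ∧ θ ≤ 1 / 16 ∧ 0 < K ∧
    ∀ x : ℝ, 0 < x → ∀ s : ℂ, 1 - θ / Real.log (|s.im| + 2) ≤ s.re → s.re ≤ 2 →
      H s ≠ 0 ∧ s * (s + 1) ≠ 0 ∧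
      ‖(s - 1) ^ e / H s * ((x : ℂ) ^ s * (1 / (s * (s + 1))))‖ ≤
        K * x ^ s.re * (1 + |s.im|) ^ (-(3 / 2) : ℝ) := by
  obtain ⟨θ, K, hθ, hθ1, hK, h⟩ := hL.exists_norm_inv_le
  refine ⟨θ, 36 * K, hθ, hθ1, by positivity, fun x hx s hs1 hs2 => ?_⟩
  obtain ⟨h1, h2⟩ := h s hs1 hs2
  have hl := half_le_log_abs_add_two s.im
  have hre : 1 / 2 ≤ s.re := by
    have : θ / Real.log (|s.im| + 2) ≤ 1 / 2 := by
      rw [div_le_iff₀ (by linarith)]; linarith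
    linarith
  have h3 := le_norm_mul_add_one hre
  have h4 : 0 < ‖s * (s + 1)‖ := lt_of_lt_of_le (by positivity) h3
  refine ⟨h1, norm_pos_iff.1 h4, ?_⟩
  have ht := abs_nonneg s.im
  rw [norm_mul, norm_mul, Complex.norm_cpow_eq_rpow_re_of_pos hx, norm_div (1:ℂ), norm_one]
  have h5 : 1 / ‖s * (s + 1)‖ ≤ 36 * (|s.im| + 2) ^ (-2 : ℝ) := by
    rw [Real.rpow_neg (by positivity), div_le_iff₀ h4, Real.rpow_two]
    calc (1:ℝ) = 36 * ((|s.im| + 2) ^ 2)⁻¹ * ((|s.im| + 2) ^ 2 / 36) := by field_simp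
      _ ≤ _ := by gcongr
  calc _ ≤ K * (|s.im| + 2) ^ (1 / 2 : ℝ) * (x ^ s.re * (36 * (|s.im| + 2) ^ (-2 : ℝ))) := by
        gcongr
    _ = 36 * K * x ^ s.re * ((|s.im| + 2) ^ (1 / 2 : ℝ) * (|s.im| + 2) ^ (-2 : ℝ)) := by ring
    _ = 36 * K * x ^ s.re * (|s.im| + 2) ^ (-(3 / 2) : ℝ) := by
        rw [← Real.rpow_add (by positivity)]; norm_num
    _ ≤ _ := by
        refine mul_le_mul_of_nonneg_left ?_ (by positivity)
        exact Real.rpow_le_rpow_of_nonpos (by positivity) (by linarith) (by norm_num)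

end IsRealLFunction

/-! ### Contour shift and the prime number theorem with classical error term -/

/-- Part of the decay is traded for a saving (1 + T)^(-1/4), leaving the still integrable exponent
5/4. -/
lemma rpow_three_half_le {T y : ℝ} (hT : 0 ≤ T) (hy : T ≤ |y|) :
    (1 + |y|) ^ (-(3 / 2) : ℝ) ≤ (1 + T) ^ (-(1 / 4) : ℝ) * (1 + |y|) ^ (-(5 / 4) : ℝ) := by
  have h0 := abs_nonneg y
  calc (1 + |y|) ^ (-(3 / 2) : ℝ)
      = (1 + |y|) ^ (-(1 / 4) : ℝ) * (1 + |y|) ^ (-(5 / 4) : ℝ) := by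
        rw [← Real.rpow_add (by positivity)]; norm_num
    _ ≤ _ := by
        gcongr ?_ * _
        exact Real.rpow_le_rpow_of_nonpos (by positivity) (by linarith) (by norm_num)

lemma integrable_one_add_abs_rpow {r : ℝ} (hr : 1 < r) :
    MeasureTheory.Integrable fun y : ℝ => (1 + |y|) ^ (-r) := by
  have : MeasureTheory.Integrable (fun y : ℝ => (1 + ‖y‖) ^ (-r)) :=
    integrable_one_add_norm (by simpa using hr)
  simpa using this

/-- Shifting a vertical line of integration for a function that decays like `|y| ^ (-3/2)`. -/
lemma norm_integral_vertical_le {F : ℂ → ℂ} {σ₀ σ₁ T M₀ M₁ : ℝ} (hT : 0 ≤ T) (hσ : σ₁ ≤ σ₀)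
    (hσ' : σ₀ ≤ σ₁ + 2) (hM₀ : 0 ≤ M₀) (hM₁ : 0 ≤ M₁)
    (hd : ∀ s : ℂ, σ₁ ≤ s.re → s.re ≤ σ₀ → |s.im| ≤ T → DifferentiableAt ℂ F s)
    (hint : MeasureTheory.Integrable fun y : ℝ => F ((σ₀ : ℂ) + y * Complex.I))
    (hb₀ : ∀ y : ℝ, ‖F ((σ₀ : ℂ) + y * Complex.I)‖ ≤ M₀ * (1 + |y|) ^ (-(3 / 2) : ℝ))
    (hb : ∀ s : ℂ, σ₁ ≤ s.re → s.re ≤ σ₀ → |s.im| = T → ‖F s‖ ≤ M₀ * (1 + T) ^ (-(3 / 2) : ℝ))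
    (hb₁ : ∀ y : ℝ, |y| ≤ T → ‖F ((σ₁ : ℂ) + y * Complex.I)‖ ≤ M₁ * (1 + |y|) ^ (-(3 / 2) : ℝ)) :
    ‖∫ y : ℝ, F ((σ₀ : ℂ) + y * Complex.I)‖ ≤
      (∫ y : ℝ, (1 + |y|) ^ (-(5 / 4) : ℝ)) * (M₀ * (1 + T) ^ (-(1 / 4) : ℝ) + M₁) +
        4 * M₀ * (1 + T) ^ (-(1 / 4) : ℝ) := by
  set J := ∫ y : ℝ, (1 + |y|) ^ (-(5 / 4) : ℝ) with hJ
  have hJi := integrable_one_add_abs_rpow (r := 5 / 4) (by norm_num)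
  have hW : ∀ y : ℝ, (1 + |y|) ^ (-(3 / 2) : ℝ) ≤ (1 + |y|) ^ (-(5 / 4) : ℝ) := fun y =>
    Real.rpow_le_rpow_of_exponent_le (by linarith [abs_nonneg y]) (by norm_num)
  have hW0 : ∀ y : ℝ, 0 ≤ (1 + |y|) ^ (-(5 / 4) : ℝ) := fun y => by positivity
  -- the tails
  have htail : ‖(∫ y : ℝ, F ((σ₀ : ℂ) + y * Complex.I)) -
      ∫ y in (-T)..T, F ((σ₀ : ℂ) + y * Complex.I)‖ ≤ J * (M₀ * (1 + T) ^ (-(1 / 4) : ℝ)) := by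
    rw [intervalIntegral.integral_of_le (by linarith),
      ← MeasureTheory.integral_add_compl (measurableSet_Ioc (a := -T) (b := T)) hint,
      add_sub_cancel_left]
    calc _ ≤ ∫ y in (Set.Ioc (-T) T)ᶜ, M₀ * (1 + T) ^ (-(1 / 4) : ℝ) * (1 + |y|) ^ (-(5 / 4) : ℝ) := by
          refine MeasureTheory.norm_integral_le_of_norm_le (hJi.const_mul _).integrableOn ?_
          refine (MeasureTheory.ae_restrict_iff' measurableSet_Ioc.compl).2
            (Eventually.of_forall fun y hy => ?_)
          have hy' : T ≤ |y| := by
            by_contra! h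
            rw [abs_lt] at h
            exact hy ⟨h.1, h.2.le⟩
          refine (hb₀ y).trans ?_
          rw [mul_assoc]
          gcongr
          exact rpow_three_half_le hT hy'
      _ ≤ ∫ y : ℝ, M₀ * (1 + T) ^ (-(1 / 4) : ℝ) * (1 + |y|) ^ (-(5 / 4) : ℝ) :=
          MeasureTheory.setIntegral_le_integral (hJi.const_mul _)
            (Eventually.of_forall fun y => by positivity)
      _ = _ := by rw [MeasureTheory.integral_const_mul]; ring
  -- the left edge
  have hleft : ‖∫ y in (-T)..T, F ((σ₁ : ℂ) + y * Complex.I)‖ ≤ J * M₁ := by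
    rw [intervalIntegral.integral_of_le (by linarith)]
    calc _ ≤ ∫ y in Set.Ioc (-T) T, M₁ * (1 + |y|) ^ (-(5 / 4) : ℝ) := by
          refine MeasureTheory.norm_integral_le_of_norm_le (hJi.const_mul _).integrableOn ?_
          refine (MeasureTheory.ae_restrict_iff' measurableSet_Ioc).2
            (Eventually.of_forall fun y hy => ?_)
          exact (hb₁ y (abs_le.2 ⟨hy.1.le, hy.2⟩)).trans
            (mul_le_mul_of_nonneg_left (hW y) hM₁)
      _ ≤ ∫ y : ℝ, M₁ * (1 + |y|) ^ (-(5 / 4) : ℝ) :=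
          MeasureTheory.setIntegral_le_integral (hJi.const_mul _)
            (Eventually.of_forall fun y => by positivity)
      _ = _ := by rw [MeasureTheory.integral_const_mul]; ring
  -- the horizontal edges
  have hhor : ∀ t : ℝ, |t| = T → ‖∫ u in σ₁..σ₀, F ((u : ℂ) + t * Complex.I)‖ ≤
      2 * M₀ * (1 + T) ^ (-(1 / 4) : ℝ) := by
    intro t ht
    have h1 : ‖∫ u in σ₁..σ₀, F ((u : ℂ) + t * Complex.I)‖ ≤
        M₀ * (1 + T) ^ (-(3 / 2) : ℝ) * |σ₀ - σ₁| := by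
      refine intervalIntegral.norm_integral_le_of_norm_le_const fun u hu => ?_
      rw [Set.uIoc_of_le hσ] at hu
      exact hb _ (by simpa using hu.1.le) (by simpa using hu.2) (by simpa using ht)
    refine h1.trans ?_
    rw [abs_of_nonneg (by linarith)]
    have h2 : (1 + T) ^ (-(3 / 2) : ℝ) ≤ (1 + T) ^ (-(1 / 4) : ℝ) :=
      Real.rpow_le_rpow_of_exponent_le (by linarith) (by norm_num)
    calc _ ≤ M₀ * (1 + T) ^ (-(1 / 4) : ℝ) * 2 := by gcongr; linarith
      _ = _ := by ring
  have hrect := Complex.integral_boundary_rect_eq_zero_of_differentiableOn F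
    (⟨σ₁, -T⟩ : ℂ) ⟨σ₀, T⟩ (fun s hs => by
      rw [Complex.mem_reProdIm] at hs
      simp only [Set.uIcc_of_le hσ, Set.uIcc_of_le (show -T ≤ T by linarith)] at hs
      exact (hd s hs.1.1 hs.1.2 (abs_le.2 hs.2)).differentiableWithinAt)
  simp only [smul_eq_mul] at hrect
  -- Cauchy's theorem on the rectangle, multiplied by -i to isolate the right edge.
  have hmid : (∫ y in (-T)..T, F ((σ₀ : ℂ) + y * Complex.I)) =
      (∫ y in (-T)..T, F ((σ₁ : ℂ) + y * Complex.I)) +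
      Complex.I * ((∫ u in σ₁..σ₀, F ((u : ℂ) + (-T : ℝ) * Complex.I)) -
        ∫ u in σ₁..σ₀, F ((u : ℂ) + T * Complex.I)) := by
    linear_combination (-Complex.I) * hrect + ((∫ y in (-T)..T, F ((σ₀ : ℂ) + y * Complex.I)) -
      (∫ y in (-T)..T, F ((σ₁ : ℂ) + y * Complex.I))) * Complex.I_mul_I
  have hmidn : ‖∫ y in (-T)..T, F ((σ₀ : ℂ) + y * Complex.I)‖ ≤
      J * M₁ + (2 * M₀ * (1 + T) ^ (-(1 / 4) : ℝ) + 2 * M₀ * (1 + T) ^ (-(1 / 4) : ℝ)) := by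
    rw [hmid]
    refine (norm_add_le _ _).trans (add_le_add hleft ?_)
    rw [norm_mul, Complex.norm_I, one_mul]
    exact (norm_sub_le _ _).trans (add_le_add (hhor (-T) (by rw [abs_neg, abs_of_nonneg hT]))
      (hhor T (abs_of_nonneg hT)))
  have := norm_add_le ((∫ y : ℝ, F ((σ₀ : ℂ) + y * Complex.I)) -
      ∫ y in (-T)..T, F ((σ₀ : ℂ) + y * Complex.I)) (∫ y in (-T)..T, F ((σ₀ : ℂ) + y * Complex.I))
  rw [sub_add_cancel] at this
  linarith

end

namespace IsRealLFunction

variable {ψ : ℕ → ℂ} {e : ℕ} {H : ℂ → ℂ}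

/-- The line Re s = 1 + 1/log x, where x^s has size e x, is shifted to the edge of the zero-free
region up to height T. The shift saves x^(-θ/log(T + 2)) and the truncation saves T^(-1/4). -/
theorem exists_norm_sum_cesaro_le (hL : IsRealLFunction ψ e H) : ∃ c K : ℝ, 0 < c ∧ c ≤ 1 ∧ 0 < K ∧
    ∀ x : ℝ, Real.exp 1 ≤ x →
      ‖∑ n ∈ Finset.Icc 1 ⌊x⌋₊, (ψ * fun n => (ArithmeticFunction.moebius n : ℂ)) n * (1 - n / x)‖ ≤
        K * x * Real.exp (-(c * √(Real.log x))) := by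
  obtain ⟨θ, K, hθ, hθ1, hK, hF⟩ := hL.exists_integrand_le
  set J := ∫ y : ℝ, (1 + |y|) ^ (-(5 / 4) : ℝ) with hJ
  have hJ0 : 0 ≤ J := MeasureTheory.integral_nonneg fun y => by positivity
  refine ⟨θ / 2, J * (K * Real.exp 1 + K) + 4 * (K * Real.exp 1), by positivity, by linarith,
    by positivity, fun x hx => ?_⟩
  have hx0 : 0 < x := (Real.exp_pos 1).trans_le hx
  have hx1 : 1 ≤ x := (Real.one_le_exp zero_le_one).trans hx
  have hlog : 1 ≤ Real.log x := (Real.le_log_iff_exp_le hx0).2 hx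
  set u := √(Real.log x) with hu
  have hu1 : 1 ≤ u := Real.one_le_sqrt.2 hlog
  have hu2 : u * u = Real.log x := Real.mul_self_sqrt (by linarith)
  -- T = exp(√log x) balances the two savings: log(T + 2) ≤ 2u gives x^(-θ/(2u)) = exp(-θu/2), and
  -- T^(-1/4) = exp(-u/4) is no larger.
  set T := Real.exp u with hT
  have hT2 : 2 ≤ T := by
    have := Real.add_one_le_exp u; linarith
  have hTabs : |T| = T := abs_of_pos (by linarith)
  have hlT : 1 / 2 ≤ Real.log (T + 2) := by
    have := half_le_log_abs_add_two T; rwa [hTabs] at this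
  have hlT2 : Real.log (T + 2) ≤ 2 * u := by
    have : Real.log (T + 2) ≤ Real.log (T ^ 2) := Real.log_le_log (by linarith) (by nlinarith)
    rwa [Real.log_pow, hT, Real.log_exp, Nat.cast_ofNat] at this
  set σ₀ := 1 + 1 / Real.log x with hσ₀
  set σ₁ := 1 - θ / Real.log (T + 2) with hσ₁
  have h1 : 0 < 1 / Real.log x := by positivity
  have h2 : 1 / Real.log x ≤ 1 := by rw [div_le_one (by linarith)]; exact hlog
  have h3 : 0 < θ / Real.log (T + 2) := div_pos hθ (by linarith)
  have h4 : θ / Real.log (T + 2) ≤ 1 / 2 := by rw [div_le_iff₀ (by linarith)]; linarith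
  have hvre : ∀ σ y : ℝ, ((σ : ℂ) + y * Complex.I).re = σ := fun σ y => by simp
  have hvim : ∀ σ y : ℝ, ((σ : ℂ) + y * Complex.I).im = y := fun σ y => by simp
  have hregion : ∀ s : ℂ, σ₁ ≤ s.re → |s.im| ≤ T → 1 - θ / Real.log (|s.im| + 2) ≤ s.re := by
    intro s hs hs'
    refine le_trans ?_ hs
    have := half_le_log_abs_add_two s.im
    rw [hσ₁]
    gcongr
  have hregion₀ : ∀ y : ℝ, 1 - θ / Real.log (|((σ₀ : ℂ) + y * Complex.I).im| + 2) ≤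
      ((σ₀ : ℂ) + y * Complex.I).re := by
    intro y
    have := half_le_log_abs_add_two ((σ₀ : ℂ) + y * Complex.I).im
    have h5 : 0 ≤ θ / Real.log (|((σ₀ : ℂ) + y * Complex.I).im| + 2) :=
      div_nonneg hθ.le (by linarith)
    have h6 : ((σ₀ : ℂ) + y * Complex.I).re = σ₀ := by simp
    rw [h6]; linarith
  have hxσ₀ : x ^ σ₀ = Real.exp 1 * x := by
    rw [hσ₀, Real.rpow_add hx0, Real.rpow_one, Real.rpow_def_of_pos hx0, mul_one_div_cancel
      (by linarith), mul_comm]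
  set F : ℂ → ℂ := fun s => (s - 1) ^ e / H s * ((x : ℂ) ^ s * (1 / (s * (s + 1)))) with hFdef
  have hM₀ : K * x ^ σ₀ = K * Real.exp 1 * x := by rw [hxσ₀]; ring
  have hb₀ : ∀ y : ℝ, ‖F ((σ₀ : ℂ) + y * Complex.I)‖ ≤
      K * Real.exp 1 * x * (1 + |y|) ^ (-(3 / 2) : ℝ) := by
    intro y
    have := (hF x hx0 _ (hregion₀ y) (by simp; linarith)).2.2
    rw [hvre, hvim] at this
    rw [← hM₀]
    exact this
  have hdiff : ∀ s : ℂ, 1 - θ / Real.log (|s.im| + 2) ≤ s.re → s.re ≤ 2 →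
      DifferentiableAt ℂ F s := by
    intro s hs hs2
    obtain ⟨hne, hne2, -⟩ := hF x hx0 s hs hs2
    have hxc : (x : ℂ) ≠ 0 := by exact_mod_cast hx0.ne'
    have hHd := hL.differentiable s
    have hpow : DifferentiableAt ℂ (fun s : ℂ => (x : ℂ) ^ s) s :=
      differentiableAt_id.const_cpow (.inl hxc)
    exact ((((differentiableAt_id.sub_const 1).pow e).div hHd hne).mul
      (hpow.mul ((differentiableAt_const 1).div
        (differentiableAt_id.mul (differentiableAt_id.add_const 1)) hne2)))
  have hcont : Continuous fun y : ℝ => F ((σ₀ : ℂ) + y * Complex.I) := by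
    refine continuous_iff_continuousAt.2 fun y => ?_
    refine ContinuousAt.comp (f := fun y : ℝ => (σ₀ : ℂ) + y * Complex.I)
      (hdiff _ (hregion₀ y) (by simp; linarith)).continuousAt ?_
    fun_prop
  have hint : MeasureTheory.Integrable fun y : ℝ => F ((σ₀ : ℂ) + y * Complex.I) :=
    ((integrable_one_add_abs_rpow (r := 3 / 2) (by norm_num)).const_mul _).mono'
      hcont.aestronglyMeasurable (Eventually.of_forall hb₀)
  have hmain := norm_integral_vertical_le (F := F) (σ₀ := σ₀) (σ₁ := σ₁) (T := T)
    (M₀ := K * Real.exp 1 * x) (M₁ := K * x ^ σ₁) (by linarith) (by linarith) (by linarith)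
    (by positivity) (by positivity)
    (fun s hs hs0 hsT => hdiff s (hregion s hs hsT) (by linarith)) hint hb₀
    (fun s hs hs0 hsT => by
      have := (hF x hx0 s (hregion s hs hsT.le) (by linarith)).2.2
      rw [hsT] at this
      refine this.trans ?_
      rw [← hM₀]
      gcongr)
    (fun y hy => by
      have := (hF x hx0 ((σ₁ : ℂ) + y * Complex.I)
        (hregion _ (by simp) (by simpa using hy)) (by simp; linarith)).2.2
      rw [hvre, hvim] at this
      exact this)
  rw [← hJ] at hmain
  set E := Real.exp (-(θ / 2 * u)) with hE
  have hT4 : (1 + T) ^ (-(1 / 4) : ℝ) ≤ E := by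
    calc (1 + T) ^ (-(1 / 4) : ℝ) ≤ T ^ (-(1 / 4) : ℝ) :=
          Real.rpow_le_rpow_of_nonpos (by linarith) (by linarith) (by norm_num)
      _ = Real.exp (u * (-(1 / 4))) := by rw [hT, ← Real.exp_mul]
      _ ≤ E := by
          rw [hE, Real.exp_le_exp]
          nlinarith
  have hxσ₁ : x ^ σ₁ ≤ x * E := by
    rw [hσ₁, sub_eq_add_neg, Real.rpow_add hx0, Real.rpow_one]
    gcongr
    rw [Real.rpow_def_of_pos hx0, hE, Real.exp_le_exp, ← hu2]
    have : θ / (2 * u) ≤ θ / Real.log (T + 2) := by gcongr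
    have h7 : u * u * (θ / (2 * u)) = θ / 2 * u := by field_simp
    nlinarith
  rw [sum_cesaro_eq_integral hL.norm_mul_moebius_le_one (σ := σ₀) (by linarith) hx0, norm_smul]
  have hpi : ‖(1 / (2 * Real.pi) : ℝ)‖ ≤ 1 := by
    rw [Real.norm_of_nonneg (by positivity), div_le_one (by positivity)]
    linarith [Real.pi_gt_three]
  have hFeq : ∀ y : ℝ, LSeries (ψ * fun n => (ArithmeticFunction.moebius n : ℂ))
      ((σ₀ : ℂ) + y * Complex.I) * ((x : ℂ) ^ ((σ₀ : ℂ) + y * Complex.I) *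
        ((1 : ℂ) / (((σ₀ : ℂ) + y * Complex.I) * ((σ₀ : ℂ) + y * Complex.I + 1)))) =
      F ((σ₀ : ℂ) + y * Complex.I) := fun y => by
    rw [hL.LSeries_mul_moebius_eq (by simp; linarith)]
  simp only [hFeq]
  calc _ ≤ 1 * ‖∫ y : ℝ, F ((σ₀ : ℂ) + y * Complex.I)‖ := by gcongr
    _ ≤ J * (K * Real.exp 1 * x * (1 + T) ^ (-(1 / 4) : ℝ) + K * x ^ σ₁) +
        4 * (K * Real.exp 1 * x) * (1 + T) ^ (-(1 / 4) : ℝ) := by rw [one_mul]; exact hmain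
    _ ≤ J * (K * Real.exp 1 * x * E + K * (x * E)) + 4 * (K * Real.exp 1 * x) * E := by gcongr
    _ = _ := by ring

end IsRealLFunction

lemma norm_sum_le_floor {a : ℕ → ℂ} (ha : ∀ n, ‖a n‖ ≤ 1) {x : ℝ} (hx : 0 ≤ x) :
    ‖∑ n ∈ Finset.Icc 1 ⌊x⌋₊, a n‖ ≤ x := by
  refine (norm_sum_le _ _).trans ((Finset.sum_le_card_nsmul _ _ 1 fun n _ => ha n).trans ?_)
  simpa using Nat.floor_le hx

/-- Removing Cesàro weights. -/
lemma norm_sum_le_of_cesaro {a : ℕ → ℂ} (ha : ∀ n, ‖a n‖ ≤ 1) {x Δ A B : ℝ} (hx : 0 < x)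
    (hΔ : 0 < Δ)
    (hA : ‖∑ n ∈ Finset.Icc 1 ⌊x⌋₊, a n * (1 - n / x)‖ ≤ A)
    (hB : ‖∑ n ∈ Finset.Icc 1 ⌊x + Δ⌋₊, a n * (1 - n / (x + Δ : ℝ))‖ ≤ B) :
    ‖∑ n ∈ Finset.Icc 1 ⌊x⌋₊, a n‖ ≤ (x * A + (x + Δ) * B) / Δ + Δ + 1 := by
  have hscale : ∀ y : ℝ, 0 < y → (∑ n ∈ Finset.Icc 1 ⌊y⌋₊, a n * ((y : ℂ) - n)) =
      y * ∑ n ∈ Finset.Icc 1 ⌊y⌋₊, a n * (1 - n / y) := by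
    intro y hy
    have : (y : ℂ) ≠ 0 := by exact_mod_cast hy.ne'
    rw [Finset.mul_sum]
    refine Finset.sum_congr rfl fun n _ => ?_
    field_simp
  have hle : ⌊x⌋₊ ≤ ⌊x + Δ⌋₊ := Nat.floor_le_floor (by linarith)
  have hIcc : ∀ m : ℕ, Finset.Icc 1 m = Finset.Ioc 0 m := fun m => by ext; simp; omega
  -- At y = x + Δ and y = x the sums ∑ a(n)(y - n) differ by Δ times the plain sum plus a remainder
  -- over (x, x + Δ], which has at most Δ + 1 integers of weight at most Δ.
  have hsplit : (Δ : ℂ) * ∑ n ∈ Finset.Icc 1 ⌊x⌋₊, a n =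
      (x + Δ : ℝ) * ∑ n ∈ Finset.Icc 1 ⌊x + Δ⌋₊, a n * (1 - n / (x + Δ : ℝ)) -
      x * ∑ n ∈ Finset.Icc 1 ⌊x⌋₊, a n * (1 - n / x) -
      ∑ n ∈ Finset.Ioc ⌊x⌋₊ ⌊x + Δ⌋₊, a n * (((x + Δ : ℝ) : ℂ) - n) := by
    rw [← hscale x hx, ← hscale (x + Δ) (by linarith), hIcc, hIcc,
      ← Finset.sum_Ioc_consecutive _ (Nat.zero_le _) hle, add_sub_right_comm, add_sub_cancel_right,
      ← Finset.sum_sub_distrib, Finset.mul_sum]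
    refine Finset.sum_congr rfl fun n _ => ?_
    push_cast; ring
  have hrest : ‖∑ n ∈ Finset.Ioc ⌊x⌋₊ ⌊x + Δ⌋₊, a n * (((x + Δ : ℝ) : ℂ) - n)‖ ≤ (Δ + 1) * Δ := by
    refine (norm_sum_le _ _).trans ((Finset.sum_le_card_nsmul _ _ Δ fun n hn => ?_).trans ?_)
    · rw [Finset.mem_Ioc] at hn
      have h1 : x < n := (Nat.floor_lt hx.le).1 hn.1
      have h2 : (n : ℝ) ≤ x + Δ := (Nat.le_floor_iff (by linarith)).1 hn.2
      rw [norm_mul]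
      have h3 : ‖((x + Δ : ℝ) : ℂ) - n‖ ≤ Δ := by
        rw [show ((x + Δ : ℝ) : ℂ) - n = ((x + Δ - n : ℝ) : ℂ) by push_cast; ring,
          Complex.norm_real, Real.norm_of_nonneg (by linarith)]
        linarith
      calc _ ≤ 1 * Δ := by gcongr; exact ha n
        _ = Δ := one_mul _
    · rw [nsmul_eq_mul, Nat.card_Ioc, Nat.cast_sub hle]
      have h1 := Nat.lt_floor_add_one x
      have h2 := Nat.floor_le (show 0 ≤ x + Δ by linarith)
      gcongr
      linarith
  have hnorm := congrArg norm hsplit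
  rw [norm_mul, Complex.norm_real, Real.norm_of_nonneg hΔ.le] at hnorm
  have h5 : Δ * ‖∑ n ∈ Finset.Icc 1 ⌊x⌋₊, a n‖ ≤ (x + Δ) * B + x * A + (Δ + 1) * Δ := by
    rw [hnorm]
    refine (norm_sub_le _ _).trans (add_le_add ((norm_sub_le _ _).trans (add_le_add ?_ ?_)) hrest)
    · rw [norm_mul, Complex.norm_real, Real.norm_of_nonneg (by linarith)]
      gcongr
    · rw [norm_mul, Complex.norm_real, Real.norm_of_nonneg (by linarith)]
      gcongr
  have h6 : (x * A + (x + Δ) * B) / Δ + Δ + 1 = ((x + Δ) * B + x * A + (Δ + 1) * Δ) / Δ := by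
    field_simp; ring
  rw [h6, le_div_iff₀ hΔ]
  linarith

/-- The **prime number theorem** with the classical error term, for a real-valued completely
multiplicative function with an `L`-function: its product with the Möbius function has small
partial sums. -/
theorem IsRealLFunction.exists_norm_sum_moebius_le {ψ : ℕ → ℂ} {e : ℕ} {H : ℂ → ℂ}
    (hL : IsRealLFunction ψ e H) : ∃ c K : ℝ, 0 < c ∧ 0 < K ∧ ∀ x : ℝ, 1 ≤ x →
      ‖∑ n ∈ Finset.Icc 1 ⌊x⌋₊, (ψ * fun n => (ArithmeticFunction.moebius n : ℂ)) n‖ ≤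
        K * x * Real.exp (-(c * √(Real.log x))) := by
  obtain ⟨c, K, hc, hc1, hK, h⟩ := hL.exists_norm_sum_cesaro_le
  refine ⟨c / 2, 5 * K + 3, by positivity, by positivity, fun x hx1 => ?_⟩
  have hx0 : 0 < x := by linarith
  set a := ψ * fun n => (ArithmeticFunction.moebius n : ℂ) with ha
  have ha1 : ∀ n, ‖a n‖ ≤ 1 := hL.norm_mul_moebius_le_one
  have hlog0 : 0 ≤ Real.log x := Real.log_nonneg hx1
  set u := √(Real.log x) with hu
  have hu0 : 0 ≤ u := Real.sqrt_nonneg _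
  have hu2 : u * u = Real.log x := Real.mul_self_sqrt hlog0
  set E := Real.exp (-(c / 2 * u)) with hE
  have hE0 : 0 < E := Real.exp_pos _
  rcases le_or_gt (Real.exp 1) x with hx | hx
  · have hlog1 : 1 ≤ Real.log x := (Real.le_log_iff_exp_le hx0).2 hx
    have hu1 : 1 ≤ u := Real.one_le_sqrt.2 hlog1
    have hE1 : E ≤ 1 := Real.exp_le_one_iff.2 (by have := mul_nonneg hc.le hu0; linarith)
    have hEE : Real.exp (-(c * u)) = E * E := by rw [hE, ← Real.exp_add]; ring_nf
    have hxE : 1 ≤ x * E := by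
      have : x = Real.exp (u * u) := by rw [hu2, Real.exp_log hx0]
      rw [this, hE, ← Real.exp_add]
      exact Real.one_le_exp (by nlinarith)
    -- The increment is Δ = xE, where E² is the Cesàro saving: then x²E²/Δ and Δ are both of size
    -- xE. This halves the constant in the exponent; xE ≥ 1 absorbs the leftover 1.
    have hA := h x hx
    have hB := h (x + x * E) (by have := mul_pos hx0 hE0; linarith)
    rw [hEE] at hA
    have hB' : K * (x + x * E) * Real.exp (-(c * √(Real.log (x + x * E)))) ≤ K * (2 * x) * (E * E) := by
      rw [← hEE]
      have h1 : x + x * E ≤ 2 * x := by nlinarith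
      have h2 : u ≤ √(Real.log (x + x * E)) :=
        Real.sqrt_le_sqrt (Real.log_le_log hx0 (by have := mul_pos hx0 hE0; linarith))
      gcongr
    refine (norm_sum_le_of_cesaro ha1 hx0 (mul_pos hx0 hE0) hA (hB.trans hB')).trans ?_
    have h1 : (x * (K * x * (E * E)) + (x + x * E) * (K * (2 * x) * (E * E))) / (x * E) ≤
        5 * K * x * E := by
      rw [div_le_iff₀ (mul_pos hx0 hE0)]
      have : 0 ≤ K * (x * x) * (E * E) * (1 - E) := by
        have : 0 ≤ 1 - E := by linarith
        positivity
      nlinarith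
    nlinarith
  · refine (norm_sum_le_floor ha1 hx0.le).trans ?_
    have hu1 : u ≤ 1 := by
      rw [hu, Real.sqrt_le_one]
      exact ((Real.log_lt_iff_lt_exp hx0).2 hx).le
    have : 1 / 3 ≤ E := by
      have h1 := Real.add_one_le_exp (-(c / 2 * u))
      have h2 : c / 2 * u ≤ 1 / 2 := by nlinarith
      rw [hE]; linarith
    have h3 : 1 ≤ (5 * K + 3) * E := by nlinarith
    nlinarith

/-! ### Weighted summability of multiplicative functions supported on few primes -/

/-- A nonnegative function that is submultiplicative on coprime arguments is summable, if the sum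
of its values at the prime powers is finite. -/
lemma summable_of_submultiplicative {F : ℕ → ℝ} (h0 : ∀ n, 0 ≤ F n) (h1 : F 1 = 1)
    (hsub : ∀ m n : ℕ, 1 < m → 1 < n → m.Coprime n → F (m * n) ≤ F m * F n)
    (hpow : ∀ p : ℕ, p.Prime → Summable fun j : ℕ => F (p ^ (j + 1)))
    {S : ℕ → ℝ} (hS : Summable S) (hS0 : ∀ n, 0 ≤ S n)
    (hFS : ∀ p : ℕ, p.Prime → ∑' j : ℕ, F (p ^ (j + 1)) ≤ S p) : Summable F := by
  -- F is only submultiplicative, so the Euler product is applied to the multiplicative function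
  -- with the same values at prime powers, which majorises F.
  set G : ℕ → ℝ := fun n => n.factorization.prod fun p j => F (p ^ j) with hG
  have hG0 : ∀ n, 0 ≤ G n := fun n => Finset.prod_nonneg fun p _ => h0 _
  have hGp : ∀ p j : ℕ, p.Prime → G (p ^ j) = F (p ^ j) := by
    intro p j hp
    simp only [hG, hp.factorization_pow]
    rw [Finsupp.prod_single_index (by simpa using h1)]
  have hG1 : G 1 = 1 := by simp [hG]
  have hGmul : ∀ {m n : ℕ}, m.Coprime n → G (m * n) = G m * G n := by
    intro m n hmn
    simp only [hG]
    rw [Nat.factorization_mul_of_coprime hmn]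
    exact Finsupp.prod_add_index_of_disjoint (by
      simpa using hmn.disjoint_primeFactors) _
  have hFG : ∀ n, 1 ≤ n → F n ≤ G n := by
    intro n
    induction n using Nat.recOnPosPrimePosCoprime with
    | prime_pow p n hp hn => intro _; exact (hGp p n hp).ge
    | zero => intro h; omega
    | one => intro _; rw [h1, hG1]
    | coprime a b ha hb hab iha ihb =>
      intro _
      rw [hGmul hab]
      exact (hsub a b ha hb hab).trans (mul_le_mul (iha ha.le) (ihb hb.le) (h0 _) (hG0 _))
  have hpow' : ∀ {p : ℕ}, p.Prime → Summable fun n : ℕ => ‖G (p ^ n)‖ := by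
    intro p hp
    rw [← summable_nat_add_iff 1]
    refine (hpow p hp).congr fun j => ?_
    rw [hGp p _ hp, Real.norm_of_nonneg (h0 _)]
  rw [← summable_nat_add_iff 1]
  refine summable_of_sum_range_le (c := Real.exp (∑' p, S p)) (fun n => h0 _) fun N => ?_
  have hsm := (EulerProduct.summable_and_hasSum_smoothNumbers_prod_primesBelow_tsum hG1 hGmul
    hpow' (N + 1)).2
  have hsm' := (hasSum_subtype_iff_indicator (f := G)).1 hsm
  have hle : ∑ i ∈ Finset.range N, F (i + 1) ≤
      ∏ p ∈ (N + 1).primesBelow, ∑' n : ℕ, G (p ^ n) := by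
    calc ∑ i ∈ Finset.range N, F (i + 1)
        ≤ ∑ i ∈ Finset.range N, (Nat.smoothNumbers (N + 1)).indicator G (i + 1) := by
          refine Finset.sum_le_sum fun i hi => ?_
          rw [Finset.mem_range] at hi
          rw [Set.indicator_of_mem (Nat.mem_smoothNumbers_of_lt (by omega) (by omega))]
          exact hFG _ (by omega)
      _ = ∑ i ∈ (Finset.range N).map ⟨fun i => i + 1, add_left_injective 1⟩,
            (Nat.smoothNumbers (N + 1)).indicator G i := by simp
      _ ≤ _ := sum_le_hasSum _ (fun i _ => Set.indicator_nonneg (fun _ _ => hG0 _) i) hsm'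
  refine hle.trans ?_
  calc ∏ p ∈ (N + 1).primesBelow, ∑' n : ℕ, G (p ^ n)
      ≤ ∏ p ∈ (N + 1).primesBelow, Real.exp (S p) := by
        refine Finset.prod_le_prod (fun p _ => tsum_nonneg fun _ => hG0 _) fun p hp => ?_
        have hp' := Nat.prime_of_mem_primesBelow hp
        have hs : Summable fun n : ℕ => G (p ^ n) := (hpow' hp').of_norm
        rw [hs.tsum_eq_zero_add, pow_zero, hG1]
        simp only [hGp p _ hp']
        linarith [hFS p hp', Real.add_one_le_exp (S p)]
    _ = Real.exp (∑ p ∈ (N + 1).primesBelow, S p) := (Real.exp_sum _ _).symm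
    _ ≤ _ := Real.exp_le_exp.2 (hS.sum_le_tsum _ fun p _ => hS0 p)

/-- The term of degree 4 = 2 · 2 in the exponential series, with 24 = 4!, already compares with ∑
1/i². -/
lemma summable_exp_neg_mul_sqrt {δ : ℝ} (hδ : 0 < δ) :
    Summable fun i : ℕ => Real.exp (-(δ * √((i : ℝ) + 1))) := by
  have h1 : Summable fun i : ℕ => 24 / δ ^ 4 * (1 / ((i + 1 : ℕ) : ℝ) ^ 2) :=
    ((summable_nat_add_iff 1).2 (Real.summable_one_div_nat_pow.2 one_lt_two)).mul_left _
  refine h1.of_nonneg_of_le (fun i => (Real.exp_pos _).le) fun i => ?_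
  have hi : (0:ℝ) < (i : ℝ) + 1 := by positivity
  have h2 := Real.pow_div_factorial_le_exp (x := δ * √((i : ℝ) + 1)) (by positivity) 4
  have h3 : (δ * √((i : ℝ) + 1)) ^ 4 = δ ^ 4 * ((i : ℝ) + 1) ^ 2 := by
    rw [mul_pow, show (4 : ℕ) = 2 * 2 from rfl, pow_mul (√((i : ℝ) + 1)), Real.sq_sqrt hi.le]
  rw [h3] at h2
  rw [Real.exp_neg, inv_le_comm₀ (Real.exp_pos _) (by positivity)]
  refine le_trans (le_of_eq ?_) h2
  simp [Nat.factorial]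
  field_simp

/-- If a set `s` of positive integers has at most `O(x ^ α exp (-c √log x))` elements up to `x`,
then the series of `n ^ (-α) exp (c' √log n)` over `s` converges for `c' < c`. -/
lemma summable_indicator_of_card_le {s : Set ℕ} (hs : ∀ n ∈ s, 1 ≤ n) {α c c' C : ℝ} (hα : 0 < α)
    (hc' : 0 ≤ c') (hcc : c' < c)
    (hcard : ∀ t : Finset ℕ, ↑t ⊆ s → ∀ x : ℝ, 1 ≤ x → (∀ n ∈ t, (n : ℝ) ≤ x) →
      (t.card : ℝ) ≤ C * x ^ α * Real.exp (-(c * √(Real.log x)))) :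
    Summable (s.indicator fun n : ℕ => (n : ℝ) ^ (-α) * Real.exp (c' * √(Real.log n))) := by
  classical
  set G : ℕ → ℝ := fun n => (n : ℝ) ^ (-α) * Real.exp (c' * √(Real.log n)) with hG
  have hG0 : ∀ n, 0 ≤ G n := fun n => by positivity
  have hl2 : 0 < Real.log 2 := Real.log_pos one_lt_two
  set δ := (c - c') * √(Real.log 2) with hδ
  have hδ0 : 0 < δ := mul_pos (by linarith) (Real.sqrt_pos.2 hl2)
  have hC0 : 0 ≤ C := by
    have := hcard ∅ (by simp) 1 le_rfl (by simp)
    simpa using this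
  set V : ℕ → ℝ := fun i => C * 2 ^ α * Real.exp (-(δ * √((i : ℝ) + 1))) with hV
  have hVs : Summable V := (summable_exp_neg_mul_sqrt hδ0).mul_left _
  refine summable_of_sum_le (c := ∑' i, V i) (fun n => Set.indicator_nonneg (fun _ _ => hG0 _) n)
    fun u => ?_
  set t := u.filter (· ∈ s) with ht
  have h1 : ∑ n ∈ u, s.indicator G n = ∑ n ∈ t, G n := by
    rw [ht, Finset.sum_filter]
    rfl
  -- Dyadic blocks 2^i ≤ n < 2^(i+1): the powers 2^(iα) cancel, and each block contributes at most a
  -- constant times exp(-(c - c') √((i + 1) log 2)).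
  rw [h1, ← Finset.sum_fiberwise_of_maps_to (s := t) (t := t.image (Nat.log 2)) (g := Nat.log 2)
    (fun n hn => Finset.mem_image_of_mem _ hn)]
  refine (Finset.sum_le_sum fun i _ => ?_).trans (hVs.sum_le_tsum _ fun i _ => by
    simp only [hV]; positivity)
  set ti := t.filter (fun n => Nat.log 2 n = i) with hti
  have hmem : ∀ n ∈ ti, n ∈ s ∧ (2:ℝ) ^ i ≤ n ∧ (n : ℝ) ≤ 2 ^ (i + 1) := by
    intro n hn
    rw [hti, Finset.mem_filter, ht, Finset.mem_filter] at hn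
    have hn1 := hs n hn.1.2
    have h2 := Nat.pow_log_le_self 2 (show n ≠ 0 by omega)
    have h3 := Nat.lt_pow_succ_log_self (one_lt_two) n
    rw [hn.2] at h2 h3
    exact ⟨hn.1.2, by exact_mod_cast h2, by exact_mod_cast h3.le⟩
  have hcd := hcard ti (fun n hn => (hmem n hn).1) (2 ^ (i + 1))
    (one_le_pow₀ one_le_two) (fun n hn => (hmem n hn).2.2)
  have hGle : ∀ n ∈ ti, G n ≤ ((2:ℝ) ^ i) ^ (-α) * Real.exp (c' * √(Real.log (2 ^ (i + 1)))) := by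
    intro n hn
    obtain ⟨-, h2, h3⟩ := hmem n hn
    have hpos : (0:ℝ) < 2 ^ i := by positivity
    have h4 : (n : ℝ) ^ (-α) ≤ ((2:ℝ) ^ i) ^ (-α) :=
      Real.rpow_le_rpow_of_nonpos hpos h2 (by linarith)
    have h5 : Real.log n ≤ Real.log (2 ^ (i + 1)) := Real.log_le_log (by linarith) h3
    simp only [hG]
    gcongr
  have hsqrt : √(Real.log ((2:ℝ) ^ (i + 1))) = √(Real.log 2) * √((i : ℝ) + 1) := by
    rw [Real.log_pow, mul_comm, Real.sqrt_mul hl2.le]; push_cast; rfl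
  calc ∑ n ∈ ti, G n
      ≤ ti.card • (((2:ℝ) ^ i) ^ (-α) * Real.exp (c' * √(Real.log (2 ^ (i + 1))))) :=
        Finset.sum_le_card_nsmul _ _ _ hGle
    _ ≤ (C * ((2:ℝ) ^ (i + 1)) ^ α * Real.exp (-(c * √(Real.log (2 ^ (i + 1)))))) *
          (((2:ℝ) ^ i) ^ (-α) * Real.exp (c' * √(Real.log (2 ^ (i + 1))))) := by
        rw [nsmul_eq_mul]; gcongr
    _ = C * (((2:ℝ) ^ (i + 1)) ^ α * ((2:ℝ) ^ i) ^ (-α)) *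
          (Real.exp (-(c * √(Real.log (2 ^ (i + 1))))) *
            Real.exp (c' * √(Real.log (2 ^ (i + 1))))) := by ring
    _ = V i := by
        simp only [hV]
        congr 2
        · rw [pow_succ, Real.mul_rpow (by positivity) (by positivity), Real.rpow_neg (by positivity)]
          field_simp
        · rw [← Real.exp_add, hsqrt, hδ]; ring_nf

/-- This makes exp(c √log n) submultiplicative on positive integers, the property on which all the
weighted convolutions rely. -/
lemma sqrt_add_le {a b : ℝ} (ha : 0 ≤ a) (hb : 0 ≤ b) : √(a + b) ≤ √a + √b := by
  rw [Real.sqrt_le_left (by positivity)]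
  have h1 := Real.sq_sqrt ha
  have h2 := Real.sq_sqrt hb
  nlinarith [mul_nonneg (Real.sqrt_nonneg a) (Real.sqrt_nonneg b)]

/-- Summability with the weight `n ^ (-α) exp (c √log n)` of a multiplicative function that is
bounded on the powers of the primes in `s` and vanishes at the powers of other primes. -/
lemma summable_isMultiplicative_mul_weight {f : ArithmeticFunction ℝ} (hf : f.IsMultiplicative)
    {s : Set ℕ} {M α c : ℝ} (hα : 0 < α) (hc : 0 ≤ c) (hM : 0 ≤ M)
    (hbd : ∀ p j : ℕ, p.Prime → |f (p ^ (j + 1))| ≤ M)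
    (hvan : ∀ p j : ℕ, p.Prime → p ∉ s → f (p ^ (j + 1)) = 0)
    (hs : Summable (s.indicator fun n : ℕ => (n : ℝ) ^ (-α) * Real.exp (c * √(Real.log n)))) :
    Summable fun n : ℕ => |f n| * ((n : ℝ) ^ (-α) * Real.exp (c * √(Real.log n))) := by
  classical
  set G : ℕ → ℝ := fun n => (n : ℝ) ^ (-α) * Real.exp (c * √(Real.log n)) with hG
  have hG0 : ∀ n, 0 ≤ G n := fun n => by positivity
  have hGmul : ∀ m n : ℕ, 1 ≤ m → 1 ≤ n → G (m * n) ≤ G m * G n := by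
    intro m n hm hn
    have hm' : (1:ℝ) ≤ m := by exact_mod_cast hm
    have hn' : (1:ℝ) ≤ n := by exact_mod_cast hn
    simp only [hG]
    push_cast
    rw [Real.mul_rpow (by positivity) (by positivity),
      Real.log_mul (by positivity) (by positivity)]
    have h1 := sqrt_add_le (Real.log_nonneg hm') (Real.log_nonneg hn')
    have h2 : Real.exp (c * √(Real.log m + Real.log n)) ≤
        Real.exp (c * √(Real.log m)) * Real.exp (c * √(Real.log n)) := by
      rw [← Real.exp_add, Real.exp_le_exp, ← mul_add]
      gcongr
    calc _ ≤ (m : ℝ) ^ (-α) * (n : ℝ) ^ (-α) *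
          (Real.exp (c * √(Real.log m)) * Real.exp (c * √(Real.log n))) := by gcongr
      _ = _ := by ring
  -- Half of the decay p^(-jα) absorbs exp(c √log p^j), since c √y ≤ c²/(2α) + αy/2; the other half
  -- leaves a geometric series with ratio at most 2^(-α/2).
  set r : ℝ := (2:ℝ) ^ (-(α / 2)) with hr
  have hr0 : 0 < r := by positivity
  have hr1 : r < 1 := Real.rpow_lt_one_of_one_lt_of_neg one_lt_two (by linarith)
  set A := Real.exp (c ^ 2 / (2 * α)) with hA
  have hGpow : ∀ p j : ℕ, p.Prime → G (p ^ j) ≤ A * r ^ j := by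
    intro p j hp
    have hp2 : (2:ℝ) ≤ p := by exact_mod_cast hp.two_le
    have hlog : 0 ≤ Real.log ((p : ℝ) ^ j) := Real.log_nonneg (one_le_pow₀ (by linarith))
    set y := Real.log ((p : ℝ) ^ j) with hy
    have h1 : c * √y ≤ c ^ 2 / (2 * α) + α / 2 * y := by
      have h2 := Real.sq_sqrt hlog
      have h3 : c ^ 2 / (2 * α) + α / 2 * y - c * √y = (c - α * √y) ^ 2 / (2 * α) := by
        field_simp
        rw [← h2, Real.sqrt_sq (Real.sqrt_nonneg _)]
        ring
      have : 0 ≤ (c - α * √y) ^ 2 / (2 * α) := by positivity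
      linarith
    have hppos : (0:ℝ) < (p : ℝ) ^ j := by positivity
    simp only [hG]
    push_cast
    calc ((p : ℝ) ^ j) ^ (-α) * Real.exp (c * √y)
        ≤ ((p : ℝ) ^ j) ^ (-α) * Real.exp (c ^ 2 / (2 * α) + α / 2 * y) := by gcongr
      _ = A * (((p : ℝ) ^ j) ^ (-α) * ((p : ℝ) ^ j) ^ (α / 2)) := by
          rw [Real.exp_add, ← hA, Real.rpow_def_of_pos hppos (α / 2), ← hy, mul_comm y]; ring
      _ = A * ((p : ℝ) ^ (-(α / 2))) ^ j := by
          rw [← Real.rpow_add hppos, ← Real.rpow_natCast, ← Real.rpow_mul (by positivity),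
            ← Real.rpow_natCast, ← Real.rpow_mul (by positivity)]
          ring_nf
      _ ≤ A * r ^ j := by
          gcongr
          exact Real.rpow_le_rpow_of_nonpos two_pos hp2 (by linarith)
  have hgeo : Summable fun j : ℕ => r ^ j := summable_geometric_of_lt_one hr0.le hr1
  -- Splitting one factor p off p^(j+1) bounds the sum over j by a constant times G(p), which is
  -- summable over the exceptional primes.
  have hterm : ∀ p j : ℕ, p.Prime → |f (p ^ (j + 1))| * G (p ^ (j + 1)) ≤
      M * s.indicator G p * A * r ^ j := by
    intro p j hp
    by_cases hps : p ∈ s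
    · rw [Set.indicator_of_mem hps]
      calc _ ≤ M * (G p * G (p ^ j)) := by
            refine mul_le_mul (hbd p j hp) ?_ (hG0 _) hM
            rw [pow_succ']
            exact hGmul _ _ hp.one_le (Nat.one_le_pow _ _ hp.pos)
        _ ≤ M * (G p * (A * r ^ j)) := by
            have := hG0 p
            gcongr; exact hGpow p j hp
        _ = _ := by ring
    · rw [hvan p j hp hps, Set.indicator_of_notMem hps]; simp
  refine summable_of_submultiplicative (S := fun p => M * A * (1 - r)⁻¹ * s.indicator G p)
    (fun n => mul_nonneg (abs_nonneg _) (hG0 n)) ?_ ?_ ?_ (hs.mul_left _) ?_ ?_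
  · simp [hf.map_one]
  · intro m n hm hn hmn
    rw [hf.map_mul_of_coprime hmn, abs_mul]
    calc _ ≤ |f m| * |f n| * (G m * G n) :=
          mul_le_mul_of_nonneg_left (hGmul m n hm.le hn.le) (by positivity)
      _ = _ := by ring
  · intro p hp
    exact (hgeo.mul_left (M * s.indicator G p * A)).of_nonneg_of_le
      (fun j => mul_nonneg (abs_nonneg _) (hG0 _)) fun j => hterm p j hp
  · intro n
    have : 0 ≤ s.indicator G n := Set.indicator_nonneg (fun _ _ => hG0 _) n
    have : 0 < 1 - r := by linarith
    positivity
  · intro p hp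
    have hsum := hgeo.mul_left (M * s.indicator G p * A)
    calc _ ≤ ∑' j : ℕ, M * s.indicator G p * A * r ^ j :=
          Summable.tsum_le_tsum (fun j => hterm p j hp) (hsum.of_nonneg_of_le
            (fun j => mul_nonneg (abs_nonneg _) (hG0 _)) fun j => hterm p j hp) hsum
      _ = _ := by
          rw [tsum_mul_left, tsum_geometric_of_lt_one hr0.le hr1]; ring

/-! ### Convolution estimates and the hyperbola method -/

/-- Dirichlet convolution with a function that is absolutely summable with the appropriate weight
preserves bounds of the shape `x ^ α exp (-c √log x)` for partial sums. -/
lemma abs_sum_mul_le {h b : ArithmeticFunction ℝ} {α c K : ℝ} (hc : 0 ≤ c) (hK : 0 ≤ K)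
    (hb : ∀ y : ℝ, 1 ≤ y → |∑ n ∈ Finset.Ioc 0 ⌊y⌋₊, b n| ≤
      K * y ^ α * Real.exp (-(c * √(Real.log y))))
    (hh : Summable fun n : ℕ => |h n| * ((n : ℝ) ^ (-α) * Real.exp (c * √(Real.log n))))
    {x : ℝ} (hx : 1 ≤ x) :
    |∑ n ∈ Finset.Ioc 0 ⌊x⌋₊, (h * b) n| ≤
      (K * ∑' n : ℕ, |h n| * ((n : ℝ) ^ (-α) * Real.exp (c * √(Real.log n)))) * x ^ α *
        Real.exp (-(c * √(Real.log x))) := by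
  have hx0 : 0 < x := by linarith
  set w : ℕ → ℝ := fun n => |h n| * ((n : ℝ) ^ (-α) * Real.exp (c * √(Real.log n))) with hw
  rw [ArithmeticFunction.sum_Ioc_mul_eq_sum_sum]
  have hterm : ∀ n ∈ Finset.Ioc 0 ⌊x⌋₊, |h n * ∑ m ∈ Finset.Ioc 0 (⌊x⌋₊ / n), b m| ≤
      K * x ^ α * Real.exp (-(c * √(Real.log x))) * w n := by
    intro n hn
    rw [Finset.mem_Ioc] at hn
    have hn1 : (1:ℝ) ≤ n := by exact_mod_cast hn.1
    have hnx : (n : ℝ) ≤ x := (Nat.le_floor_iff hx0.le).1 hn.2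
    have hxn : 1 ≤ x / n := (one_le_div (by linarith)).2 hnx
    rw [abs_mul, ← Nat.floor_div_natCast]
    -- The saving at x/n is worse than that at x by at most exp(c √log n), exactly the weight in the
    -- summability hypothesis.
    have hsq : √(Real.log x) ≤ √(Real.log (x / n)) + √(Real.log n) := by
      have := sqrt_add_le (Real.log_nonneg hxn) (Real.log_nonneg hn1)
      rwa [← Real.log_mul (by positivity) (by positivity), div_mul_cancel₀ _ (by positivity)] at this
    have hexp : Real.exp (-(c * √(Real.log (x / n)))) ≤
        Real.exp (-(c * √(Real.log x))) * Real.exp (c * √(Real.log n)) := by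
      rw [← Real.exp_add, Real.exp_le_exp]
      nlinarith
    calc |h n| * |∑ m ∈ Finset.Ioc 0 ⌊x / n⌋₊, b m|
        ≤ |h n| * (K * (x / n) ^ α * Real.exp (-(c * √(Real.log (x / n))))) := by
          gcongr; exact hb _ hxn
      _ ≤ |h n| * (K * (x / n) ^ α *
            (Real.exp (-(c * √(Real.log x))) * Real.exp (c * √(Real.log n)))) := by gcongr
      _ = _ := by
          rw [Real.div_rpow hx0.le (by linarith)]
          simp only [hw]
          rw [Real.rpow_neg (by linarith)]
          ring
  refine (Finset.abs_sum_le_sum_abs _ _).trans ((Finset.sum_le_sum hterm).trans ?_)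
  rw [← Finset.mul_sum]
  have hw0 : ∀ n, 0 ≤ w n := fun n => by positivity
  calc _ ≤ K * x ^ α * Real.exp (-(c * √(Real.log x))) * ∑' n, w n := by
        gcongr; exact hh.sum_le_tsum _ fun n _ => hw0 n
    _ = _ := by ring

/-- The arithmetic function supported on the `k`-th powers with value `a d` at `d ^ k`. -/
noncomputable def powSupported (k : ℕ) (a : ℕ → ℝ) : ArithmeticFunction ℝ :=
  ⟨fun n => ∑ d ∈ n.divisors with d ^ k = n, a d, by simp⟩

lemma powSupported_apply (k : ℕ) (a : ℕ → ℝ) (n : ℕ) :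
    powSupported k a n = ∑ d ∈ n.divisors with d ^ k = n, a d := rfl

lemma sum_powSupported_mul {k : ℕ} (hk : k ≠ 0) (a W : ℕ → ℝ) (N : ℕ) :
    ∑ n ∈ Finset.Ioc 0 N, powSupported k a n * W n =
      ∑ d ∈ Finset.Ioc 0 N, if d ^ k ≤ N then a d * W (d ^ k) else 0 := by
  have h1 : ∀ n ∈ Finset.Ioc 0 N, powSupported k a n * W n =
      ∑ d ∈ Finset.Ioc 0 N, if d ^ k = n then a d * W n else 0 := by
    intro n hn
    rw [Finset.mem_Ioc] at hn
    rw [powSupported_apply, Finset.sum_mul, ← Finset.sum_filter]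
    refine Finset.sum_congr ?_ fun _ _ => rfl
    ext d
    simp only [Finset.mem_filter, Nat.mem_divisors, Finset.mem_Ioc]
    constructor
    · rintro ⟨⟨h1, h2⟩, h3⟩
      exact ⟨⟨Nat.pos_of_dvd_of_pos h1 hn.1, (Nat.le_of_dvd hn.1 h1).trans hn.2⟩, h3⟩
    · rintro ⟨-, h3⟩
      exact ⟨⟨h3 ▸ dvd_pow_self d hk, by omega⟩, h3⟩
  rw [Finset.sum_congr rfl h1, Finset.sum_comm]
  refine Finset.sum_congr rfl fun d hd => ?_
  rw [Finset.mem_Ioc] at hd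
  rw [Finset.sum_ite_eq]
  have : d ^ k ∈ Finset.Ioc 0 N ↔ d ^ k ≤ N := by
    rw [Finset.mem_Ioc]; exact ⟨fun h => h.2, fun h => ⟨pow_pos hd.1 k, h⟩⟩
  simp only [this]

/-- The hyperbola method for a function with small partial sums at `k`-th powers, convolved with a
function with bounded partial sums. -/
lemma abs_sum_powSupported_mul_le {k : ℕ} (hk : k ≠ 0) {a : ℕ → ℝ} {X : ArithmeticFunction ℝ}
    {Q K c : ℝ} (hc : 0 ≤ c) (hK : 0 ≤ K) (ha : ∀ n, |a n| ≤ 1) (hX : ∀ n, |X n| ≤ 1)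
    (hXs : ∀ n : ℕ, |∑ m ∈ Finset.Ioc 0 n, X m| ≤ Q)
    (has : ∀ z : ℝ, 1 ≤ z → |∑ d ∈ Finset.Ioc 0 ⌊z⌋₊, a d| ≤
      K * z * Real.exp (-(c * √(Real.log z))))
    {y D : ℝ} (hy : 1 ≤ y) (hD : 1 ≤ D) :
    |∑ n ∈ Finset.Ioc 0 ⌊y⌋₊, (powSupported k a * X) n| ≤
      Q * D + y / D ^ k * (2 * K * y ^ (k : ℝ)⁻¹ * Real.exp (-(c * √(Real.log D)))) := by
  classical
  have hy0 : 0 < y := by linarith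
  have hD0 : 0 < D := by linarith
  have hQ : 0 ≤ Q := (abs_nonneg _).trans (hXs 0)
  have hk0 : (0:ℝ) < k := by exact_mod_cast Nat.pos_of_ne_zero hk
  set N := ⌊y⌋₊ with hN
  rw [ArithmeticFunction.sum_Ioc_mul_eq_sum_sum, sum_powSupported_mul hk,
    ← Finset.sum_filter_add_sum_filter_not _ (fun d : ℕ => (d : ℝ) ≤ D)]
  refine (abs_add_le _ _).trans (add_le_add ?_ ?_)
  · calc |∑ d ∈ (Finset.Ioc 0 N).filter (fun d : ℕ => (d : ℝ) ≤ D),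
            if d ^ k ≤ N then a d * ∑ m ∈ Finset.Ioc 0 (N / d ^ k), X m else 0|
        ≤ ∑ d ∈ (Finset.Ioc 0 N).filter (fun d : ℕ => (d : ℝ) ≤ D), Q := by
          refine (Finset.abs_sum_le_sum_abs _ _).trans (Finset.sum_le_sum fun d _ => ?_)
          split_ifs
          · rw [abs_mul]
            calc _ ≤ 1 * Q := mul_le_mul (ha d) (hXs _) (abs_nonneg _) zero_le_one
              _ = Q := one_mul Q
          · simpa using hQ
      _ ≤ ∑ d ∈ Finset.Ioc 0 ⌊D⌋₊, Q := by
          refine Finset.sum_le_sum_of_subset_of_nonneg (fun d hd => ?_) fun _ _ _ => hQ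
          simp only [Finset.mem_filter, Finset.mem_Ioc] at hd ⊢
          exact ⟨hd.1.1, Nat.le_floor hd.2⟩
      _ ≤ Q * D := by
          rw [Finset.sum_const, nsmul_eq_mul, Nat.card_Ioc, mul_comm]
          gcongr
          simpa using Nat.floor_le hD0.le
  · set R := 2 * K * y ^ (k : ℝ)⁻¹ * Real.exp (-(c * √(Real.log D))) with hR
    have hR0 : 0 ≤ R := by positivity
    -- For d > D the roles are exchanged: m is fixed and a is summed over D < d ≤ (y/m)^(1/k), an
    -- interval that is nonempty only if m ≤ y/D^k. The factor 2 in R comes from its two endpoints.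
    have hswap : (∑ d ∈ (Finset.Ioc 0 N).filter (fun d : ℕ => ¬ (d : ℝ) ≤ D),
        if d ^ k ≤ N then a d * ∑ m ∈ Finset.Ioc 0 (N / d ^ k), X m else 0) =
        ∑ m ∈ Finset.Ioc 0 N, X m *
          ∑ d ∈ (Finset.Ioc 0 N).filter
            (fun d : ℕ => ¬ (d : ℝ) ≤ D ∧ m * d ^ k ≤ N), a d := by
      have h1 : ∀ d ∈ Finset.Ioc 0 N, (if d ^ k ≤ N then
          a d * ∑ m ∈ Finset.Ioc 0 (N / d ^ k), X m else 0) =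
          ∑ m ∈ Finset.Ioc 0 N, if m * d ^ k ≤ N then X m * a d else 0 := by
        intro d hd
        rw [Finset.mem_Ioc] at hd
        have hpos : 0 < d ^ k := pow_pos hd.1 k
        have h2 : Finset.Ioc 0 (N / d ^ k) = {m ∈ Finset.Ioc 0 N | m * d ^ k ≤ N} := by
          ext m
          simp only [Finset.mem_Ioc, Finset.mem_filter, Nat.le_div_iff_mul_le hpos]
          constructor
          · rintro ⟨h1, h2⟩
            exact ⟨⟨h1, (Nat.le_mul_of_pos_right m hpos).trans h2⟩, h2⟩
          · rintro ⟨⟨h1, -⟩, h2⟩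
            exact ⟨h1, h2⟩
        split_ifs with h
        · rw [h2, Finset.mul_sum, Finset.sum_filter]
          refine Finset.sum_congr rfl fun m _ => ?_
          split_ifs <;> ring
        · refine (Finset.sum_eq_zero fun m hm => ?_).symm
          rw [Finset.mem_Ioc] at hm
          rw [if_neg]
          intro h3
          exact h ((Nat.le_mul_of_pos_left _ hm.1).trans h3)
      rw [Finset.sum_congr rfl fun d hd => h1 d (Finset.mem_filter.1 hd).1, Finset.sum_comm]
      refine Finset.sum_congr rfl fun m _ => ?_
      rw [← Finset.filter_filter, Finset.sum_filter, Finset.mul_sum, Finset.sum_filter]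
      rw [Finset.sum_filter]
    rw [hswap]
    have hinner : ∀ m ∈ Finset.Ioc 0 N,
        |X m * ∑ d ∈ (Finset.Ioc 0 N).filter
            (fun d : ℕ => ¬ (d : ℝ) ≤ D ∧ m * d ^ k ≤ N), a d| ≤
          if (m : ℝ) ≤ y / D ^ k then R else 0 := by
      intro m hm
      rw [Finset.mem_Ioc] at hm
      have hm1 : (1:ℝ) ≤ m := by exact_mod_cast hm.1
      have hym : 0 < y / m := by positivity
      set z := (y / m) ^ (k : ℝ)⁻¹ with hz
      have hz0 : 0 < z := by positivity
      have hzy : z ≤ y ^ (k : ℝ)⁻¹ := by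
        rw [hz]; gcongr; exact div_le_self hy0.le hm1
      have hset : (Finset.Ioc 0 N).filter (fun d : ℕ => ¬ (d : ℝ) ≤ D ∧ m * d ^ k ≤ N) =
          Finset.Ioc ⌊D⌋₊ ⌊z⌋₊ := by
        ext d
        have hd1 : m * d ^ k ≤ N ↔ d ≤ ⌊z⌋₊ := by
          rw [hN, Nat.le_floor_iff hy0.le, Nat.le_floor_iff hz0.le, hz,
            Real.le_rpow_inv_iff_of_pos (by positivity) hym.le hk0, Real.rpow_natCast,
            le_div_iff₀ (by linarith)]
          push_cast
          rw [mul_comm]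
        simp only [Finset.mem_filter, Finset.mem_Ioc, not_le, ← Nat.floor_lt hD0.le, hd1]
        constructor
        · rintro ⟨-, h1, h2⟩; exact ⟨h1, h2⟩
        · rintro ⟨h1, h2⟩
          have h3 := hd1.2 h2
          have h4 : 0 < d := by omega
          refine ⟨⟨h4, ?_⟩, h1, h2⟩
          calc d ≤ d ^ k := Nat.le_self_pow hk d
            _ ≤ m * d ^ k := Nat.le_mul_of_pos_left _ hm.1
            _ ≤ N := h3
      rw [hset, abs_mul]
      rcases le_or_gt D z with hDz | hDz
      · have hmy : (m : ℝ) ≤ y / D ^ k := by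
          rw [hz, Real.le_rpow_inv_iff_of_pos hD0.le hym.le hk0, Real.rpow_natCast,
            le_div_iff₀ (by linarith)] at hDz
          rw [le_div_iff₀ (by positivity)]
          linarith
        rw [if_pos hmy]
        have hsplit : ∑ d ∈ Finset.Ioc ⌊D⌋₊ ⌊z⌋₊, a d =
            ∑ d ∈ Finset.Ioc 0 ⌊z⌋₊, a d - ∑ d ∈ Finset.Ioc 0 ⌊D⌋₊, a d := by
          rw [← Finset.sum_Ioc_consecutive _ (Nat.zero_le _) (Nat.floor_le_floor hDz)]; ring
        have hz1 : 1 ≤ z := hD.trans hDz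
        have hsub : |∑ d ∈ Finset.Ioc 0 ⌊z⌋₊, a d - ∑ d ∈ Finset.Ioc 0 ⌊D⌋₊, a d| ≤
            |∑ d ∈ Finset.Ioc 0 ⌊z⌋₊, a d| + |∑ d ∈ Finset.Ioc 0 ⌊D⌋₊, a d| := by
          simp only [← Real.norm_eq_abs]; exact norm_sub_le _ _
        have hexp : Real.exp (-(c * √(Real.log z))) ≤ Real.exp (-(c * √(Real.log D))) := by
          have := Real.sqrt_le_sqrt (Real.log_le_log hD0 hDz)
          gcongr
        calc |X m| * |∑ d ∈ Finset.Ioc ⌊D⌋₊ ⌊z⌋₊, a d|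
            ≤ 1 * (K * z * Real.exp (-(c * √(Real.log z))) +
                K * D * Real.exp (-(c * √(Real.log D)))) := by
              rw [hsplit]
              exact mul_le_mul (hX m) (hsub.trans (add_le_add (has z hz1) (has D hD)))
                (abs_nonneg _) zero_le_one
          _ ≤ 1 * (K * y ^ (k : ℝ)⁻¹ * Real.exp (-(c * √(Real.log D))) +
                K * y ^ (k : ℝ)⁻¹ * Real.exp (-(c * √(Real.log D)))) := by
              have := hDz.trans hzy
              gcongr
          _ = R := by rw [hR]; ring
      · rw [Finset.Ioc_eq_empty (by
          have := Nat.floor_le_floor hDz.le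
          omega)]
        simp only [Finset.sum_empty, abs_zero, mul_zero]
        split_ifs
        · exact hR0
        · exact le_rfl
    refine (Finset.abs_sum_le_sum_abs _ _).trans ((Finset.sum_le_sum hinner).trans ?_)
    rw [← Finset.sum_filter, Finset.sum_const, nsmul_eq_mul]
    have hcard : (((Finset.Ioc 0 N).filter fun m : ℕ => (m : ℝ) ≤ y / D ^ k).card : ℝ) ≤
        y / D ^ k := by
      have hsub : (Finset.Ioc 0 N).filter (fun m : ℕ => (m : ℝ) ≤ y / D ^ k) ⊆
          Finset.Ioc 0 ⌊y / D ^ k⌋₊ := by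
        intro m hm
        simp only [Finset.mem_filter, Finset.mem_Ioc] at hm ⊢
        exact ⟨hm.1.1, Nat.le_floor hm.2⟩
      have h1 := Finset.card_le_card hsub
      rw [Nat.card_Ioc, Nat.sub_zero] at h1
      exact (Nat.cast_le.2 h1).trans (Nat.floor_le (by positivity))
    gcongr

/-- The hyperbola method with an optimised parameter. -/
lemma exists_abs_sum_powSupported_mul_le {k : ℕ} (hk : k ≠ 0) {a : ℕ → ℝ}
    {X : ArithmeticFunction ℝ} {Q K c : ℝ} (hc : 0 < c) (hK : 0 ≤ K) (ha : ∀ n, |a n| ≤ 1)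
    (hX : ∀ n, |X n| ≤ 1) (hXs : ∀ n : ℕ, |∑ m ∈ Finset.Ioc 0 n, X m| ≤ Q)
    (has : ∀ z : ℝ, 1 ≤ z → |∑ d ∈ Finset.Ioc 0 ⌊z⌋₊, a d| ≤
      K * z * Real.exp (-(c * √(Real.log z)))) :
    ∃ ε K' : ℝ, 0 < ε ∧ 0 ≤ K' ∧ ∀ y : ℝ, 1 ≤ y →
      |∑ n ∈ Finset.Ioc 0 ⌊y⌋₊, (powSupported k a * X) n| ≤
        K' * y ^ (k : ℝ)⁻¹ * Real.exp (-(ε * √(Real.log y))) := by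
  have hk1 : (1:ℝ) ≤ k := by exact_mod_cast Nat.pos_of_ne_zero hk
  have hk0 : (0:ℝ) < k := by linarith
  have hQ : 0 ≤ Q := (abs_nonneg _).trans (hXs 0)
  set β := (k : ℝ)⁻¹ with hβ
  have hβ0 : 0 < β := by positivity
  have hkβ : k * β = 1 := mul_inv_cancel₀ hk0.ne'
  set s := √(β / 2) with hs
  have hs0 : 0 < s := Real.sqrt_pos.2 (by positivity)
  -- With D = y^β exp(-εu) one has log D ≥ (β/2) log y, so the sums of a save exp(-csu), while y/D^k
  -- = exp(kεu). Taking kε = cs/2 leaves exp(-kεu) ≤ exp(-εu).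
  set ε := c * s / (2 * k) with hε
  have hε0 : 0 < ε := by positivity
  have hkε : k * ε = c * s / 2 := by rw [hε]; field_simp
  refine ⟨ε, (Q + 2 * K) * Real.exp (2 * ε ^ 2 / β), hε0, by positivity, fun y hy => ?_⟩
  have hy0 : 0 < y := by linarith
  have hlog : 0 ≤ Real.log y := Real.log_nonneg hy
  set u := √(Real.log y) with hu
  have hu0 : 0 ≤ u := Real.sqrt_nonneg _
  have hu2 : Real.log y = u * u := (Real.mul_self_sqrt hlog).symm
  have hyu : y = Real.exp (u * u) := by rw [← hu2, Real.exp_log hy0]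
  have hyβ : y ^ β = Real.exp (β * (u * u)) := by
    rw [Real.rpow_def_of_pos hy0, hu2, mul_comm]
  have hE1 : 1 ≤ Real.exp (2 * ε ^ 2 / β) := Real.one_le_exp (by positivity)
  have hE0 : 0 < Real.exp (2 * ε ^ 2 / β) := Real.exp_pos _
  rcases le_or_gt (2 * ε / β) u with hcase | hcase
  · rw [div_le_iff₀ hβ0] at hcase
    set D := Real.exp (β * (u * u) - ε * u) with hD
    have hlogD : β / 2 * (u * u) ≤ β * (u * u) - ε * u := by nlinarith
    have hD1 : 1 ≤ D := Real.one_le_exp (le_trans (by positivity) hlogD)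
    have hDk : y / D ^ k = Real.exp (k * ε * u) := by
      rw [hD, ← Real.exp_nat_mul, hyu, ← Real.exp_sub]
      congr 1
      linear_combination (- (u * u)) * hkβ
    have hsq : s * u ≤ √(Real.log D) := by
      rw [hD, Real.log_exp]
      refine le_trans (le_of_eq ?_) (Real.sqrt_le_sqrt hlogD)
      rw [Real.sqrt_mul (by positivity), Real.sqrt_mul_self hu0]
    have hexp : Real.exp (-(c * √(Real.log D))) ≤ Real.exp (-(c * (s * u))) := by gcongr
    have hDε : D = y ^ β * Real.exp (-(ε * u)) := by
      rw [hD, hyβ, ← Real.exp_add]; ring_nf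
    have h2 : Real.exp (k * ε * u) * Real.exp (-(c * (s * u))) ≤ Real.exp (-(ε * u)) := by
      rw [← Real.exp_add, Real.exp_le_exp]
      have : c * (s * u) = 2 * (k * ε) * u := by rw [hkε]; ring
      rw [this]
      have : ε * u ≤ k * ε * u := by
        gcongr; nlinarith
      linarith
    refine (abs_sum_powSupported_mul_le hk hc.le hK ha hX hXs has hy hD1).trans ?_
    rw [hDk]
    calc Q * D + Real.exp (k * ε * u) * (2 * K * y ^ β * Real.exp (-(c * √(Real.log D))))
        ≤ Q * D + Real.exp (k * ε * u) * (2 * K * y ^ β * Real.exp (-(c * (s * u)))) := by gcongr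
      _ = Q * D + 2 * K * y ^ β * (Real.exp (k * ε * u) * Real.exp (-(c * (s * u)))) := by ring
      _ ≤ Q * D + 2 * K * y ^ β * Real.exp (-(ε * u)) := by gcongr
      _ = (Q + 2 * K) * 1 * y ^ β * Real.exp (-(ε * u)) := by rw [hDε]; ring
      _ ≤ _ := by gcongr
  -- Here u is bounded, so D = y^β suffices: the constant exp(2ε²/β) outweighs the loss exp(-εu).
  · have hD1 : 1 ≤ y ^ β := Real.one_le_rpow hy hβ0.le
    have hDk : y / (y ^ β) ^ k = 1 := by
      rw [← Real.rpow_natCast, ← Real.rpow_mul hy0.le, mul_comm β, hkβ, Real.rpow_one,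
        div_self hy0.ne']
    refine (abs_sum_powSupported_mul_le hk hc.le hK ha hX hXs has hy hD1).trans ?_
    rw [hDk]
    have h1 : Real.exp (-(c * √(Real.log (y ^ β)))) ≤ 1 :=
      Real.exp_le_one_iff.2 (by have := mul_nonneg hc.le (Real.sqrt_nonneg (Real.log (y ^ β))); linarith)
    have h2 : 1 ≤ Real.exp (2 * ε ^ 2 / β) * Real.exp (-(ε * u)) := by
      rw [← Real.exp_add]
      refine Real.one_le_exp ?_
      have : ε * u ≤ ε * (2 * ε / β) := by gcongr
      have h3 : ε * (2 * ε / β) = 2 * ε ^ 2 / β := by ring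
      linarith
    calc Q * y ^ β + 1 * (2 * K * y ^ β * Real.exp (-(c * √(Real.log (y ^ β)))))
        ≤ Q * y ^ β + 1 * (2 * K * y ^ β * 1) := by gcongr
      _ = (Q + 2 * K) * y ^ β * 1 := by ring
      _ ≤ (Q + 2 * K) * y ^ β * (Real.exp (2 * ε ^ 2 / β) * Real.exp (-(ε * u))) := by gcongr
      _ = _ := by ring

/-! ### Quotients of real characters and the k-free indicator -/

/-- A completely multiplicative arithmetic function with values in `{-1, 0, 1}`. -/
structure IsRealCharacterLike (u : ArithmeticFunction ℝ) : Prop where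
  map_one : u 1 = 1
  map_mul : ∀ m n : ℕ, u (m * n) = u m * u n
  values : ∀ n, u n = -1 ∨ u n = 0 ∨ u n = 1

/-- The arithmetic function `μ v`. -/
noncomputable def moebiusTwist (v : ArithmeticFunction ℝ) : ArithmeticFunction ℝ :=
  ArithmeticFunction.pmul (ArithmeticFunction.moebius : ArithmeticFunction ℝ) v

lemma moebiusTwist_apply (v : ArithmeticFunction ℝ) (n : ℕ) :
    moebiusTwist v n = (ArithmeticFunction.moebius n : ℝ) * v n := by
  simp [moebiusTwist]

namespace IsRealCharacterLike

variable {u v : ArithmeticFunction ℝ}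

lemma abs_le_one (hu : IsRealCharacterLike u) (n : ℕ) : |u n| ≤ 1 := by
  rcases hu.values n with h | h | h <;> simp [h]

lemma map_pow (hu : IsRealCharacterLike u) (m j : ℕ) : u (m ^ j) = u m ^ j := by
  induction j with
  | zero => simp [hu.map_one]
  | succ j ih => rw [pow_succ, hu.map_mul, ih, pow_succ]

lemma isMultiplicative (hu : IsRealCharacterLike u) : u.IsMultiplicative :=
  ⟨hu.map_one, fun {m n} _ => hu.map_mul m n⟩

/-- Complete multiplicativity pulls v(n) out of the convolution and leaves ζ * μ = 1. -/
lemma mul_moebiusTwist (hv : IsRealCharacterLike v) : v * moebiusTwist v = 1 := by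
  ext n
  have h1 : (v * moebiusTwist v) n = v n * (((ArithmeticFunction.zeta : ArithmeticFunction ℕ) :
      ArithmeticFunction ℝ) * (ArithmeticFunction.moebius : ArithmeticFunction ℝ)) n := by
    rw [ArithmeticFunction.mul_apply, ArithmeticFunction.coe_zeta_mul_apply,
      Nat.sum_divisorsAntidiagonal' (fun a b => v a * moebiusTwist v b), Finset.mul_sum]
    refine Finset.sum_congr rfl fun d hd => ?_
    have := Nat.div_mul_cancel (Nat.dvd_of_mem_divisors hd)
    conv_rhs => rw [← this, hv.map_mul]
    rw [moebiusTwist_apply]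
    simp
    ring
  rw [h1, ArithmeticFunction.coe_zeta_mul_coe_moebius]
  rcases eq_or_ne n 1 with rfl | hn
  · simp [hv.map_one]
  · simp [ArithmeticFunction.one_apply_ne hn]

lemma isMultiplicative_quotient (hu : IsRealCharacterLike u) (hv : IsRealCharacterLike v) :
    (u * moebiusTwist v).IsMultiplicative :=
  hu.isMultiplicative.mul
    (ArithmeticFunction.IsMultiplicative.pmul
      ArithmeticFunction.isMultiplicative_moebius.intCast hv.isMultiplicative)

/-- Only the divisors 1 and p survive the Möbius factor. In particular the quotient vanishes at
powers of primes where u and v agree. -/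
lemma quotient_apply_prime_pow (hu : IsRealCharacterLike u) (hv : IsRealCharacterLike v)
    {p : ℕ} (hp : p.Prime) (j : ℕ) :
    (u * moebiusTwist v) (p ^ (j + 1)) = u p ^ j * (u p - v p) := by
  rw [mul_comm, ArithmeticFunction.mul_apply,
    Nat.sum_divisorsAntidiagonal (fun a b => moebiusTwist v a * u b),
    Nat.sum_divisors_prime_pow hp, Finset.sum_range_succ', Finset.sum_range_succ',
    Finset.sum_eq_zero]
  · rw [pow_zero, Nat.div_one, zero_add, pow_one, moebiusTwist_apply, moebiusTwist_apply,
      ArithmeticFunction.moebius_apply_prime hp, ArithmeticFunction.moebius_apply_one, hv.map_one,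
      pow_succ, Nat.mul_div_cancel _ hp.pos, hu.map_mul, hu.map_pow]
    push_cast; ring
  · intro i _
    rw [moebiusTwist_apply, ArithmeticFunction.moebius_apply_prime_pow hp (by omega),
      if_neg (by omega)]
    simp

lemma abs_quotient_apply_prime_pow_le (hu : IsRealCharacterLike u) (hv : IsRealCharacterLike v)
    (p j : ℕ) (hp : p.Prime) : |(u * moebiusTwist v) (p ^ (j + 1))| ≤ 2 := by
  rw [hu.quotient_apply_prime_pow hv hp, abs_mul, abs_pow]
  have h1 : |u p| ^ j ≤ 1 := pow_le_one₀ (abs_nonneg _) (hu.abs_le_one p)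
  have h2 : |u p - v p| ≤ 2 := by
    rcases hu.values p with h | h | h <;> rcases hv.values p with h' | h' | h' <;>
      rw [h, h'] <;> norm_num
  calc _ ≤ 1 * 2 := mul_le_mul h1 h2 (abs_nonneg _) zero_le_one
    _ = 2 := by norm_num

lemma quotient_mul (hv : IsRealCharacterLike v) (u : ArithmeticFunction ℝ) :
    u * moebiusTwist v * v = u := by
  rw [mul_assoc, mul_comm (moebiusTwist v), hv.mul_moebiusTwist, mul_one]

lemma moebiusTwist_eq (hv : IsRealCharacterLike v) (u : ArithmeticFunction ℝ) :
    v * moebiusTwist u * moebiusTwist v = moebiusTwist u := by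
  rw [mul_right_comm, hv.mul_moebiusTwist, one_mul]

end IsRealCharacterLike

/-- The `k`-free integers are detected by Möbius inversion over `k`-th power divisors. -/
lemma sum_moebius_pow_dvd {k n : ℕ} (hk : k ≠ 0) (hn : n ≠ 0) :
    ∑ d ∈ n.divisors with d ^ k ∣ n, ArithmeticFunction.moebius d = kFreeIndicator k n := by
  -- d^k divides n exactly when d divides `Nat.floorRoot k n`, so the sum is ∑ μ(d) over all
  -- divisors of that root, and n is k-free exactly when the root is 1.
  have hr : Nat.floorRoot k n ≠ 0 := Nat.floorRoot_ne_zero.2 ⟨hk, hn⟩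
  have h1 : (n.divisors.filter fun d => d ^ k ∣ n) = (Nat.floorRoot k n).divisors := by
    ext d
    simp only [Finset.mem_filter, Nat.mem_divisors, Nat.pow_dvd_iff_dvd_floorRoot]
    constructor
    · rintro ⟨-, h⟩; exact ⟨h, hr⟩
    · rintro ⟨h, -⟩
      exact ⟨⟨(dvd_pow_self d hk).trans (Nat.pow_dvd_iff_dvd_floorRoot.2 h), hn⟩, h⟩
  rw [h1, ← ArithmeticFunction.coe_mul_zeta_apply, ArithmeticFunction.moebius_mul_coe_zeta,
    ArithmeticFunction.one_apply, kFreeIndicator]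
  congr 1
  rw [IsKFree, eq_iff_iff]
  constructor
  · intro h p hp hd
    rw [Nat.pow_dvd_iff_dvd_floorRoot, h] at hd
    exact hp.one_lt.ne' (Nat.dvd_one.1 hd)
  · intro h
    by_contra hne
    obtain ⟨p, hp, hd⟩ := Nat.exists_prime_and_dvd hne
    exact h p hp (Nat.pow_dvd_iff_dvd_floorRoot.2 hd)

/-- If d^k ∣ n, then u(d)^k u(n/d^k) = u(n) by complete multiplicativity, so the convolution reduces
to the Möbius sum detecting k-free integers. -/
lemma powSupported_mul_apply {k n : ℕ} (hk : k ≠ 0) (hn : n ≠ 0) {u : ArithmeticFunction ℝ}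
    (hu : IsRealCharacterLike u) :
    (powSupported k (fun d => (ArithmeticFunction.moebius d : ℝ) * u d ^ k) * u) n =
      kFreeIndicator k n * u n := by
  rw [ArithmeticFunction.mul_apply, Nat.sum_divisorsAntidiagonal (fun a b => powSupported k _ a * u b)]
  have h1 : ∀ e ∈ n.divisors, powSupported k
      (fun d => (ArithmeticFunction.moebius d : ℝ) * u d ^ k) e * u (n / e) =
      ∑ d ∈ n.divisors, if d ^ k = e then (ArithmeticFunction.moebius d : ℝ) * u n else 0 := by
    intro e he
    have hen := Nat.dvd_of_mem_divisors he
    rw [powSupported_apply, Finset.sum_mul, ← Finset.sum_filter]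
    refine Finset.sum_congr ?_ fun d hd => ?_
    · ext d
      simp only [Finset.mem_filter, Nat.mem_divisors]
      constructor
      · rintro ⟨⟨h1, -⟩, h3⟩; exact ⟨⟨h1.trans hen, hn⟩, h3⟩
      · rintro ⟨-, h3⟩
        exact ⟨⟨h3 ▸ dvd_pow_self d hk, ne_zero_of_dvd_ne_zero hn hen⟩, h3⟩
    · rw [Finset.mem_filter] at hd
      rw [mul_assoc, ← hu.map_pow, hd.2, ← hu.map_mul, Nat.mul_div_cancel' hen]
  rw [Finset.sum_congr rfl h1, Finset.sum_comm, ← sum_moebius_pow_dvd hk hn]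
  push_cast
  rw [Finset.sum_mul, Finset.sum_filter]
  refine Finset.sum_congr rfl fun d _ => ?_
  rw [Finset.sum_ite_eq]
  simp [hn]

/-! ### Counting exceptional primes and assembling the estimate -/

/-- A bound for a nonnegative weight summed over the primes counts the primes of weight at
least `1`, uniformly down to `x = 1`. -/
lemma exists_card_le_of_isBigO {s : Set ℕ} {w : ℕ → ℝ} {α c : ℝ} (hα : 0 < α) (hc : 0 < c)
    (hs : ∀ p ∈ s, p.Prime) (hw : ∀ p, 0 ≤ w p) (hw1 : ∀ p ∈ s, 1 ≤ w p)
    (h : (fun x : ℝ => ∑ p ∈ primesUpTo x, w p)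
      =O[atTop] fun x : ℝ => x ^ α / Real.exp (c * √(Real.log x))) :
    ∃ C : ℝ, ∀ t : Finset ℕ, ↑t ⊆ s → ∀ x : ℝ, 1 ≤ x → (∀ n ∈ t, (n : ℝ) ≤ x) →
      (t.card : ℝ) ≤ C * x ^ α * Real.exp (-(c * √(Real.log x))) := by
  have hcard : ∀ t : Finset ℕ, ↑t ⊆ s → ∀ x : ℝ, (∀ n ∈ t, (n : ℝ) ≤ x) →
      (t.card : ℝ) ≤ ∑ p ∈ primesUpTo x, w p := by
    intro t ht x hx
    calc (t.card : ℝ) = ∑ p ∈ t, (1 : ℝ) := by simp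
      _ ≤ ∑ p ∈ t, w p := Finset.sum_le_sum fun p hp => hw1 p (ht hp)
      _ ≤ ∑ p ∈ primesUpTo x, w p := by
        refine Finset.sum_le_sum_of_subset_of_nonneg (fun p hp => ?_) fun p _ _ => hw p
        have := hs p (ht hp)
        simp only [primesUpTo, Finset.mem_filter, Finset.mem_Icc]
        exact ⟨⟨this.one_le, Nat.le_floor (hx p hp)⟩, this⟩
  obtain ⟨A, hA, hb⟩ := h.exists_nonneg
  obtain ⟨x₀, hx₀⟩ := eventually_atTop.1 hb.bound
  set x₁ := max x₀ 1
  set S := ∑ p ∈ primesUpTo x₁, w p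
  have hS : 0 ≤ S := Finset.sum_nonneg fun p _ => hw p
  -- A serves beyond x₁; the second summand covers 1 ≤ x ≤ x₁, where the count is at most S.
  refine ⟨A + S * Real.exp (c * √(Real.log x₁)), fun t ht x hx htx => ?_⟩
  have hx0 : 0 < x := by linarith
  have hxα : 1 ≤ x ^ α := Real.one_le_rpow hx hα.le
  rcases le_total x₁ x with hxx | hxx
  · have h1 := hx₀ x ((le_max_left _ _).trans hxx)
    rw [Real.norm_of_nonneg (Finset.sum_nonneg fun p _ => hw p),
      Real.norm_of_nonneg (by positivity), div_eq_mul_inv, ← Real.exp_neg] at h1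
    calc (t.card : ℝ) ≤ A * (x ^ α * Real.exp (-(c * √(Real.log x)))) := (hcard t ht x htx).trans h1
      _ = A * x ^ α * Real.exp (-(c * √(Real.log x))) := by ring
      _ ≤ _ := by
        gcongr
        exact le_add_of_nonneg_right (by positivity)
  · have h1 : (t.card : ℝ) ≤ S := hcard t ht x₁ fun n hn => (htx n hn).trans hxx
    have h2 : 1 ≤ Real.exp (c * √(Real.log x₁)) * Real.exp (-(c * √(Real.log x))) := by
      rw [← Real.exp_add]
      refine Real.one_le_exp ?_
      have : √(Real.log x) ≤ √(Real.log x₁) := Real.sqrt_le_sqrt (Real.log_le_log hx0 hxx)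
      nlinarith
    calc (t.card : ℝ) ≤ S := h1
      _ ≤ S * (x ^ α * (Real.exp (c * √(Real.log x₁)) * Real.exp (-(c * √(Real.log x))))) :=
        le_mul_of_one_le_right hS (one_le_mul_of_one_le_of_one_le hxα h2)
      _ = S * Real.exp (c * √(Real.log x₁)) * x ^ α * Real.exp (-(c * √(Real.log x))) := by ring
      _ ≤ _ := by
        gcongr
        exact le_add_of_nonneg_left hA

/-- The value at 0 is replaced by 0: nothing is assumed about it, and arithmetic functions must
vanish there. -/
lemma isRealCharacterLike_of_values {u : ℕ → ℝ} (h1 : u 1 = 1)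
    (hmul : ∀ m n : ℕ, 1 ≤ m → 1 ≤ n → u (m * n) = u m * u n)
    (hval : ∀ n : ℕ, 1 ≤ n → u n = -1 ∨ u n = 0 ∨ u n = 1) :
    IsRealCharacterLike ⟨fun n => if n = 0 then 0 else u n, by simp⟩ where
  map_one := by simpa using h1
  map_mul m n := by
    simp only [ArithmeticFunction.coe_mk, mul_eq_zero]
    rcases eq_or_ne m 0 with rfl | hm
    · simp
    rcases eq_or_ne n 0 with rfl | hn
    · simp
    simp only [hm, hn, or_self, if_false]
    exact hmul m n (Nat.one_le_iff_ne_zero.2 hm) (Nat.one_le_iff_ne_zero.2 hn)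
  values n := by
    simp only [ArithmeticFunction.coe_mk]
    split_ifs with hn
    · simp
    · exact hval n (Nat.one_le_iff_ne_zero.2 hn)

lemma sum_Icc_ofReal_eq {ψ : ℕ → ℂ} {u : ℕ → ℝ} (h : ∀ n, n ≠ 0 → ψ n = u n) (m : ℕ) :
    ∑ n ∈ Finset.Icc 1 m, ψ n = ((∑ n ∈ Finset.Ioc 0 m, u n : ℝ) : ℂ) := by
  have h1 : Finset.Icc 1 m = Finset.Ioc 0 m := by ext; simp; omega
  rw [h1, Complex.ofReal_sum]
  exact Finset.sum_congr rfl fun n hn => h n (Finset.mem_Ioc.1 hn).1.ne'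

/-- The bound for the Möbius twist of a real character, in real terms. -/
lemma IsRealLFunction.exists_abs_sum_moebiusTwist_le {ψ : ℕ → ℂ} {e : ℕ} {H : ℂ → ℂ}
    (hL : IsRealLFunction ψ e H) {u : ℕ → ℝ} (hu : ∀ n, n ≠ 0 → ψ n = u n) :
    ∃ c K : ℝ, 0 < c ∧ 0 ≤ K ∧ ∀ x : ℝ, 1 ≤ x →
      |∑ n ∈ Finset.Ioc 0 ⌊x⌋₊, (ArithmeticFunction.moebius n : ℝ) * u n| ≤
        K * x * Real.exp (-(c * √(Real.log x))) := by
  obtain ⟨c, K, hc, hK, h⟩ := hL.exists_norm_sum_moebius_le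
  refine ⟨c, K, hc, hK.le, fun x hx => ?_⟩
  have h1 := h x hx
  rwa [sum_Icc_ofReal_eq (u := fun n => (ArithmeticFunction.moebius n : ℝ) * u n),
    Complex.norm_real, Real.norm_eq_abs] at h1
  intro n hn
  simp [hu n hn, mul_comm]

/-- Two real characters that differ at few primes are related by convolution with a function whose
weighted sum converges. -/
lemma IsRealCharacterLike.summable_quotient {u v : ArithmeticFunction ℝ}
    (hu : IsRealCharacterLike u) (hv : IsRealCharacterLike v) {α c : ℝ} (hα : 0 < α) (hc : 0 ≤ c)
    (hs : Summable ({p : ℕ | p.Prime ∧ u p ≠ v p}.indicator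
      fun n : ℕ => (n : ℝ) ^ (-α) * Real.exp (c * √(Real.log n)))) :
    Summable fun n : ℕ => |(u * moebiusTwist v) n| * ((n : ℝ) ^ (-α) *
      Real.exp (c * √(Real.log n))) := by
  refine summable_isMultiplicative_mul_weight (hu.isMultiplicative_quotient hv) hα hc
    zero_le_two (fun p j hp => hu.abs_quotient_apply_prime_pow_le hv p j hp) (fun p j hp hps => ?_) hs
  have h : u p = v p := by
    by_contra hne
    exact hps ⟨hp, hne⟩
  rw [hu.quotient_apply_prime_pow hv hp, h, sub_self, mul_zero]

lemma exists_abs_sum_mul_le {h b : ArithmeticFunction ℝ} {α c K : ℝ} (hc : 0 ≤ c) (hK : 0 ≤ K)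
    (hb : ∀ y : ℝ, 1 ≤ y → |∑ n ∈ Finset.Ioc 0 ⌊y⌋₊, b n| ≤
      K * y ^ α * Real.exp (-(c * √(Real.log y))))
    (hh : Summable fun n : ℕ => |h n| * ((n : ℝ) ^ (-α) * Real.exp (c * √(Real.log n)))) :
    ∃ K' : ℝ, 0 ≤ K' ∧ ∀ x : ℝ, 1 ≤ x → |∑ n ∈ Finset.Ioc 0 ⌊x⌋₊, (h * b) n| ≤
      K' * x ^ α * Real.exp (-(c * √(Real.log x))) :=
  ⟨_, mul_nonneg hK (tsum_nonneg fun n => by positivity), fun _ => abs_sum_mul_le hc hK hb hh⟩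

lemma rpow_mul_exp_le {K K' x α c c' : ℝ} (hx : 1 ≤ x) (hK' : 0 ≤ K') (hK : K ≤ K') (hc : c' ≤ c) :
    K * x ^ α * Real.exp (-(c * √(Real.log x))) ≤ K' * x ^ α * Real.exp (-(c' * √(Real.log x))) := by
  have : 0 ≤ x ^ α := Real.rpow_nonneg (by linarith) _
  gcongr

/-- Summability with the weight `n ^ (-α)` implies summability with the weight `n⁻¹`. -/
lemma summable_weight_one {h : ArithmeticFunction ℝ} {α c : ℝ} (hα : α ≤ 1)
    (hh : Summable fun n : ℕ => |h n| * ((n : ℝ) ^ (-α) * Real.exp (c * √(Real.log n)))) :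
    Summable fun n : ℕ => |h n| * ((n : ℝ) ^ (-1 : ℝ) * Real.exp (c * √(Real.log n))) := by
  refine Summable.of_nonneg_of_le (fun n => by positivity) (fun n => ?_) hh
  rcases eq_or_ne n 0 with rfl | hn
  · simp
  have : (1 : ℝ) ≤ n := by exact_mod_cast Nat.one_le_iff_ne_zero.2 hn
  gcongr

/-- Partial sums of a `k`-free twist of a real character `u` which is close to a real character `v`
with bounded partial sums. -/
lemma exists_abs_sum_kFreeIndicator_mul_le {k : ℕ} (hk : k ≠ 0) {u v : ArithmeticFunction ℝ}
    (hu : IsRealCharacterLike u) (hu0 : ∀ n, n ≠ 0 → u n ≠ 0) (hv : IsRealCharacterLike v)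
    {Q c c₁ c₂ K₁ K₂ : ℝ} (hc : 0 < c)
    (hs : Summable ({p : ℕ | p.Prime ∧ u p ≠ v p}.indicator
      fun n : ℕ => (n : ℝ) ^ (-(k : ℝ)⁻¹) * Real.exp (c * √(Real.log n))))
    (hvs : ∀ n : ℕ, |∑ m ∈ Finset.Ioc 0 n, v m| ≤ Q)
    (hc₁ : 0 < c₁) (hK₁ : 0 ≤ K₁) (hζ : ∀ x : ℝ, 1 ≤ x →
      |∑ n ∈ Finset.Ioc 0 ⌊x⌋₊, (ArithmeticFunction.moebius n : ℝ)| ≤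
        K₁ * x * Real.exp (-(c₁ * √(Real.log x))))
    (hc₂ : 0 < c₂) (hK₂ : 0 ≤ K₂) (hμv : ∀ x : ℝ, 1 ≤ x →
      |∑ n ∈ Finset.Ioc 0 ⌊x⌋₊, (ArithmeticFunction.moebius n : ℝ) * v n| ≤
        K₂ * x * Real.exp (-(c₂ * √(Real.log x)))) :
    ∃ ε K : ℝ, 0 < ε ∧ 0 ≤ K ∧ ∀ x : ℝ, 1 ≤ x →
      |∑ n ∈ Finset.Ioc 0 ⌊x⌋₊, kFreeIndicator k n * u n| ≤
        K * x ^ (k : ℝ)⁻¹ * Real.exp (-(ε * √(Real.log x))) := by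
  have hk0 : (0 : ℝ) < (k : ℝ)⁻¹ := by positivity
  have hk1 : (k : ℝ)⁻¹ ≤ 1 := inv_le_one_of_one_le₀ (by exact_mod_cast Nat.one_le_iff_ne_zero.2 hk)
  have weaken : ∀ c' ≤ c, Summable ({p : ℕ | p.Prime ∧ u p ≠ v p}.indicator
      fun n : ℕ => (n : ℝ) ^ (-(k : ℝ)⁻¹) * Real.exp (c' * √(Real.log n))) := by
    intro c' hc'
    refine Summable.of_nonneg_of_le (fun n => Set.indicator_nonneg (fun n _ => by positivity) n)
      (fun n => Set.indicator_le_indicator ?_) hs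
    gcongr
  have husq : ∀ n, n ≠ 0 → u n ^ 2 = 1 := by
    intro n hn
    rcases hu.values n with h | h | h
    · rw [h]; norm_num
    · exact absurd h (hu0 n hn)
    · rw [h]; norm_num
  set a : ℕ → ℝ := fun d => (ArithmeticFunction.moebius d : ℝ) * u d ^ k with ha
  have ha1 : ∀ n, |a n| ≤ 1 := by
    intro n
    rw [ha, abs_mul, abs_pow]
    refine mul_le_one₀ ?_ (by positivity) (pow_le_one₀ (abs_nonneg _) (hu.abs_le_one n))
    exact_mod_cast ArithmeticFunction.abs_moebius_le_one
  -- Since u² = 1 away from 0, a is μ or μ u according to the parity of k.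
  obtain ⟨c₃, K₃, hc₃, hK₃, has⟩ : ∃ c₃ K₃ : ℝ, 0 < c₃ ∧ 0 ≤ K₃ ∧ ∀ z : ℝ, 1 ≤ z →
      |∑ d ∈ Finset.Ioc 0 ⌊z⌋₊, a d| ≤ K₃ * z * Real.exp (-(c₃ * √(Real.log z))) := by
    rcases Nat.even_or_odd' k with ⟨m, hm | hm⟩
    · refine ⟨c₁, K₁, hc₁, hK₁, fun z hz => ?_⟩
      rw [Finset.sum_congr rfl (g := fun n => (ArithmeticFunction.moebius n : ℝ))]
      · exact hζ z hz
      · intro n hn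
        simp only [ha]
        rw [hm, pow_mul, husq n (Finset.mem_Ioc.1 hn).1.ne', one_pow, mul_one]
    · set c' := min c c₂
      have hc' : 0 < c' := lt_min hc hc₂
      -- For odd k, μ u is the convolution of μ v with the opposite quotient v * μ u. The sums of μ
      -- v have main power x, so the weight with n^(-1) is the relevant one.
      have hsum := summable_weight_one hk1
        (hv.summable_quotient hu hk0 hc'.le (by simpa only [ne_comm] using weaken c' (min_le_left _ _)))
      obtain ⟨K', hK', h1⟩ := exists_abs_sum_mul_le (b := moebiusTwist v) hc'.le hK₂ (fun y hy => by
        simp only [moebiusTwist_apply]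
        refine (hμv y hy).trans ?_
        nth_rw 1 [← Real.rpow_one y]
        exact rpow_mul_exp_le hy hK₂ le_rfl (min_le_right _ _)) hsum
      refine ⟨c', K', hc', hK', fun z hz => ?_⟩
      have h1 := h1 z hz
      rw [hv.moebiusTwist_eq, Real.rpow_one] at h1
      rw [Finset.sum_congr rfl (g := fun n => moebiusTwist u n)]
      · exact h1
      · intro n hn
        simp only [ha]
        rw [hm, pow_succ, pow_mul, husq n (Finset.mem_Ioc.1 hn).1.ne', one_pow, one_mul,
          moebiusTwist_apply]
  obtain ⟨ε, K, hε, hK, hB⟩ := exists_abs_sum_powSupported_mul_le hk hc₃ hK₃ ha1 hv.abs_le_one hvs has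
  set c' := min ε c
  have hc' : 0 < c' := lt_min hε hc
  have hsum := hu.summable_quotient hv hk0 hc'.le (weaken c' (min_le_right _ _))
  obtain ⟨K', hK', h1⟩ := exists_abs_sum_mul_le (b := powSupported k a * v) hc'.le hK
    (fun y hy => (hB y hy).trans (rpow_mul_exp_le hy hK le_rfl (min_le_left _ _))) hsum
  refine ⟨c', K', hc', hK', fun x hx => ?_⟩
  have h1 := h1 x hx
  -- Reassociation: h * (A * v) = A * (h * v) = A * u.
  rw [mul_left_comm, hv.quotient_mul] at h1
  rw [Finset.sum_congr rfl (g := fun n => (powSupported k a * u) n)]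
  · exact h1
  · intro n hn
    exact (powSupported_mul_apply hk (Finset.mem_Ioc.1 hn).1.ne' hu).symm

theorem theorem1p3 (k : ℕ) (hk : 2 ≤ k)
    (g : ℕ → ℤ) (hg_val : ∀ n : ℕ, 1 ≤ n → g n = -1 ∨ g n = 1)
    (hg_mul : IsCompletelyMultiplicative g)
    (q : ℕ) [NeZero q] (χ : DirichletCharacter ℂ q)
    (hχ_real : ∀ a : ZMod q, (χ a).im = 0) (hχ_nonprincipal : χ ≠ 1)
    (hpret : IsPretentious (fun n => (g n : ℂ)) (fun n => χ (n : ZMod q)))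
    (c : ℝ) (hc : 0 < c)
    (hprimes : (fun x : ℝ => ∑ p ∈ primesUpTo x, ‖1 - (g p : ℂ) * χ (p : ZMod q)‖)
      =O[atTop] fun x : ℝ => x ^ (1 / (k : ℝ)) / Real.exp (c * √(Real.log x))) :
    ∃ lam : ℝ, 0 < lam ∧
      (fun x : ℝ => ∑ n ∈ Finset.Icc 1 ⌊x⌋₊, ((kFreeIndicator k n * g n : ℤ) : ℝ))
        =O[atTop] fun x : ℝ =>
          x ^ (1 / (k : ℝ)) / Real.exp (lam * Real.log x ^ (1 / 4 : ℝ)) := by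
  have hk0 : k ≠ 0 := by omega
  have hβ : (0 : ℝ) < (k : ℝ)⁻¹ := by positivity
  rw [one_div] at hprimes ⊢
  have hχre : ∀ a : ZMod q, χ a = ((χ a).re : ℂ) := fun a => by
    apply Complex.ext <;> simp [hχ_real a]
  have hu := isRealCharacterLike_of_values (u := fun n => (g n : ℝ)) (by simp [hg_mul.1])
    (fun m n hm hn => by simp [hg_mul.2 m n hm hn])
    (fun n hn => by rcases hg_val n hn with h | h <;> simp [h])
  have hv := isRealCharacterLike_of_values (u := fun n => (χ (n : ZMod q)).re) (by simp)
    (fun m n _ _ => by simp [hχ_real])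
    (fun n _ => by rcases dirichletCharacter_values hχ_real n with h | h | h <;> simp [h])
  set u : ArithmeticFunction ℝ := ⟨fun n => if n = 0 then 0 else (g n : ℝ), by simp⟩ with hu_def
  set v : ArithmeticFunction ℝ := ⟨fun n => if n = 0 then 0 else (χ (n : ZMod q)).re, by simp⟩
    with hv_def
  have hu_apply : ∀ n, n ≠ 0 → u n = g n := fun n hn => by simp [hu_def, hn]
  have hv_apply : ∀ n : ℕ, n ≠ 0 → χ (n : ZMod q) = v n := fun n hn => by
    rw [hχre]; simp [hv_def, hn]
  obtain ⟨C, hC⟩ := exists_card_le_of_isBigO (s := {p : ℕ | p.Prime ∧ u p ≠ v p}) hβ hc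
    (fun p hp => hp.1) (fun p => norm_nonneg _) (fun p hp => by
      obtain ⟨hp, hne⟩ := hp
      rw [hv_apply p hp.ne_zero]
      rw [hu_apply p hp.ne_zero] at hne
      rcases hg_val p hp.one_le with h | h <;> rcases hv.values p with h' | h' | h' <;>
        simp [h, h'] at hne ⊢ <;> norm_num) hprimes
  -- The series needs an exponent strictly below c; c/2 is used from here on.
  have hs := summable_indicator_of_card_le (fun p hp => hp.1.one_le) hβ (half_pos hc).le
    (half_lt_self hc) hC
  obtain ⟨c₁, K₁, hc₁, hK₁, hζ⟩ :=
    isRealLFunction_zeta.exists_abs_sum_moebiusTwist_le (u := fun _ => 1) (by simp)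
  obtain ⟨c₂, K₂, hc₂, hK₂, hμv⟩ := (isRealLFunction_dirichletCharacter hχ_real
    hχ_nonprincipal).exists_abs_sum_moebiusTwist_le hv_apply
  obtain ⟨ε, K, hε, hK, h⟩ := exists_abs_sum_kFreeIndicator_mul_le hk0 hu
    (fun n hn => by
      rw [hu_apply n hn]
      rcases hg_val n (Nat.one_le_iff_ne_zero.2 hn) with h | h <;> simp [h]) hv (half_pos hc) hs
    (fun n => by
      rw [← Real.norm_eq_abs, ← Complex.norm_real, ← sum_Icc_ofReal_eq hv_apply]
      exact norm_sum_dirichletCharacter_le hχ_nonprincipal n)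
    hc₁ hK₁ (by simpa using hζ) hc₂ hK₂ hμv
  refine ⟨ε, hε, IsBigO.of_bound K ?_⟩
  filter_upwards [eventually_ge_atTop (Real.exp 1)] with x hx
  have hx1 : 1 ≤ x := (Real.one_le_exp zero_le_one).trans hx
  have hx0 : 0 < x := by linarith
  have hlog : 1 ≤ Real.log x := (Real.le_log_iff_exp_le hx0).2 hx
  -- For x ≥ e the saving exp(-ε √log x) is at least as strong as exp(-ε (log x)^(1/4)), so λ = ε
  -- works.
  have hroot : Real.log x ^ (1 / 4 : ℝ) ≤ √(Real.log x) := by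
    rw [Real.sqrt_eq_rpow]
    exact Real.rpow_le_rpow_of_exponent_le hlog (by norm_num)
  have hI : Finset.Icc 1 ⌊x⌋₊ = Finset.Ioc 0 ⌊x⌋₊ := by ext; simp; omega
  rw [hI, Real.norm_eq_abs, Real.norm_of_nonneg (by positivity), div_eq_mul_inv, ← Real.exp_neg,
    ← mul_assoc]
  rw [Finset.sum_congr rfl (g := fun n => (kFreeIndicator k n : ℝ) * u n)]
  · refine (h x hx1).trans ?_
    gcongr
  · intro n hn
    rw [hu_apply n (Finset.mem_Ioc.1 hn).1.ne']
    push_cast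
    rfl
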